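/- Let $K\ge 1$ sources generate data: $X_n=(X_n^1,\dots,X_n^K)$, $n\ge 1$, are independent over time, all $X_n^k$ take values in one measurable space, and the coordinates of $X_n$ may be dependent. Let $\mathsf F$ be a probability distribution (pre-change) and $\mathcal G$ a family of probability distributions (post-change) on the $K$-fold product space. Under $\mathbb P_\infty$ all $X_n$ have law $\mathsf F$; under $\mathbb P_\nu^{\mathsf G}$ ($\nu\ge 0$, $\mathsf G\in\mathcal G$) $X_n$ has law $\mathsf F$ for $n\le\nu$ and $\mathsf G$ for $n>\nu$. Let $\mathsf F^k,\mathsf G^k$ be the $k$-th marginals, $\mathcal A(\mathsf G)=\{k:\mathsf G^k\ne\mathsf F^k\}$ and $\mathcal G^k=\{\mathsf G^k:\mathsf G\in\mathcal G,\ \mathsf G^k\neq\mathsf F^k\}$. Assume that $\mathcal A(\mathsf G)\ne\emptyset$ for every $\mathsf G\in\mathcal G$ and $\mathcal G^k\neq\emptyset$ for every $k$. Only one source is sampled at each time. A policy is a pair $(S,T)$: with $\mathcal F_0^S$ generated by a randomization independent of the data and $\mathcal F_n^S=\sigma(\mathcal F_{n-1}^S,X_n^{S_n})$, the sampled source $S_n\in\{1,\dots,K\}$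 is $\mathcal F^S_{n-1}$-measurable and $T\in\{1,2,\dots\}\cup\{\infty\}$ satisfies $\{T=n\}\in\mathcal F_n^S$ for every $n$. For $\gamma>1$, $\Delta(\gamma)$ is the set of policies with $\mathbb E_\infty[T]\ge\gamma$. The worst-case delay is $$D^{\mathsf G}(S,T)=\sup_{\nu\ge 0}\operatorname{ess\,sup}\mathbb E_\nu^{\mathsf G}\big[T-\nu\,\big|\,\mathcal F_\nu^S(\mathsf G),\,T>\nu\big],\qquad \mathcal F_\nu^S(\mathsf G)=\sigma\big(S_t,X_t^{S_t}: t\le\nu,\ S_t\in\mathcal A(\mathsf G)\big),$$ where the conditional expectation is taken under $\mathbb P_\nu^{\mathsf G}(\,\cdot\,|\,T>\nu)$, and those $\nu$ with $\mathbb P_\nu^{\mathsf G}(T>\nu)=0$ are disregarded. The Round Robin CUSUM policy $(\tilde S,\tilde T)$ with threshold $A=\log\gamma$: fix an ordering $E_1,\dots,E_K$ of the sources, let $\mathsf H^k=|\mathcal G^k|^{-1}\sum_{\mathsf P\in\mathcal G^k}\mathsf P$ and $\xi_n^k=\log\frac{d\mathsf H^k}{d\mathsf F^k}(X_n^k)$.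 Start with $\tilde S_1=E_1$, $Y_0=0$, and set $Y_n=\max\{Y_{n-1},0\}+\xi_n^{\tilde S_n}$. If $Y_n\le 0$, then $\tilde S_{n+1}$ is the source that follows $\tilde S_n$ in the cyclic order $E_1,\dots,E_K,E_1,\dots$; otherwise $\tilde S_{n+1}=\tilde S_n$. Stop at $\tilde T=\inf\{n\ge1:Y_n\ge A\}$. **Proposition.** Suppose there are $\mathsf F^*$ and $\mathsf G^*$ such that $\mathsf F^k=\mathsf F^*$ for every $k$ and $\mathsf G^k=\mathsf G^*$ for every $\mathsf G\in\mathcal G$ and $k\in\mathcal A(\mathsf G)$; that the Kullback–Leibler divergences of $\mathsf G^*$ from $\mathsf F^*$ and of $\mathsf F^*$ from $\mathsf G^*$ are both finite (so that $\mathsf F^*,\mathsf G^*$ are mutually absolutely continuous); and that $\int\big(\log\frac{d\mathsf G^k}{d\mathsf F^k}\big)^2d\mathsf G^k<\infty$ for every $\mathsf G\in\mathcal G$ and $k\in\mathcal A(\mathsf G)$. Then, for every choice of the ordering, $(\tilde S,\tilde T)$ with $A=\log\gamma$ is asymptotically optimal under every $\mathsf G\in\mathcal G$, i.e. $$\lim_{\gamma\to\infty}\frac{D^{\mathsf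 G}(\tilde S,\tilde T)}{\inf\{D^{\mathsf G}(S,T):(S,T)\in\Delta(\gamma)\}}=1 .$$ -/

import Mathlib

open MeasureTheory ProbabilityTheory Filter Topology
open scoped ENNReal

noncomputable section

namespace RoundRobin

/-!
`K` sources take values in a measurable space `𝓧` and exactly one source is sampled per time instant
(`m = 1`), so the size-one sets `{k}` are identified with the sources `k : Fin K`.

A sample point is `ω = (r, x)`: `r : R` is the randomization available to the statistician at time
`0`, and `x n : Fin K → 𝓧` is the vector generated by all the sources at time `n + 1`
(so the observation written `X_{n+1}` on paper is the coordinate `x n`).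
-/

/-- Sample space: initial randomization together with the data of all sources at all times. -/
abbrev Sample (R 𝓧 : Type*) (K : ℕ) : Type _ := R × (ℕ → Fin K → 𝓧)

variable {R 𝓧 : Type*} [MeasurableSpace R] [MeasurableSpace 𝓧] {K : ℕ}

/-! ### The change-point model -/

/-- The local (marginal) distribution `P^k` of source `k` under the global distribution `P`. -/
def marginal (P : Measure (Fin K → 𝓧)) (k : Fin K) : Measure 𝓧 :=
  P.map (fun x => x k)

/-- `𝒜(G)`: the sources whose marginal distribution differs under `F` and `G`. -/
def affected (F G : Measure (Fin K → 𝓧)) : Set (Fin K) :=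
  {k | marginal G k ≠ marginal F k}

/-- `𝒢^k`: the plausible post-change marginal distributions of source `k`. -/
def postMarginals (F : Measure (Fin K → 𝓧)) (𝒢 : Set (Measure (Fin K → 𝓧))) (k : Fin K) :
    Set (Measure 𝓧) :=
  {P | ∃ G ∈ 𝒢, k ∈ affected F G ∧ P = marginal G k}

/-- `ℙ_∞`: no change, the data are i.i.d. from `F` and independent of the randomization. -/
def lawNoChange (ρ : Measure R) (F : Measure (Fin K → 𝓧)) : Measure (Sample R 𝓧 K) :=
  ρ.prod (Measure.infinitePi (fun _ : ℕ => F))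

/-- `ℙ_ν^G`: the first `ν` vectors have distribution `F`, all later ones have distribution `G`;
they are independent over time and of the randomization. -/
def lawChange (ρ : Measure R) (F G : Measure (Fin K → 𝓧)) (ν : ℕ) : Measure (Sample R 𝓧 K) :=
  ρ.prod (Measure.infinitePi (fun n : ℕ => if n < ν then F else G))

/-! ### Policies

A sampling rule is a sequence `S`, where `S n ω` is the source sampled at time `n + 1`. A stopping
time is a function with values in `ℕ∞`, where `⊤` means that no alarm is ever raised. -/

/-- The filtration of the collected observations: `ℱ_0^S` is generated by the randomization and
`ℱ_{n+1}^S = σ(ℱ_n^S, X_{n+1}^{S_{n+1}})`. -/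
@[reducible]
def obsFiltration (S : ℕ → Sample R 𝓧 K → Fin K) : ℕ → MeasurableSpace (Sample R 𝓧 K)
  | 0 => MeasurableSpace.comap Prod.fst inferInstance
  | n + 1 => obsFiltration S n ⊔ MeasurableSpace.comap (fun ω => ω.2 n (S n ω)) inferInstance

/-- `(S, T) ∈ Δ`: the source sampled at time `n + 1` is determined by the observations collected up
to time `n`, and `T` is a positive stopping time of the filtration of the collected observations. -/
structure IsPolicy (S : ℕ → Sample R 𝓧 K → Fin K) (T : Sample R 𝓧 K → ℕ∞) : Prop where
  sampling_measurable : ∀ n, Measurable[obsFiltration S n] (S n)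
  stop_pos : ∀ ω, 1 ≤ T ω
  stop_measurable : ∀ n : ℕ, MeasurableSet[obsFiltration S n] {ω | T ω = (n : ℕ∞)}

/-- `(S, T) ∈ Δ(γ)`: a policy whose expected time to a false alarm is at least `γ`. -/
def InDelta (ρ : Measure R) (F : Measure (Fin K → 𝓧)) (γ : ℝ)
    (S : ℕ → Sample R 𝓧 K → Fin K) (T : Sample R 𝓧 K → ℕ∞) : Prop :=
  IsPolicy S T ∧ ENNReal.ofReal γ ≤ ∫⁻ ω, (T ω : ℝ≥0∞) ∂(lawNoChange ρ F)

/-! ### Detection delay -/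

/-- `ℱ_ν^S(G)`: the `σ`-algebra generated by those samples, up to time `ν`, that were taken from
affected sources, i.e. by `(S_t, X_t^{S_t})` for the times `t ≤ ν` with `S_t ∈ 𝒜(G)`. -/
@[reducible]
def affectedHistory (F G : Measure (Fin K → 𝓧)) (S : ℕ → Sample R 𝓧 K → Fin K) (ν : ℕ) :
    MeasurableSpace (Sample R 𝓧 K) :=
  MeasurableSpace.generateFrom
    {C | ∃ t < ν, ∃ k ∈ affected F G, ∃ B : Set 𝓧, MeasurableSet B ∧
      C = {ω | S t ω = k ∧ ω.2 t k ∈ B}}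

/-- `ℙ_ν^G` conditioned on the event `{T > ν}` (the zero measure if this event is null). -/
def lawGivenNoAlarm (ρ : Measure R) (F G : Measure (Fin K → 𝓧)) (T : Sample R 𝓧 K → ℕ∞) (ν : ℕ) :
    Measure (Sample R 𝓧 K) :=
  ProbabilityTheory.cond (lawChange ρ F G ν) {ω | (ν : ℕ∞) < T ω}

/-- The worst-case conditional expected detection delay
`D^G(S, T) = sup_{ν ≥ 0} esssup 𝔼_ν^G[T - ν | ℱ_ν^S(G), T > ν]`. Change-points `ν` for which
`{T > ν}` is null contribute `0`. -/
def worstDelay (ρ : Measure R) (F G : Measure (Fin K → 𝓧))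
    (S : ℕ → Sample R 𝓧 K → Fin K) (T : Sample R 𝓧 K → ℕ∞) : ℝ≥0∞ :=
  ⨆ ν : ℕ,
    essSup
      (condLExp (affectedHistory F G S ν) (lawGivenNoAlarm ρ F G T ν)
        (fun ω => (T ω : ℝ≥0∞) - (ν : ℝ≥0∞)))
      (lawGivenNoAlarm ρ F G T ν)

/-- `inf {D^G(S, T) : (S, T) ∈ Δ(γ)}`. -/
def optimalDelay (ρ : Measure R) (F G : Measure (Fin K → 𝓧)) (γ : ℝ) : ℝ≥0∞ :=
  ⨅ (S : ℕ → Sample R 𝓧 K → Fin K) (T : Sample R 𝓧 K → ℕ∞) (_ : InDelta ρ F γ S T),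
    worstDelay ρ F G S T

/-- A family of policies indexed by `γ` is asymptotically optimal under `G` if
`D^G(S_γ, T_γ) ∼ inf {D^G(S, T) : (S, T) ∈ Δ(γ)}` as `γ → ∞`, i.e. the ratio tends to `1`.
(With the conventions of `ℝ≥0∞`, a quotient close to `1` has positive and finite terms.) -/
def IsAsymptoticallyOptimal (ρ : Measure R) (F G : Measure (Fin K → 𝓧))
    (S : ℝ → ℕ → Sample R 𝓧 K → Fin K) (T : ℝ → Sample R 𝓧 K → ℕ∞) : Prop :=
  Tendsto (fun γ : ℝ => worstDelay ρ F G (S γ) (T γ) / optimalDelay ρ F G γ) atTop (𝓝 1)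

/-! ### The Round Robin CUSUM policy -/

/-- `H^k`: the uniform mixture of the members of `𝒢^k` (for finite non-empty `𝒢^k`). -/
def mixture (F : Measure (Fin K → 𝓧)) (𝒢 : Set (Measure (Fin K → 𝓧))) (k : Fin K) : Measure 𝓧 :=
  ((postMarginals F 𝒢 k).ncard : ℝ≥0∞)⁻¹ • ∑ᶠ P ∈ postMarginals F 𝒢 k, P

/-- The log-likelihood ratio `log (dH^k/dF^k)`, whose value at `X_n^k` is `ξ_n^k`. -/
def score (F : Measure (Fin K → 𝓧)) (𝒢 : Set (Measure (Fin K → 𝓧))) (k : Fin K) (x : 𝓧) : ℝ :=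
  llr (mixture F 𝒢 k) (marginal F k) x

/-- `cusum F 𝒢 e x n = (Y_n, d)`, where `e d` is the source to be sampled at time `n + 1` and `e` is
the order in which the sources are visited. The next source in this cyclic order is taken
exactly when `Y_n ≤ 0`. -/
def cusum [NeZero K] (F : Measure (Fin K → 𝓧)) (𝒢 : Set (Measure (Fin K → 𝓧)))
    (e : Equiv.Perm (Fin K)) (x : ℕ → Fin K → 𝓧) : ℕ → ℝ × Fin K
  | 0 => (0, 0)
  | n + 1 =>
    let y := (cusum F 𝒢 e x n).1
    let d := (cusum F 𝒢 e x n).2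
    let y' := max y 0 + score F 𝒢 (e d) (x n (e d))
    (y', if y' ≤ 0 then d + 1 else d)

/-- The sampling rule of the Round Robin CUSUM policy. -/
def rrSampling [NeZero K] (F : Measure (Fin K → 𝓧)) (𝒢 : Set (Measure (Fin K → 𝓧)))
    (e : Equiv.Perm (Fin K)) (n : ℕ) (ω : Sample R 𝓧 K) : Fin K :=
  e (cusum F 𝒢 e ω.2 n).2

/-- The alarm time `inf {n ≥ 1 : Y_n ≥ A}` of the Round Robin CUSUM policy (`⊤` if there is no such
`n`). -/
def rrStop [NeZero K] (F : Measure (Fin K → 𝓧)) (𝒢 : Set (Measure (Fin K → 𝓧)))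
    (e : Equiv.Perm (Fin K)) (A : ℝ) (ω : Sample R 𝓧 K) : ℕ∞ :=
  ⨅ (n : ℕ) (_ : 1 ≤ n ∧ A ≤ (cusum F 𝒢 e ω.2 n).1), (n : ℕ∞)

/-! ### The objects above are well defined -/

theorem obsFiltration_mono (S : ℕ → Sample R 𝓧 K → Fin K) : Monotone (obsFiltration S) :=
  monotone_nat_of_le_succ fun n => by
    rw [obsFiltration]
    exact le_sup_left

/-- For a policy, the filtration of the observations consists of sub-`σ`-algebras. -/
theorem IsPolicy.obsFiltration_le {S : ℕ → Sample R 𝓧 K → Fin K} {T : Sample R 𝓧 K → ℕ∞}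
    (h : IsPolicy S T) (n : ℕ) :
    obsFiltration S n ≤ (inferInstance : MeasurableSpace (Sample R 𝓧 K)) := by
  induction n with
  | zero => exact measurable_fst.comap_le
  | succ n ih =>
    rw [obsFiltration]
    refine sup_le ih (Measurable.comap_le ?_)
    have hS : Measurable (S n) := (h.sampling_measurable n).mono ih le_rfl
    have hx : Measurable fun p : (Fin K → 𝓧) × Fin K => p.1 p.2 :=
      measurable_from_prod_countable_left fun k => measurable_pi_apply k
    exact hx.comp (((measurable_pi_apply n).comp measurable_snd).prodMk hS)

/-- For a policy, the history of the affected sources is part of the collected observations. -/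
theorem IsPolicy.affectedHistory_le {S : ℕ → Sample R 𝓧 K → Fin K} {T : Sample R 𝓧 K → ℕ∞}
    (h : IsPolicy S T) (F G : Measure (Fin K → 𝓧)) (ν : ℕ) :
    affectedHistory F G S ν ≤ obsFiltration S ν := by
  refine MeasurableSpace.generateFrom_le ?_
  rintro C ⟨t, ht, k, -, B, hB, rfl⟩
  have h1 : MeasurableSet[obsFiltration S ν] {ω | S t ω = k} :=
    obsFiltration_mono S ht.le _ (h.sampling_measurable t (measurableSet_singleton k))
  have h2 : MeasurableSet[obsFiltration S ν] {ω : Sample R 𝓧 K | ω.2 t (S t ω) ∈ B} := by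
    refine obsFiltration_mono S (Nat.succ_le_of_lt ht) _ ?_
    rw [obsFiltration]
    exact (le_sup_right : _ ≤ obsFiltration S t ⊔ _) _ ⟨B, hB, rfl⟩
  convert! h1.inter h2 using 1
  ext ω
  constructor
  · rintro ⟨rfl, hb⟩
    exact ⟨rfl, hb⟩
  · rintro ⟨rfl, hb⟩
    exact ⟨rfl, hb⟩

theorem measurable_cusum [NeZero K] (F : Measure (Fin K → 𝓧)) (𝒢 : Set (Measure (Fin K → 𝓧)))
    (e : Equiv.Perm (Fin K)) (n : ℕ) :
    Measurable[obsFiltration (rrSampling (R := R) F 𝒢 e) n]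
      fun ω : Sample R 𝓧 K => cusum F 𝒢 e ω.2 n := by
  induction n with
  | zero => exact measurable_const
  | succ n ih =>
    have hstep : Measurable fun q : (ℝ × 𝓧) × Fin K =>
        let y' := max q.1.1 0 + score F 𝒢 (e q.2) q.1.2
        ((y', if y' ≤ 0 then q.2 + 1 else q.2) : ℝ × Fin K) := by
      refine measurable_from_prod_countable_left fun d => ?_
      have hy : Measurable fun a : ℝ × 𝓧 => max a.1 0 + score F 𝒢 (e d) a.2 :=
        (measurable_fst.max measurable_const).add ((measurable_llr _ _).comp measurable_snd)
      exact hy.prodMk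
        (Measurable.ite (hy measurableSet_Iic) measurable_const measurable_const)
    have ih' := ih.mono (obsFiltration_mono _ (Nat.le_succ n)) le_rfl
    have hx : Measurable[obsFiltration (rrSampling (R := R) F 𝒢 e) (n + 1)]
        fun ω : Sample R 𝓧 K => ω.2 n (rrSampling F 𝒢 e n ω) := by
      rw [obsFiltration]
      exact (comap_measurable _).mono le_sup_right le_rfl
    let _ := obsFiltration (rrSampling (R := R) F 𝒢 e) (n + 1)
    exact hstep.comp (((measurable_fst.comp ih').prodMk hx).prodMk (measurable_snd.comp ih'))

/-- The Round Robin CUSUM policy is a policy. -/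
theorem isPolicy_roundRobin [NeZero K] (F : Measure (Fin K → 𝓧))
    (𝒢 : Set (Measure (Fin K → 𝓧))) (e : Equiv.Perm (Fin K)) (A : ℝ) :
    IsPolicy (rrSampling (R := R) F 𝒢 e) (rrStop F 𝒢 e A) where
  sampling_measurable n :=
    (measurable_of_finite e).comp (measurable_snd.comp (measurable_cusum F 𝒢 e n))
  stop_pos ω := le_iInf₂ fun n hn => by exact_mod_cast hn.1
  stop_measurable n := by
    have hle : ∀ m : ℕ, MeasurableSet[obsFiltration (rrSampling (R := R) F 𝒢 e) m]
        {ω | rrStop F 𝒢 e A ω ≤ (m : ℕ∞)} := by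
      intro m
      have : {ω : Sample R 𝓧 K | rrStop F 𝒢 e A ω ≤ (m : ℕ∞)} =
          ⋃ j ∈ Set.Icc 1 m, {ω | A ≤ (cusum F 𝒢 e ω.2 j).1} := by
        ext ω
        simp only [Set.mem_ofPred_eq, Set.mem_iUnion, Set.mem_Icc, exists_prop]
        constructor
        · intro h
          by_contra! hc
          have : ((m + 1 : ℕ) : ℕ∞) ≤ rrStop F 𝒢 e A ω := by
            refine le_iInf₂ fun j hj => ?_
            by_contra! hlt
            have hj' : j < m + 1 := by exact_mod_cast hlt
            exact absurd hj.2 (not_le.mpr (hc j ⟨hj.1, by omega⟩))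
          have h3 := this.trans h
          have h4 : m + 1 ≤ m := by exact_mod_cast h3
          omega
        · rintro ⟨j, hj, hA⟩
          exact (iInf₂_le j ⟨hj.1, hA⟩).trans (by exact_mod_cast hj.2)
      rw [this]
      refine MeasurableSet.biUnion (Set.to_countable _) fun j hj => ?_
      exact obsFiltration_mono _ hj.2 _
        ((measurable_fst.comp (measurable_cusum F 𝒢 e j)) measurableSet_Ici)
    cases n with
    | zero =>
      convert! hle 0 using 1
      ext ω
      simp
    | succ n =>
      convert! (hle (n + 1)).diff (obsFiltration_mono _ (Nat.le_succ n) _ (hle n)) using 1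
      ext ω
      simp only [Set.mem_ofPred_eq, Set.mem_sdiff, not_le]
      constructor
      · intro h
        rw [h]
        exact ⟨le_rfl, by exact_mod_cast Nat.lt_succ_self n⟩
      · rintro ⟨h1, h2⟩
        exact le_antisymm h1 (by simpa using Order.add_one_le_of_lt h2)

end RoundRobin

end

/-! Let `ξ` be the log-likelihood ratio of `Gs` to `Fs`, and let `I` be its mean under `Gs`, the
divergence of `Gs` from `Fs`. One source is seen at a time, so the law of the observations depends
on `F` and `G` only through the marginals (`IsPolicy.trim_sampleLaw`). Both the optimal delay and
the Round Robin delay are `(1 + o(1)) log γ / I`.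

Lower bound (`IsPolicy.optimal_lower_bound`). A mean time to false alarm of at least `γ` forces a
time `ν` at which an alarm within `m` further steps has conditional probability at most `2m/γ`
without a change. After a change the log-likelihood gains on average at most `I` per step, whichever
sources are sampled, and Chebyshev's inequality controls its fluctuations. For `m` slightly below
`log γ / I` an early alarm thus stays unlikely under the changed law.

False alarms (`exp_le_lintegral_rrStop`). Under `F`, `exp Y` grows in mean by at most one per step,
so it needs a mean time of at least `exp A` to reach `exp A`; the threshold `log γ` is therefore
admissible.

Upper bound (`worstDelay_rrStop_le`). The Lyapunov function `delayBound` bounds the remaining delay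
by `A / I` up to lower order, plus a term `α * max y 0` if the current source is unaffected. That
term is harmful only if `y` is of order `A`, so the heart of the proof is that this is unlikely even
given the affected history and no alarm (`measure_affectedHistory_inter_le`). While unaffected
sources are visited the affected history is frozen, and the state is a walk with increments `ξ`
under `Fs`, reset at zero and killed at `A`. The probability of surviving `s` steps and ending above
`εA` must be compared with that of surviving `s` steps.

Let `Λ` be the cumulant generating function of `ξ` under `Fs` and `θ` its least minimizer on `[0,
1]`. An exponential supersolution bounds the first probability by `exp (sΛ(θ) + θ(x - εA))`
(`killedOp_exp_le`), and a walk that never leaves `(0, A)` bounds the second from below by `exp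
(sΛ(θ) + θx)` (`exists_stripProb_ge`), each up to small exponential factors. The comparison is
uniform in the starting point `x` when `s` is a suitable multiple of `A`; longer blocks are observed
only from that many steps before `ν`, and shorter ones start with a nonpositive statistic. -/

namespace RoundRobin

/-! ### Functions of the past, as a pointwise notion. -/

section Past

variable {R 𝓧 : Type*} {K : ℕ}

/-- `f` depends only on the randomization and on the data of the first `n` time instants. -/
def DependsOnPast {β : Type*} (n : ℕ) (f : Sample R 𝓧 K → β) : Prop :=
  ∀ ω ω' : Sample R 𝓧 K, ω.1 = ω'.1 → (∀ t < n, ω.2 t = ω'.2 t) → f ω = f ω'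

theorem DependsOnPast.mono {β : Type*} {m n : ℕ} {f : Sample R 𝓧 K → β} (h : DependsOnPast m f)
    (hmn : m ≤ n) : DependsOnPast n f :=
  fun ω ω' h1 h2 => h ω ω' h1 fun t ht => h2 t (ht.trans_le hmn)

theorem DependsOnPast.comp {β δ : Type*} {n : ℕ} {f : Sample R 𝓧 K → β} (h : DependsOnPast n f)
    (g : β → δ) : DependsOnPast n fun ω => g (f ω) :=
  fun ω ω' h1 h2 => congrArg g (h ω ω' h1 h2)

theorem DependsOnPast.comp₂ {β β' δ : Type*} {n : ℕ} {f : Sample R 𝓧 K → β}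
    {f' : Sample R 𝓧 K → β'} (h : DependsOnPast n f) (h' : DependsOnPast n f') (g : β → β' → δ) :
    DependsOnPast n fun ω => g (f ω) (f' ω) :=
  fun ω ω' h1 h2 => by simp only [h ω ω' h1 h2, h' ω ω' h1 h2]

/-- The `σ`-algebra of all sets that are determined by the first `n` data vectors. -/
@[reducible]
def pastInvariant (R 𝓧 : Type*) (K n : ℕ) : MeasurableSpace (Sample R 𝓧 K) where
  MeasurableSet' C := ∀ ω ω' : Sample R 𝓧 K, ω.1 = ω'.1 → (∀ t < n, ω.2 t = ω'.2 t) →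
    (ω ∈ C ↔ ω' ∈ C)
  measurableSet_empty _ _ _ _ := Iff.rfl
  measurableSet_compl C hC ω ω' h1 h2 := not_congr (hC ω ω' h1 h2)
  measurableSet_iUnion C hC ω ω' h1 h2 := by
    simp only [Set.mem_iUnion]
    exact exists_congr fun i => hC i ω ω' h1 h2

theorem dependsOnPast_of_measurable {β : Type*} [MeasurableSpace β] [MeasurableSingletonClass β]
    {n : ℕ} {f : Sample R 𝓧 K → β} (hf : Measurable[pastInvariant R 𝓧 K n] f) :
    DependsOnPast n f := fun ω ω' h1 h2 =>
  ((hf (measurableSet_singleton (f ω)) ω ω' h1 h2).1 rfl).symm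

end Past

variable {R 𝓧 : Type*} [MeasurableSpace R] [MeasurableSpace 𝓧] {K : ℕ}

/-! ### Resampling one coordinate and the one-step disintegration -/

/-- The law of the randomization and of independent data vectors with distributions `Q n`. -/
noncomputable def sampleLaw (ρ : Measure R) (Q : ℕ → Measure (Fin K → 𝓧)) :
    Measure (Sample R 𝓧 K) :=
  ρ.prod (Measure.infinitePi Q)

instance isProbabilityMeasure_sampleLaw (ρ : Measure R) [IsProbabilityMeasure ρ]
    (Q : ℕ → Measure (Fin K → 𝓧)) [∀ n, IsProbabilityMeasure (Q n)] :
    IsProbabilityMeasure (sampleLaw ρ Q) := by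
  unfold sampleLaw; infer_instance

/-- On a finite box, the redrawn coordinate supplies exactly the factor that the box loses at `n`.
Redrawing replaces a splitting of the product into past, present and future. -/
theorem map_update_infinitePi {E : Type*} [MeasurableSpace E] (Q : ℕ → Measure E)
    [∀ n, IsProbabilityMeasure (Q n)] (n : ℕ) :
    ((Measure.infinitePi Q).prod (Q n)).map (fun p => Function.update p.1 n p.2) =
      Measure.infinitePi Q := by
  refine Measure.eq_infinitePi _ fun s t ht => ?_
  have hm : Measurable fun p : (ℕ → E) × E => Function.update p.1 n p.2 := measurable_update'
  rw [Measure.map_apply hm (.pi s.countable_toSet fun i _ => ht i)]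
  by_cases hn : n ∈ s
  · have : (fun p : (ℕ → E) × E => Function.update p.1 n p.2) ⁻¹' (Set.pi s t) =
        (Set.pi (s.erase n : Finset ℕ) t) ×ˢ t n := by
      ext p
      simp only [Set.mem_preimage, Set.mem_pi, Set.mem_prod, Finset.mem_coe, Finset.mem_erase]
      constructor
      · intro h
        refine ⟨fun i hi => ?_, by simpa using h n hn⟩
        simpa [Function.update_of_ne hi.1] using h i hi.2
      · rintro ⟨h1, h2⟩ i hi
        by_cases h : i = n
        · subst h; simpa using h2
        · simpa [Function.update_of_ne h] using h1 i ⟨h, hi⟩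
    rw [this, Measure.prod_prod, Measure.infinitePi_pi _ fun i _ => ht i, mul_comm,
      Finset.mul_prod_erase _ (fun i => Q i (t i)) hn]
  · have : (fun p : (ℕ → E) × E => Function.update p.1 n p.2) ⁻¹' (Set.pi s t) =
        (Set.pi s t) ×ˢ Set.univ := by
      ext p
      simp only [Set.mem_preimage, Set.mem_pi, Set.mem_prod, Finset.mem_coe, Set.mem_univ,
        and_true]
      refine forall₂_congr fun i hi => ?_
      have h : i ≠ n := fun h => hn (h ▸ hi)
      simp [Function.update_of_ne h]
    rw [this, Measure.prod_prod, Measure.infinitePi_pi _ fun i _ => ht i, measure_univ, mul_one]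

/-- By `map_update_infinitePi` the vector at `n` may be redrawn independently; `s` and `f` do not
notice, as they depend on earlier data only. Just the marginal of the selected source survives, so
dependence between the coordinates of a vector is irrelevant. -/
theorem lintegral_sampled (ρ : Measure R) [IsProbabilityMeasure ρ]
    (Q : ℕ → Measure (Fin K → 𝓧)) [∀ n, IsProbabilityMeasure (Q n)] (n : ℕ)
    {s : Sample R 𝓧 K → Fin K} (hs : Measurable s) (hsp : DependsOnPast n s)
    {f : Sample R 𝓧 K → 𝓧 → ℝ≥0∞} (hf : Measurable (Function.uncurry f))
    (hfp : ∀ x, DependsOnPast n fun ω => f ω x) :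
    ∫⁻ ω, f ω (ω.2 n (s ω)) ∂(sampleLaw ρ Q) =
      ∫⁻ ω, ∫⁻ x, f ω x ∂(marginal (Q n) (s ω)) ∂(sampleLaw ρ Q) := by
  have heval : Measurable fun p : (Fin K → 𝓧) × Fin K => p.1 p.2 :=
    measurable_from_prod_countable_left fun k => measurable_pi_apply k
  have hg : Measurable fun ω : Sample R 𝓧 K => f ω (ω.2 n (s ω)) :=
    hf.comp (measurable_id.prodMk
      (heval.comp (((measurable_pi_apply n).comp measurable_snd).prodMk hs)))
  have hh : Measurable fun p : Sample R 𝓧 K × (Fin K → 𝓧) => f p.1 (p.2 (s p.1)) :=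
    hf.comp (measurable_fst.prodMk
      (heval.comp (measurable_snd.prodMk (hs.comp measurable_fst))))
  have hu : Measurable fun p : (ℕ → Fin K → 𝓧) × (Fin K → 𝓧) => Function.update p.1 n p.2 :=
    measurable_update'
  have hinner : ∀ ω, ∫⁻ x, f ω x ∂(marginal (Q n) (s ω)) =
      ∫⁻ y, f ω (y (s ω)) ∂(Q n) := fun ω => by
    rw [marginal, lintegral_map (f := fun x => f ω x)
      (hf.comp (measurable_const.prodMk measurable_id)) (measurable_pi_apply _)]
  simp_rw [hinner]
  rw [sampleLaw, lintegral_prod _ hg.aemeasurable,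
    lintegral_prod _ (hh.lintegral_prod_right').aemeasurable]
  refine lintegral_congr fun r => ?_
  conv_lhs => rw [← map_update_infinitePi Q n]
  have hgr : Measurable fun x : ℕ → Fin K → 𝓧 => f (r, x) (x n (s (r, x))) :=
    hg.comp (measurable_const.prodMk measurable_id)
  refine (lintegral_map hgr hu).trans ((lintegral_prod _ (hgr.comp hu).aemeasurable).trans ?_)
  refine lintegral_congr fun x => lintegral_congr fun y => ?_
  have hag : ∀ t < n, ((r, Function.update x n y) : Sample R 𝓧 K).2 t =
      ((r, x) : Sample R 𝓧 K).2 t := fun t ht => Function.update_of_ne ht.ne _ _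
  have h1 : s (r, Function.update x n y) = s (r, x) := hsp _ _ rfl hag
  simp only [Function.comp_def, h1, Function.update_self]
  exact hfp _ _ _ rfl hag

/-! ### Observables of a policy depend only on the past -/

/-- By induction `S n` is a function of the first `n` vectors, so the value it selects is a function
of the first `n + 1`. This turns measurability for the observations into the pointwise form that
`lintegral_sampled` needs. -/
theorem IsPolicy.obsFiltration_le_pastInvariant {S : ℕ → Sample R 𝓧 K → Fin K}
    {T : Sample R 𝓧 K → ℕ∞} (h : IsPolicy S T) (n : ℕ) :
    obsFiltration S n ≤ pastInvariant R 𝓧 K n := by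
  induction n with
  | zero =>
    rintro _ ⟨B, -, rfl⟩ ω ω' h1 -
    simp [h1]
  | succ n ih =>
    rw [obsFiltration]
    refine sup_le (fun C hC ω ω' h1 h2 => ih C hC ω ω' h1 fun t ht => h2 t (by omega)) ?_
    rintro _ ⟨B, -, rfl⟩ ω ω' h1 h2
    have hS : DependsOnPast n (S n) :=
      dependsOnPast_of_measurable ((h.sampling_measurable n).mono ih le_rfl)
    have := hS ω ω' h1 fun t ht => h2 t (by omega)
    simp [this, h2 n (by omega)]

theorem IsPolicy.measurable {S : ℕ → Sample R 𝓧 K → Fin K} {T : Sample R 𝓧 K → ℕ∞}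
    (h : IsPolicy S T) {β : Type*} [MeasurableSpace β] {n : ℕ} {f : Sample R 𝓧 K → β}
    (hf : Measurable[obsFiltration S n] f) : Measurable f :=
  hf.mono (h.obsFiltration_le n) le_rfl

theorem IsPolicy.dependsOnPast {S : ℕ → Sample R 𝓧 K → Fin K} {T : Sample R 𝓧 K → ℕ∞}
    (h : IsPolicy S T) {β : Type*} [MeasurableSpace β] [MeasurableSingletonClass β]
    {n : ℕ} {f : Sample R 𝓧 K → β} (hf : Measurable[obsFiltration S n] f) :
    DependsOnPast n f :=
  dependsOnPast_of_measurable (hf.mono (h.obsFiltration_le_pastInvariant n) le_rfl)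

theorem IsPolicy.measurableSet_le {S : ℕ → Sample R 𝓧 K → Fin K} {T : Sample R 𝓧 K → ℕ∞}
    (h : IsPolicy S T) (n : ℕ) : MeasurableSet[obsFiltration S n] {ω | T ω ≤ (n : ℕ∞)} := by
  have : {ω | T ω ≤ (n : ℕ∞)} = ⋃ j ∈ Set.Iic n, {ω | T ω = (j : ℕ∞)} := by
    ext ω
    simp only [Set.mem_ofPred_eq, Set.mem_iUnion, Set.mem_Iic, exists_prop]
    constructor
    · intro hT
      lift T ω to ℕ using (ne_top_of_le_ne_top (ENat.natCast_ne_top n) hT) with j hj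
      exact ⟨j, by exact_mod_cast hT, rfl⟩
    · rintro ⟨j, hj, hT⟩
      rw [hT]; exact_mod_cast hj
  rw [this]
  exact MeasurableSet.biUnion (Set.to_countable _) fun j hj =>
    obsFiltration_mono S hj _ (h.stop_measurable j)

theorem IsPolicy.measurableSet_lt {S : ℕ → Sample R 𝓧 K → Fin K} {T : Sample R 𝓧 K → ℕ∞}
    (h : IsPolicy S T) (n : ℕ) : MeasurableSet[obsFiltration S n] {ω | (n : ℕ∞) < T ω} := by
  convert (h.measurableSet_le n).compl using 1
  ext ω; simp

theorem toENNReal_eq_tsum (t : ℕ∞) :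
    (t : ℝ≥0∞) = ∑' n : ℕ, if (n : ℕ∞) < t then (1 : ℝ≥0∞) else 0 := by
  cases t using ENat.recTopCoe with
  | top => simp
  | coe m =>
    rw [tsum_eq_sum (s := Finset.range m)]
    · rw [Finset.sum_congr rfl (g := fun _ => 1)]
      · simp
      · intro n hn; simp [Finset.mem_range.1 hn]
    · intro n hn; simpa using hn

theorem toENNReal_sub_eq_tsum (t : ℕ∞) (ν : ℕ) :
    (t : ℝ≥0∞) - (ν : ℝ≥0∞) =
      ∑' n : ℕ, if ((ν + n : ℕ) : ℕ∞) < t then (1 : ℝ≥0∞) else 0 := by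
  cases t using ENat.recTopCoe with
  | top => simp
  | coe m =>
    have := toENNReal_eq_tsum ((m - ν : ℕ) : ℕ∞)
    have h2 : ((m : ℕ∞) : ℝ≥0∞) - (ν : ℝ≥0∞) = (((m - ν : ℕ) : ℕ∞) : ℝ≥0∞) := by
      simp
    rw [h2, this]
    refine tsum_congr fun n => ?_
    congr 1
    simp only [Nat.cast_lt, eq_iff_iff]
    omega

end RoundRobin

namespace RoundRobin

variable {R 𝓧 : Type*} [MeasurableSpace R] [MeasurableSpace 𝓧] {K : ℕ}

/-! ### Change of measure on the filtration of the observations -/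

/-- The likelihood of the first `n` observations when an observation from source `k` at time
`t + 1` has likelihood ratio `w t k`. -/
noncomputable def obsLikelihood (S : ℕ → Sample R 𝓧 K → Fin K) (w : ℕ → Fin K → 𝓧 → ℝ≥0∞) (n : ℕ)
    (ω : Sample R 𝓧 K) : ℝ≥0∞ :=
  ∏ t ∈ Finset.range n, w t (S t ω) (ω.2 t (S t ω))

/-- Supplies the π-system on which the change of measure is verified. -/
theorem generateFrom_inter_eq_sup {Ω : Type*} (m₁ m₂ : MeasurableSpace Ω) :
    m₁ ⊔ m₂ = MeasurableSpace.generateFrom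
      {C | ∃ A B, MeasurableSet[m₁] A ∧ MeasurableSet[m₂] B ∧ C = A ∩ B} := by
  refine le_antisymm (sup_le ?_ ?_) (MeasurableSpace.generateFrom_le ?_)
  · exact fun A hA => MeasurableSpace.measurableSet_generateFrom
      ⟨A, Set.univ, hA, MeasurableSet.univ, (Set.inter_univ A).symm⟩
  · exact fun B hB => MeasurableSpace.measurableSet_generateFrom
      ⟨Set.univ, B, MeasurableSet.univ, hB, (Set.univ_inter B).symm⟩
  · rintro _ ⟨A, B, hA, hB, rfl⟩
    exact MeasurableSet.inter ((le_sup_left : m₁ ≤ m₁ ⊔ m₂) _ hA)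
      ((le_sup_right : m₂ ≤ m₁ ⊔ m₂) _ hB)

theorem measurable_sample_eval (n : ℕ) {s : Sample R 𝓧 K → Fin K} (hs : Measurable s) :
    Measurable fun ω : Sample R 𝓧 K => ω.2 n (s ω) := by
  have heval : Measurable fun p : (Fin K → 𝓧) × Fin K => p.1 p.2 :=
    measurable_from_prod_countable_left fun k => measurable_pi_apply k
  exact heval.comp (((measurable_pi_apply n).comp measurable_snd).prodMk hs)

variable {S : ℕ → Sample R 𝓧 K → Fin K} {T : Sample R 𝓧 K → ℕ∞}
  {w : ℕ → Fin K → 𝓧 → ℝ≥0∞}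

theorem measurable_weight (hw : ∀ t k, Measurable (w t k)) (t : ℕ) :
    Measurable fun p : 𝓧 × Fin K => w t p.2 p.1 :=
  measurable_from_prod_countable_left fun k => hw t k

theorem IsPolicy.measurable_obsLikelihood (h : IsPolicy S T) (hw : ∀ t k, Measurable (w t k))
    (n : ℕ) : Measurable (obsLikelihood S w n) := by
  refine Finset.measurable_prod _ fun t _ => ?_
  have hS : Measurable (S t) := h.measurable (h.sampling_measurable t)
  exact (measurable_weight hw t).comp ((measurable_sample_eval t hS).prodMk hS)

theorem IsPolicy.dependsOnPast_obsLikelihood (h : IsPolicy S T) (n : ℕ) :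
    DependsOnPast n (obsLikelihood S w n) := by
  intro ω ω' h1 h2
  refine Finset.prod_congr rfl fun t ht => ?_
  have ht' := Finset.mem_range.1 ht
  have hS : S t ω = S t ω' := (h.dependsOnPast (h.sampling_measurable t)) ω ω' h1
    fun j hj => h2 j (hj.trans ht')
  rw [hS, h2 t ht']

/-- By `lintegral_sampled` a new observation enters only through the marginal of the source chosen
by the past, and the density of that marginal is the next factor of the likelihood. Equality on
intersections of a past event with an event of the new observation extends by a π-λ argument. -/
theorem IsPolicy.trim_sampleLaw (h : IsPolicy S T) (ρ : Measure R) [IsProbabilityMeasure ρ]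
    (Q Q₀ : ℕ → Measure (Fin K → 𝓧)) [∀ n, IsProbabilityMeasure (Q n)]
    [∀ n, IsProbabilityMeasure (Q₀ n)] (hw : ∀ t k, Measurable (w t k))
    (n : ℕ)
    (hQ : ∀ t < n, ∀ k, marginal (Q t) k = (marginal (Q₀ t) k).withDensity (w t k)) :
    (sampleLaw ρ Q).trim (h.obsFiltration_le n) =
      ((sampleLaw ρ Q₀).withDensity (obsLikelihood S w n)).trim (h.obsFiltration_le n) := by
  induction n with
  | zero =>
    refine @Measure.ext _ (obsFiltration S 0) _ _ fun C hC => ?_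
    rw [trim_measurableSet_eq _ hC, trim_measurableSet_eq _ hC]
    have h1 : obsLikelihood S w 0 = 1 := by ext; simp [obsLikelihood]
    rw [h1, withDensity_one]
    obtain ⟨B, hB, rfl⟩ := hC
    have : (Prod.fst ⁻¹' B : Set (Sample R 𝓧 K)) = B ×ˢ Set.univ := by ext; simp
    rw [this, sampleLaw, sampleLaw, Measure.prod_prod, Measure.prod_prod, measure_univ,
      measure_univ]
  | succ n ih =>
    replace ih := ih fun t ht => hQ t (ht.trans n.lt_succ_self)
    have hS : Measurable (S n) := h.measurable (h.sampling_measurable n)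
    have hSp : DependsOnPast n (S n) := h.dependsOnPast (h.sampling_measurable n)
    have key : ∀ A, MeasurableSet[obsFiltration S n] A → ∀ B : Set 𝓧, MeasurableSet B →
        sampleLaw ρ Q (A ∩ (fun ω => ω.2 n (S n ω)) ⁻¹' B) =
          (sampleLaw ρ Q₀).withDensity (obsLikelihood S w (n + 1))
            (A ∩ (fun ω => ω.2 n (S n ω)) ⁻¹' B) := by
      intro A hA B hB
      have hA' := h.obsFiltration_le n _ hA
      have hX := measurable_sample_eval n hS
      have hC : MeasurableSet (A ∩ (fun ω : Sample R 𝓧 K => ω.2 n (S n ω)) ⁻¹' B) :=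
        hA'.inter (hX hB)
      have hAi : Measurable[obsFiltration S n] (A.indicator (1 : Sample R 𝓧 K → ℝ≥0∞)) :=
        (@measurable_const ℝ≥0∞ _ _ (obsFiltration S n) 1).indicator hA
      have hAp : DependsOnPast n (A.indicator (1 : Sample R 𝓧 K → ℝ≥0∞)) := h.dependsOnPast hAi
      have hL := h.measurable_obsLikelihood hw n
      have hmk : Measurable[obsFiltration S n] fun ω : Sample R 𝓧 K => marginal (Q n) (S n ω) B :=
        (measurable_of_finite fun k => marginal (Q n) k B).comp (h.sampling_measurable n)
      have hmu : Measurable[obsFiltration S n] fun ω : Sample R 𝓧 K =>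
          A.indicator (1 : Sample R 𝓧 K → ℝ≥0∞) ω * marginal (Q n) (S n ω) B :=
        (measurable_mul (M := ℝ≥0∞)).comp
          (hAi.prodMk hmk)
      calc sampleLaw ρ Q (A ∩ (fun ω => ω.2 n (S n ω)) ⁻¹' B)
          = ∫⁻ ω, A.indicator 1 ω * B.indicator 1 (ω.2 n (S n ω)) ∂(sampleLaw ρ Q) := by
            rw [← lintegral_indicator_one hC]
            refine lintegral_congr fun ω => ?_
            by_cases h1 : ω ∈ A <;> by_cases h2 : ω.2 n (S n ω) ∈ B <;>
              simp [Set.indicator, h1, h2]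
        _ = ∫⁻ ω, A.indicator 1 ω * marginal (Q n) (S n ω) B ∂(sampleLaw ρ Q) := by
            rw [lintegral_sampled ρ Q n hS hSp
              (f := fun ω x => A.indicator 1 ω * B.indicator 1 x)]
            · refine lintegral_congr fun ω => ?_
              rw [lintegral_const_mul _ (measurable_one.indicator hB), lintegral_indicator_one hB]
            · exact ((measurable_one.indicator hA').comp measurable_fst).mul
                ((measurable_one.indicator hB).comp measurable_snd)
            · exact fun x => hAp.comp fun a => a * B.indicator 1 x
        -- Once the new observation is integrated out, the integrand is measurable for the first `n`
        -- observations, and the induction hypothesis applies.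
        _ = ∫⁻ ω, A.indicator 1 ω * marginal (Q n) (S n ω) B
              ∂((sampleLaw ρ Q₀).withDensity (obsLikelihood S w n)) := by
            rw [← lintegral_trim (h.obsFiltration_le n) hmu, ih,
              lintegral_trim (h.obsFiltration_le n) hmu]
        _ = ∫⁻ ω, obsLikelihood S w n ω * (A.indicator 1 ω * marginal (Q n) (S n ω) B)
              ∂(sampleLaw ρ Q₀) := by
            rw [lintegral_withDensity_eq_lintegral_mul _ hL (h.measurable hmu)]
            rfl
        _ = ∫⁻ ω, obsLikelihood S w n ω * A.indicator 1 ω *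
              (B.indicator 1 (ω.2 n (S n ω)) * w n (S n ω) (ω.2 n (S n ω)))
              ∂(sampleLaw ρ Q₀) := by
            have hwm := measurable_weight hw n
            have hBw : ∀ k, Measurable fun x => B.indicator 1 x * w n k x := fun k =>
              (measurable_one.indicator hB).mul (hw n k)
            rw [lintegral_sampled ρ Q₀ n hS hSp (f := fun ω x =>
              obsLikelihood S w n ω * A.indicator 1 ω * (B.indicator 1 x * w n (S n ω) x))]
            · refine lintegral_congr fun ω => ?_
              rw [lintegral_const_mul _ (hBw _), hQ n n.lt_succ_self,
                withDensity_apply _ hB, mul_assoc]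
              congr 2
              rw [← lintegral_indicator hB]
              refine lintegral_congr fun x => ?_
              by_cases hx : x ∈ B <;> simp [hx]
            · refine (((hL.mul (measurable_one.indicator hA')).comp measurable_fst)).mul
                (((measurable_one.indicator hB).comp measurable_snd).mul ?_)
              exact hwm.comp (measurable_snd.prodMk (hS.comp measurable_fst))
            · exact fun x => ((h.dependsOnPast_obsLikelihood n).comp₂ hAp (· * ·)).comp₂ hSp
                fun a k => a * (B.indicator 1 x * w n k x)
        _ = _ := by
            rw [withDensity_apply _ hC, ← lintegral_indicator hC]
            refine lintegral_congr fun ω => ?_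
            have hsucc : obsLikelihood S w (n + 1) ω =
                obsLikelihood S w n ω * w n (S n ω) (ω.2 n (S n ω)) := Finset.prod_range_succ _ _
            by_cases h1 : ω ∈ A <;> by_cases h2 : ω.2 n (S n ω) ∈ B <;>
              simp [Set.indicator, h1, h2, hsucc]
    have hp1 : IsProbabilityMeasure (sampleLaw (K := K) ρ Q) := inferInstance
    have huniv : sampleLaw ρ Q Set.univ =
        (sampleLaw ρ Q₀).withDensity (obsLikelihood S w (n + 1)) Set.univ := by
      simpa using key Set.univ MeasurableSet.univ Set.univ MeasurableSet.univ
    have hfin : IsFiniteMeasure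
        ((sampleLaw ρ Q₀).withDensity (obsLikelihood S w (n + 1))) :=
      ⟨by rw [← huniv]; exact measure_lt_top _ _⟩
    refine @Measure.ext _ (obsFiltration S (n + 1)) _ _ fun C hC => ?_
    rw [trim_measurableSet_eq _ hC, trim_measurableSet_eq _ hC]
    have hgen : obsFiltration S (n + 1) = _ := generateFrom_inter_eq_sup (obsFiltration S n)
      (MeasurableSpace.comap (fun ω : Sample R 𝓧 K => ω.2 n (S n ω)) inferInstance)
    have hpi : IsPiSystem {C | ∃ A B, MeasurableSet[obsFiltration S n] A ∧
        MeasurableSet[MeasurableSpace.comap (fun ω : Sample R 𝓧 K => ω.2 n (S n ω))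
          inferInstance] B ∧ C = A ∩ B} := by
      rintro _ ⟨A, B, hA, hB, rfl⟩ _ ⟨A', B', hA', hB', rfl⟩ -
      exact ⟨A ∩ A', B ∩ B', MeasurableSet.inter hA hA', MeasurableSet.inter hB hB',
        Set.inter_inter_inter_comm _ _ _ _⟩
    induction C, hC using MeasurableSpace.induction_on_inter hgen hpi with
    | empty => simp
    | basic C hC =>
      obtain ⟨A, _, hA, ⟨B, hB, rfl⟩, rfl⟩ := hC
      exact key A hA B hB
    | compl C hC ihC =>
      have hC' := h.obsFiltration_le (n + 1) _ hC
      rw [measure_compl hC' (measure_ne_top _ _), measure_compl hC' (measure_ne_top _ _), ihC,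
        huniv]
    | iUnion f hd hf ihf =>
      have hf' := fun i => h.obsFiltration_le (n + 1) _ (hf i)
      rw [measure_iUnion hd hf', measure_iUnion hd hf']
      exact tsum_congr ihf

theorem IsPolicy.lintegral_sampleLaw (h : IsPolicy S T) (ρ : Measure R) [IsProbabilityMeasure ρ]
    (Q Q₀ : ℕ → Measure (Fin K → 𝓧)) [∀ n, IsProbabilityMeasure (Q n)]
    [∀ n, IsProbabilityMeasure (Q₀ n)] (hw : ∀ t k, Measurable (w t k))
    (n : ℕ)
    (hQ : ∀ t < n, ∀ k, marginal (Q t) k = (marginal (Q₀ t) k).withDensity (w t k))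
    {φ : Sample R 𝓧 K → ℝ≥0∞} (hφ : Measurable[obsFiltration S n] φ) :
    ∫⁻ ω, φ ω ∂(sampleLaw ρ Q) = ∫⁻ ω, obsLikelihood S w n ω * φ ω ∂(sampleLaw ρ Q₀) := by
  rw [← lintegral_trim (h.obsFiltration_le n) hφ, h.trim_sampleLaw ρ Q Q₀ hw n hQ,
    lintegral_trim (h.obsFiltration_le n) hφ,
    lintegral_withDensity_eq_lintegral_mul _ (h.measurable_obsLikelihood hw n) (h.measurable hφ)]
  rfl

end RoundRobin

namespace RoundRobin

variable {R 𝓧 : Type*} [MeasurableSpace R] [MeasurableSpace 𝓧] {K : ℕ}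
variable {S : ℕ → Sample R 𝓧 K → Fin K} {T : Sample R 𝓧 K → ℕ∞}

/-! ### The universal lower bound on the detection delay -/

/-- The distribution of the data vector at time `n + 1` if the change occurs at time `ν`. -/
noncomputable def changeSeq (F G : Measure (Fin K → 𝓧)) (ν n : ℕ) : Measure (Fin K → 𝓧) :=
  if n < ν then F else G

instance isProbabilityMeasure_changeSeq (F G : Measure (Fin K → 𝓧)) [IsProbabilityMeasure F]
    [IsProbabilityMeasure G] (ν n : ℕ) : IsProbabilityMeasure (changeSeq F G ν n) := by
  unfold changeSeq; split_ifs <;> infer_instance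

theorem lawChange_eq (ρ : Measure R) (F G : Measure (Fin K → 𝓧)) (ν : ℕ) :
    lawChange ρ F G ν = sampleLaw ρ (changeSeq F G ν) := rfl

theorem lawNoChange_eq (ρ : Measure R) (F : Measure (Fin K → 𝓧)) :
    lawNoChange ρ F = sampleLaw ρ (fun _ => F) := rfl

theorem isProbabilityMeasure_marginal (P : Measure (Fin K → 𝓧)) [IsProbabilityMeasure P]
    (k : Fin K) : IsProbabilityMeasure (marginal P k) :=
  Measure.isProbabilityMeasure_map (measurable_pi_apply k).aemeasurable

/-- Laws that agree up to time `n` give the same integral to functions of the first `n`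
observations. -/
theorem IsPolicy.lintegral_congr_law (h : IsPolicy S T) (ρ : Measure R) [IsProbabilityMeasure ρ]
    (F G : Measure (Fin K → 𝓧)) [IsProbabilityMeasure F] [IsProbabilityMeasure G] (ν : ℕ)
    {φ : Sample R 𝓧 K → ℝ≥0∞} (hφ : Measurable[obsFiltration S ν] φ) :
    ∫⁻ ω, φ ω ∂(lawChange ρ F G ν) = ∫⁻ ω, φ ω ∂(lawNoChange ρ F) := by
  rw [lawChange_eq, lawNoChange_eq, h.lintegral_sampleLaw ρ (changeSeq F G ν) (fun _ => F)
    (w := fun _ _ _ => 1) (fun _ _ => measurable_const) ν (fun t ht k => ?_) hφ]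
  · simp [obsLikelihood]
  · rw [changeSeq, if_pos ht]
    exact withDensity_one.symm

theorem IsPolicy.measurable_obs (h : IsPolicy S T) (t : ℕ) {β : Type*} [MeasurableSpace β]
    {g : Fin K → 𝓧 → β} (hg : ∀ k, Measurable (g k)) :
    Measurable[obsFiltration S (t + 1)] fun ω : Sample R 𝓧 K => g (S t ω) (ω.2 t (S t ω)) := by
  have hX : Measurable[obsFiltration S (t + 1)] fun ω : Sample R 𝓧 K => ω.2 t (S t ω) := by
    rw [obsFiltration]
    exact (comap_measurable _).mono le_sup_right le_rfl
  have hS : Measurable[obsFiltration S (t + 1)] (S t) :=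
    (h.sampling_measurable t).mono (obsFiltration_mono S (Nat.le_succ t)) le_rfl
  have hg' : Measurable fun p : 𝓧 × Fin K => g p.2 p.1 :=
    measurable_from_prod_countable_left hg
  exact hg'.comp (hX.prodMk hS)

/-- If the mean time to a false alarm is at least `γ`, then for some time `ν` a false alarm within
the next `m` steps is unlikely, given that none has been raised up to `ν`. -/
theorem IsPolicy.exists_changePoint (h : IsPolicy S T) (P : Measure (Sample R 𝓧 K))
    [IsProbabilityMeasure P] {m : ℕ} (hm : 1 ≤ m) {γ : ℝ} (hγ : 0 < γ)
    (hT : ENNReal.ofReal γ ≤ ∫⁻ ω, (T ω : ℝ≥0∞) ∂P) :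
    ∃ ν : ℕ, P {ω | (ν : ℕ∞) < T ω} ≠ 0 ∧
      ENNReal.ofReal γ * P {ω | (ν : ℕ∞) < T ω ∧ T ω ≤ ((ν + m : ℕ) : ℕ∞)} ≤
        2 * m * P {ω | (ν : ℕ∞) < T ω} := by
  -- Summed over `ν`, the tails give the mean of `T`, at least `γ`, while the windows give at most
  -- `m`. The factor 2 yields a contradiction from the weak inequalities alone, which also hold at
  -- null tails.
  by_contra! hc
  have hlt : ∀ n : ℕ, MeasurableSet {ω | (n : ℕ∞) < T ω} := fun n =>
    h.obsFiltration_le n _ (h.measurableSet_lt n)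
  have hmid : ∀ n : ℕ, MeasurableSet {ω | (n : ℕ∞) < T ω ∧ T ω ≤ ((n + m : ℕ) : ℕ∞)} := fun n =>
    (hlt n).inter (h.obsFiltration_le _ _ (h.measurableSet_le (n + m)))
  have hle : ∀ ν : ℕ, 2 * m * P {ω | (ν : ℕ∞) < T ω} ≤
      ENNReal.ofReal γ * P {ω | (ν : ℕ∞) < T ω ∧ T ω ≤ ((ν + m : ℕ) : ℕ∞)} := fun ν => by
    by_cases h0 : P {ω | (ν : ℕ∞) < T ω} = 0
    · simp [h0]
    · exact (hc ν h0).le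
  have h1 : ∑' ν : ℕ, P {ω | (ν : ℕ∞) < T ω} = ∫⁻ ω, (T ω : ℝ≥0∞) ∂P := by
    simp_rw [toENNReal_eq_tsum]
    rw [lintegral_tsum fun n => (Measurable.ite (hlt n) measurable_const
      measurable_const).aemeasurable]
    refine tsum_congr fun n => ?_
    rw [← lintegral_indicator_one (hlt n)]
    refine lintegral_congr fun ω => ?_
    by_cases hω : (n : ℕ∞) < T ω <;> simp [hω]
  have h2 : ∑' ν : ℕ, P {ω | (ν : ℕ∞) < T ω ∧ T ω ≤ ((ν + m : ℕ) : ℕ∞)} ≤ m := by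
    have : ∀ ν : ℕ, P {ω | (ν : ℕ∞) < T ω ∧ T ω ≤ ((ν + m : ℕ) : ℕ∞)} =
        ∫⁻ ω, {ω | (ν : ℕ∞) < T ω ∧ T ω ≤ ((ν + m : ℕ) : ℕ∞)}.indicator 1 ω ∂P := fun ν =>
      (lintegral_indicator_one (hmid ν)).symm
    simp_rw [this]
    rw [← lintegral_tsum fun n => (measurable_one.indicator (hmid n)).aemeasurable]
    calc _ ≤ ∫⁻ _, (m : ℝ≥0∞) ∂P := by
          refine lintegral_mono fun ω => ?_
          rcases eq_or_ne (T ω) ⊤ with hT | hT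
          · simp [hT, Set.indicator]
          · lift T ω to ℕ using hT with t ht
            -- A finite value `t` lies in the window `(ν, ν + m]` only if `t - m ≤ ν < t`, hence in
            -- at most `m` windows.
            rw [tsum_eq_sum (s := Finset.Ico (t - m) t)]
            · calc _ ≤ ∑ _n ∈ Finset.Ico (t - m) t, (1 : ℝ≥0∞) :=
                    Finset.sum_le_sum fun n _ => Set.indicator_le_self' (by simp) ω
                _ ≤ m := by
                    simp only [Finset.sum_const, Nat.card_Ico, nsmul_eq_mul, mul_one]
                    exact_mod_cast (by omega : t - (t - m) ≤ m)
            · intro n hn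
              refine Set.indicator_of_notMem (fun hmem => hn ?_) _
              simp only [Set.mem_ofPred_eq, ← ht, Nat.cast_lt, Nat.cast_le] at hmem
              simp only [Finset.mem_Ico]
              omega
      _ = m := by simp
  have h3 : 2 * (m : ℝ≥0∞) * ENNReal.ofReal γ ≤ ENNReal.ofReal γ * m := by
    calc _ ≤ 2 * (m : ℝ≥0∞) * ∑' ν : ℕ, P {ω | (ν : ℕ∞) < T ω} := by rw [h1]; gcongr
      _ ≤ ENNReal.ofReal γ *
          ∑' ν : ℕ, P {ω | (ν : ℕ∞) < T ω ∧ T ω ≤ ((ν + m : ℕ) : ℕ∞)} := by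
          rw [← ENNReal.tsum_mul_left, ← ENNReal.tsum_mul_left]
          exact ENNReal.tsum_le_tsum hle
      _ ≤ _ := by gcongr
  have h4 : ENNReal.ofReal (2 * m * γ) ≤ ENNReal.ofReal (γ * m) := by
    rw [ENNReal.ofReal_mul (by positivity), ENNReal.ofReal_mul (by positivity),
      ENNReal.ofReal_mul hγ.le]
    simpa using h3
  have hm' : (1 : ℝ) ≤ m := by exact_mod_cast hm
  rw [ENNReal.ofReal_le_ofReal_iff (by positivity)] at h4
  nlinarith

end RoundRobin

namespace RoundRobin

/-! ### Sums of sampled scores and the change of measure. -/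

section

variable {R 𝓧 : Type*} {K : ℕ} {S : ℕ → Sample R 𝓧 K → Fin K}

/-- Sum of the values `u k x` over those samples from sources in `U` that are taken after `ν` and
up to time `n`. -/
noncomputable def sampledSum (S : ℕ → Sample R 𝓧 K → Fin K) (U : Set (Fin K)) (u : 𝓧 → ℝ)
    (ν n : ℕ) (ω : Sample R 𝓧 K) : ℝ :=
  open Classical in
  ∑ t ∈ Finset.range n, if ν ≤ t ∧ S t ω ∈ U then u (ω.2 t (S t ω)) else 0

theorem sampledSum_succ {U : Set (Fin K)} {u : 𝓧 → ℝ} {ν n : ℕ} (hn : ν ≤ n)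
    (ω : Sample R 𝓧 K) [Decidable (S n ω ∈ U)] :
    sampledSum S U u ν (n + 1) ω =
      sampledSum S U u ν n ω + if S n ω ∈ U then u (ω.2 n (S n ω)) else 0 := by
  classical
  rw [sampledSum, Finset.sum_range_succ]
  simp only [hn, true_and]
  congr

theorem sampledSum_self {U : Set (Fin K)} {u : 𝓧 → ℝ} {ν : ℕ} (ω : Sample R 𝓧 K) :
    sampledSum S U u ν ν ω = 0 := by
  refine Finset.sum_eq_zero fun t ht => if_neg fun h => ?_
  have := Finset.mem_range.1 ht
  omega

end

variable {R 𝓧 : Type*} [MeasurableSpace R] [MeasurableSpace 𝓧] {K : ℕ}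
variable {S : ℕ → Sample R 𝓧 K → Fin K} {T : Sample R 𝓧 K → ℕ∞}

theorem IsPolicy.measurable_sampledSum (h : IsPolicy S T) (U : Set (Fin K)) {u : 𝓧 → ℝ}
    (hu : Measurable u) (ν n : ℕ) : Measurable[obsFiltration S n] (sampledSum S U u ν n) := by
  classical
  refine Finset.measurable_sum _ fun t ht => ?_
  refine Measurable.mono (h.measurable_obs t
    (g := fun k x => if ν ≤ t ∧ k ∈ U then u x else 0) fun k => ?_)
    (obsFiltration_mono S (Nat.succ_le_of_lt (Finset.mem_range.1 ht))) le_rfl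
  split_ifs
  exacts [hu, measurable_const]

/-- The cross term vanishes since `u` is centred: orthogonality of martingale increments. -/
theorem lintegral_ofReal_add_sq (P : Measure 𝓧) [IsProbabilityMeasure P] {u : 𝓧 → ℝ}
    (hu : Integrable u P) (hu2 : Integrable (fun x => u x ^ 2) P) (h0 : ∫ x, u x ∂P = 0) (z : ℝ) :
    ∫⁻ x, ENNReal.ofReal ((z + u x) ^ 2) ∂P =
      ENNReal.ofReal (z ^ 2) + ENNReal.ofReal (∫ x, u x ^ 2 ∂P) := by
  have hi1 : Integrable (fun x => z ^ 2 + 2 * z * u x) P :=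
    (integrable_const _).add (hu.const_mul _)
  have heq : (fun x => (z + u x) ^ 2) = fun x => (z ^ 2 + 2 * z * u x) + u x ^ 2 := by
    ext x; ring
  rw [← ofReal_integral_eq_lintegral_ofReal (by rw [heq]; exact hi1.add hu2)
    (ae_of_all _ fun x => sq_nonneg _), ← ENNReal.ofReal_add (sq_nonneg _)
    (integral_nonneg fun x => sq_nonneg _), heq, integral_add hi1 hu2,
    integral_add (integrable_const _) (hu.const_mul _), integral_const_mul, h0]
  simp

/-- The sum of centred observations has variance at most linear in time. -/
theorem IsPolicy.lintegral_sampledSum_sq_le (h : IsPolicy S T) (ρ : Measure R)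
    [IsProbabilityMeasure ρ] (Q : ℕ → Measure (Fin K → 𝓧)) [∀ n, IsProbabilityMeasure (Q n)]
    {U : Set (Fin K)} {P : Measure 𝓧} [IsProbabilityMeasure P] {ν : ℕ}
    (hQ : ∀ n, ν ≤ n → ∀ k ∈ U, marginal (Q n) k = P) {u : 𝓧 → ℝ} (hum : Measurable u)
    (hu : Integrable u P) (hu2 : Integrable (fun x => u x ^ 2) P) (h0 : ∫ x, u x ∂P = 0)
    {B : Set (Sample R 𝓧 K)} (hB : MeasurableSet[obsFiltration S ν] B) (j : ℕ) :
    ∫⁻ ω in B, ENNReal.ofReal (sampledSum S U u ν (ν + j) ω ^ 2) ∂(sampleLaw ρ Q) ≤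
      j * ENNReal.ofReal (∫ x, u x ^ 2 ∂P) * sampleLaw ρ Q B := by
  classical
  induction j with
  | zero => simp [sampledSum_self]
  | succ j ih =>
    set n := ν + j with hn
    have hνn : ν ≤ n := by omega
    have hB' : MeasurableSet B := h.obsFiltration_le ν _ hB
    have hBn : MeasurableSet[obsFiltration S n] B := obsFiltration_mono S hνn _ hB
    have hBp : DependsOnPast n (B.indicator (1 : Sample R 𝓧 K → ℝ≥0∞)) :=
      h.dependsOnPast ((@measurable_const ℝ≥0∞ _ _ (obsFiltration S n) 1).indicator hBn)
    have hS : Measurable (S n) := h.measurable (h.sampling_measurable n)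
    have hSp : DependsOnPast n (S n) := h.dependsOnPast (h.sampling_measurable n)
    have hZo := h.measurable_sampledSum U hum ν n
    have hZ : Measurable (sampledSum S U u ν n) := h.measurable hZo
    have hZp : DependsOnPast n (sampledSum S U u ν n) := h.dependsOnPast hZo
    have hmk : Measurable fun p : 𝓧 × Fin K => if p.2 ∈ U then u p.1 else 0 :=
      measurable_from_prod_countable_left fun k => by
        by_cases hk : k ∈ U
        · simpa [hk] using hum
        · simp [hk]
    rw [← lintegral_indicator hB']
    calc _ = ∫⁻ ω, B.indicator 1 ω * ENNReal.ofReal ((sampledSum S U u ν n ω +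
            if S n ω ∈ U then u (ω.2 n (S n ω)) else 0) ^ 2) ∂(sampleLaw ρ Q) := by
          refine lintegral_congr fun ω => ?_
          rw [← add_assoc, ← hn, ← sampledSum_succ hνn]
          by_cases hω : ω ∈ B <;> simp [hω]
      _ = ∫⁻ ω, ∫⁻ x, B.indicator 1 ω * ENNReal.ofReal ((sampledSum S U u ν n ω +
            if S n ω ∈ U then u x else 0) ^ 2) ∂(marginal (Q n) (S n ω)) ∂(sampleLaw ρ Q) := by
          refine lintegral_sampled ρ Q n hS hSp (f := fun ω x => B.indicator 1 ω *
            ENNReal.ofReal ((sampledSum S U u ν n ω + if S n ω ∈ U then u x else 0) ^ 2)) ?_ ?_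
          · exact ((measurable_one.indicator hB').comp measurable_fst).mul
              (((hZ.comp measurable_fst).add
                (hmk.comp (measurable_snd.prodMk (hS.comp measurable_fst)))).pow_const
                2).ennreal_ofReal
          · exact fun x => hBp.comp₂ (hZp.comp₂ hSp fun z k =>
              ENNReal.ofReal ((z + if k ∈ U then u x else 0) ^ 2)) (· * ·)
      -- A sample from `U` adds one variance and any other sample adds nothing.
      _ ≤ ∫⁻ ω, B.indicator 1 ω * (ENNReal.ofReal (sampledSum S U u ν n ω ^ 2) +
            ENNReal.ofReal (∫ x, u x ^ 2 ∂P)) ∂(sampleLaw ρ Q) := by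
          refine lintegral_mono fun ω => ?_
          by_cases hk : S n ω ∈ U
          · simp only [hk, if_true, hQ n hνn _ hk]
            rw [lintegral_const_mul _ (by fun_prop), lintegral_ofReal_add_sq P hu hu2 h0]
          · have := isProbabilityMeasure_marginal (Q n) (S n ω)
            simp only [hk, if_false, add_zero, lintegral_const, measure_univ, mul_one]
            gcongr
            exact le_self_add
      _ = ∫⁻ ω in B, ENNReal.ofReal (sampledSum S U u ν n ω ^ 2) ∂(sampleLaw ρ Q) +
            ENNReal.ofReal (∫ x, u x ^ 2 ∂P) * sampleLaw ρ Q B := by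
          simp_rw [mul_add]
          rw [lintegral_add_right _ ((measurable_one.indicator hB').mul_const _),
            lintegral_mul_const _ (measurable_one.indicator hB'), lintegral_indicator_one hB',
            ← lintegral_indicator hB', mul_comm]
          congr 1
          refine lintegral_congr fun ω => ?_
          by_cases hω : ω ∈ B <;> simp [hω]
      _ ≤ _ := by
          refine (add_le_add_left ih _).trans (le_of_eq ?_)
          push_cast
          ring

/-- Change of measure: within `m` steps after the change, the probability of an event exceeds its
probability without change by at most an exponential factor, up to a variance term. -/
theorem IsPolicy.lawChange_le (h : IsPolicy S T) (ρ : Measure R) [IsProbabilityMeasure ρ]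
    (F G : Measure (Fin K → 𝓧)) [IsProbabilityMeasure F] [IsProbabilityMeasure G]
    {Fs Gs : Measure 𝓧} [IsProbabilityMeasure Gs] {ξ : 𝓧 → ℝ} (hξ : Measurable ξ)
    (hF : ∀ k, marginal F k = Fs) (hG : ∀ k ∈ affected F G, marginal G k = Gs)
    (hd : Gs = Fs.withDensity fun x => ENNReal.ofReal (Real.exp (ξ x)))
    (hi : Integrable ξ Gs) (hi2 : Integrable (fun x => (ξ x - ∫ y, ξ y ∂Gs) ^ 2) Gs)
    (hI : 0 < ∫ x, ξ x ∂Gs) (ν : ℕ) {m : ℕ} (hm : 1 ≤ m) {ε : ℝ} (hε : 0 < ε)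
    {B E : Set (Sample R 𝓧 K)} (hB : MeasurableSet[obsFiltration S ν] B)
    (hE : MeasurableSet[obsFiltration S (ν + m)] E) (hEB : E ⊆ B) :
    lawChange ρ F G ν E ≤
      ENNReal.ofReal (Real.exp ((1 + ε) * (∫ x, ξ x ∂Gs) * m)) * lawNoChange ρ F E +
      ENNReal.ofReal ((∫ x, (ξ x - ∫ y, ξ y ∂Gs) ^ 2 ∂Gs) / (ε ^ 2 * (∫ x, ξ x ∂Gs) ^ 2 * m)) *
        lawChange ρ F G ν B := by
  classical
  set I := ∫ x, ξ x ∂Gs with hIdef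
  set V := ∫ x, (ξ x - I) ^ 2 ∂Gs with hV
  set U := affected F G with hU
  have hm0 : (0 : ℝ) < m := by exact_mod_cast hm
  have hB' := h.obsFiltration_le _ _ hB
  have hE' := h.obsFiltration_le _ _ hE
  set w : ℕ → Fin K → 𝓧 → ℝ≥0∞ := fun t k x =>
    ENNReal.ofReal (Real.exp (if ν ≤ t ∧ k ∈ U then ξ x else 0)) with hw
  have hwm : ∀ t k, Measurable (w t k) := fun t k => by
    by_cases hk : ν ≤ t ∧ k ∈ U
    · simpa [hw, hk] using hξ.exp.ennreal_ofReal
    · simp [hw, hk]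
  have hQ : ∀ t < ν + m, ∀ k, marginal (changeSeq F G ν t) k =
      (marginal F k).withDensity (w t k) := fun t _ k => by
    by_cases ht : ν ≤ t
    · by_cases hk : k ∈ U
      · simp only [changeSeq, not_lt.2 ht, if_false, hw, ht, hk, and_self, if_true]
        rw [hG k hk, hF, hd]
      · simp only [changeSeq, not_lt.2 ht, if_false, hw, hk, and_false, Real.exp_zero,
          ENNReal.ofReal_one]
        exact (not_not.1 hk).trans withDensity_one.symm
    · simp only [changeSeq, not_le.1 ht, if_true, hw, ht, false_and, if_false, Real.exp_zero,
        ENNReal.ofReal_one]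
      exact withDensity_one.symm
  set Z := sampledSum S U (fun x => ξ x - I) ν (ν + m) with hZ
  have hL : ∀ ω, obsLikelihood S w (ν + m) ω =
      ENNReal.ofReal (Real.exp (sampledSum S U ξ ν (ν + m) ω)) := fun ω => by
    rw [obsLikelihood, sampledSum, Real.exp_sum,
      ENNReal.ofReal_prod_of_nonneg fun _ _ => (Real.exp_pos _).le]
  -- A sample from an unaffected source contributes zero to the log-likelihood, less than the
  -- allowance `I > 0` per step; hence the bound holds for every sampling rule.
  have hZL : ∀ ω, sampledSum S U ξ ν (ν + m) ω ≤ Z ω + I * m := fun ω => by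
    have hgen : ∀ j : ℕ, sampledSum S U ξ ν (ν + j) ω ≤
        sampledSum S U (fun x => ξ x - I) ν (ν + j) ω + I * j := by
      intro j
      induction j with
      | zero => simp [sampledSum_self]
      | succ j ih =>
        rw [← add_assoc, sampledSum_succ (by omega), sampledSum_succ (by omega)]
        push_cast
        split_ifs <;> linarith
    exact hgen m
  have hZo : Measurable[obsFiltration S (ν + m)] Z :=
    h.measurable_sampledSum U (hξ.sub measurable_const) ν (ν + m)
  have hZm : Measurable Z := h.measurable hZo
  -- Off `D` the likelihood is at most `exp ((1 + ε) * I * m)`; the event `D` itself is handled by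
  -- Chebyshev's inequality.
  set D : Set (Sample R 𝓧 K) := {ω | ε * I * m < Z ω} with hD
  have hDo : MeasurableSet[obsFiltration S (ν + m)] D := hZo measurableSet_Ioi
  have hD' : MeasurableSet D := h.obsFiltration_le _ _ hDo
  have hsplit : lawChange ρ F G ν E ≤ lawChange ρ F G ν (E \ D) + lawChange ρ F G ν (B ∩ D) := by
    refine (measure_mono fun ω hω => ?_).trans (measure_union_le _ _)
    by_cases hωD : ω ∈ D
    exacts [Or.inr ⟨hEB hω, hωD⟩, Or.inl ⟨hω, hωD⟩]
  refine hsplit.trans (add_le_add ?_ ?_)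
  · have hED : MeasurableSet[obsFiltration S (ν + m)] (E \ D) := MeasurableSet.diff hE hDo
    have hED' := h.obsFiltration_le _ _ hED
    have h1 := h.lintegral_sampleLaw ρ (changeSeq F G ν) (fun _ => F) hwm (ν + m) hQ
      (φ := (E \ D).indicator 1)
      ((@measurable_const ℝ≥0∞ _ _ (obsFiltration S (ν + m)) 1).indicator hED)
    rw [lintegral_indicator_one hED'] at h1
    rw [lawChange_eq, h1, lawNoChange_eq]
    calc _ ≤ ∫⁻ ω, ENNReal.ofReal (Real.exp ((1 + ε) * I * m)) * E.indicator 1 ω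
            ∂(sampleLaw ρ fun _ => F) := by
          refine lintegral_mono fun ω => ?_
          by_cases hω : ω ∈ E \ D
          · have hω2 : ¬ ε * I * m < Z ω := hω.2
            simp only [Set.indicator_of_mem hω, Set.indicator_of_mem hω.1, Pi.one_apply, mul_one,
              hL]
            refine ENNReal.ofReal_le_ofReal (Real.exp_le_exp.2 ?_)
            linarith [hZL ω, not_lt.1 hω2]
          · simp [Set.indicator_of_notMem hω]
      _ = _ := by
          rw [lintegral_const_mul _ (measurable_one.indicator hE'), lintegral_indicator_one hE']
  · have h2 := h.lintegral_sampledSum_sq_le ρ (changeSeq F G ν) (U := U) (P := Gs) (ν := ν)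
      (fun n hn k hk => by simp only [changeSeq, not_lt.2 hn, if_false]; exact hG k hk)
      (u := fun x => ξ x - I) (hξ.sub measurable_const) (hi.sub (integrable_const _)) hi2
      (by rw [integral_sub hi (integrable_const _)]; simp [hIdef]) hB m
    have h3 : ENNReal.ofReal ((ε * I * m) ^ 2) * lawChange ρ F G ν (B ∩ D) ≤
        m * ENNReal.ofReal V * lawChange ρ F G ν B := by
      refine le_trans ?_ h2
      rw [lawChange_eq, ← lintegral_indicator hB', ← lintegral_indicator_one (hB'.inter hD'),
        ← lintegral_const_mul _ (measurable_one.indicator (hB'.inter hD'))]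
      refine lintegral_mono fun ω => ?_
      by_cases hω : ω ∈ B ∩ D
      · have hω2 : ε * I * m < Z ω := hω.2
        simp only [Set.indicator_of_mem hω, Set.indicator_of_mem hω.1, Pi.one_apply, mul_one]
        refine ENNReal.ofReal_le_ofReal ?_
        have : 0 < ε * I * m := by positivity
        exact pow_le_pow_left₀ this.le hω2.le 2
      · simp [Set.indicator_of_notMem hω]
    have hpos : 0 < (ε * I * m) ^ 2 := by positivity
    rw [mul_comm, ← ENNReal.le_div_iff_mul_le (Or.inl (by simpa using hpos.ne'))
      (Or.inl ENNReal.ofReal_ne_top)] at h3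
    refine h3.trans (le_of_eq ?_)
    have hV0 : 0 ≤ V := integral_nonneg fun x => sq_nonneg _
    have : V / (ε ^ 2 * I ^ 2 * m) = m * V / (ε * I * m) ^ 2 := by
      field_simp
    rw [this, ENNReal.ofReal_div_of_pos hpos, ENNReal.ofReal_mul hm0.le, ENNReal.ofReal_natCast,
      div_eq_mul_inv, div_eq_mul_inv]
    ring

/-- At the change-point of `exists_changePoint` the delay exceeds `m` unless an alarm falls in the
next `m` steps. `lawChange_le` transfers the probability `2m/γ` of such an alarm to the changed law;
the two subtracted terms are its exponential and its variance part. -/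
theorem IsPolicy.optimal_lower_bound (h : IsPolicy S T) (ρ : Measure R) [IsProbabilityMeasure ρ]
    (F G : Measure (Fin K → 𝓧)) [IsProbabilityMeasure F] [IsProbabilityMeasure G]
    {Fs Gs : Measure 𝓧} [IsProbabilityMeasure Gs] {ξ : 𝓧 → ℝ} (hξ : Measurable ξ)
    (hF : ∀ k, marginal F k = Fs) (hG : ∀ k ∈ affected F G, marginal G k = Gs)
    (hd : Gs = Fs.withDensity fun x => ENNReal.ofReal (Real.exp (ξ x)))
    (hi : Integrable ξ Gs) (hi2 : Integrable (fun x => (ξ x - ∫ y, ξ y ∂Gs) ^ 2) Gs)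
    (hI : 0 < ∫ x, ξ x ∂Gs) {γ : ℝ} (hγ : 0 < γ)
    (hT : ENNReal.ofReal γ ≤ ∫⁻ ω, (T ω : ℝ≥0∞) ∂(lawNoChange ρ F))
    {m : ℕ} (hm : 1 ≤ m) {ε : ℝ} (hε : 0 < ε) :
    ENNReal.ofReal (m * (1 - (Real.exp ((1 + ε) * (∫ x, ξ x ∂Gs) * m) * (2 * m / γ) +
      (∫ x, (ξ x - ∫ y, ξ y ∂Gs) ^ 2 ∂Gs) / (ε ^ 2 * (∫ x, ξ x ∂Gs) ^ 2 * m)))) ≤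
      worstDelay ρ F G S T := by
  set I := ∫ x, ξ x ∂Gs with hIdef
  set V := ∫ x, (ξ x - I) ^ 2 ∂Gs with hV
  have : IsProbabilityMeasure (lawNoChange ρ F) := by rw [lawNoChange_eq]; infer_instance
  obtain ⟨ν, hν0, hν⟩ := h.exists_changePoint (lawNoChange ρ F) hm hγ hT
  have hPν : IsProbabilityMeasure (lawChange ρ F G ν) := by rw [lawChange_eq]; infer_instance
  set B : Set (Sample R 𝓧 K) := {ω | (ν : ℕ∞) < T ω} with hBdef
  set E : Set (Sample R 𝓧 K) := {ω | (ν : ℕ∞) < T ω ∧ T ω ≤ ((ν + m : ℕ) : ℕ∞)} with hEdef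
  have hB : MeasurableSet[obsFiltration S ν] B := h.measurableSet_lt ν
  have hE : MeasurableSet[obsFiltration S (ν + m)] E :=
    MeasurableSet.inter (obsFiltration_mono S (Nat.le_add_right ν m) _ hB)
      (h.measurableSet_le (ν + m))
  have hB' := h.obsFiltration_le _ _ hB
  have hE' := h.obsFiltration_le _ _ hE
  have hEB : E ⊆ B := fun ω hω => hω.1
  have hPB : lawChange ρ F G ν B = lawNoChange ρ F B := by
    rw [← lintegral_indicator_one hB', ← lintegral_indicator_one hB']
    exact h.lintegral_congr_law ρ F G ν
      ((@measurable_const ℝ≥0∞ _ _ (obsFiltration S ν) 1).indicator hB)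
  have hle := h.lawChange_le ρ F G hξ hF hG hd hi hi2 hI ν hm hε hB hE hEB
  have hV0 : 0 ≤ V := integral_nonneg fun x => sq_nonneg _
  have hm0 : (0 : ℝ) < m := by exact_mod_cast hm
  set μ := lawGivenNoAlarm ρ F G T ν with hμ
  have hμp : IsProbabilityMeasure μ := cond_isProbabilityMeasure (by rw [hPB]; exact hν0)
  have hbound : μ E ≤ ENNReal.ofReal (Real.exp ((1 + ε) * I * m) * (2 * m / γ) +
      V / (ε ^ 2 * I ^ 2 * m)) := by
    have h1 : lawNoChange ρ F E ≤ ENNReal.ofReal (2 * m / γ) * lawChange ρ F G ν B := by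
      rw [hPB, ENNReal.ofReal_div_of_pos hγ, ENNReal.ofReal_mul (by norm_num),
        ENNReal.ofReal_natCast, ENNReal.ofReal_ofNat, div_eq_mul_inv, mul_right_comm,
        ← div_eq_mul_inv, ENNReal.le_div_iff_mul_le (Or.inl (by simpa using hγ))
        (Or.inl ENNReal.ofReal_ne_top), mul_comm]
      exact hν
    rw [hμ, lawGivenNoAlarm, ProbabilityTheory.cond_apply hB', Set.inter_eq_right.2 hEB, mul_comm,
      ← div_eq_mul_inv]
    refine ENNReal.div_le_of_le_mul (hle.trans ?_)
    rw [ENNReal.ofReal_add (by positivity) (by positivity), ENNReal.ofReal_mul (by positivity),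
      add_mul (ENNReal.ofReal _ * ENNReal.ofReal _), mul_assoc (ENNReal.ofReal _)]
    gcongr
  have hEc : ENNReal.ofReal (1 - (Real.exp ((1 + ε) * I * m) * (2 * m / γ) +
      V / (ε ^ 2 * I ^ 2 * m))) ≤ μ Eᶜ := by
    rw [prob_compl_eq_one_sub hE', ENNReal.ofReal_sub _ (by positivity), ENNReal.ofReal_one]
    exact tsub_le_tsub_left hbound 1
  have hBc : μ Bᶜ = 0 := by
    rw [hμ, lawGivenNoAlarm, ProbabilityTheory.cond_apply hB']
    simp
  have hmean : (m : ℝ≥0∞) * μ Eᶜ ≤ ∫⁻ ω, ((T ω : ℝ≥0∞) - (ν : ℝ≥0∞)) ∂μ := by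
    rw [← lintegral_indicator_one hE'.compl, ← lintegral_const_mul _
      (measurable_one.indicator hE'.compl)]
    refine lintegral_mono_ae ?_
    filter_upwards [measure_eq_zero_iff_ae_notMem.1 hBc] with ω hω
    have hωB : (ν : ℕ∞) < T ω := by simpa [hBdef] using hω
    by_cases hωE : ω ∈ E
    · simp [hωE]
    · have hlt : ((ν + m : ℕ) : ℕ∞) ≤ T ω := by
        by_contra! hc
        exact hωE ⟨hωB, hc.le⟩
      have hlt' : ((ν + m : ℕ) : ℝ≥0∞) ≤ (T ω : ℝ≥0∞) := by
        have := ENat.toENNReal_le.2 hlt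
        simpa using this
      simp only [Set.indicator_of_mem (Set.mem_compl hωE), Pi.one_apply, mul_one]
      refine ENNReal.le_sub_of_add_le_left (ENNReal.natCast_ne_top ν) ?_
      simpa using hlt'
  -- The essential supremum of a conditional expectation dominates its mean, so the conditioning
  -- costs nothing in the lower bound.
  have hm' : affectedHistory F G S ν ≤ Prod.instMeasurableSpace :=
    (h.affectedHistory_le F G ν).trans (h.obsFiltration_le ν)
  calc _ ≤ (m : ℝ≥0∞) * μ Eᶜ := by
        rw [ENNReal.ofReal_mul hm0.le, ENNReal.ofReal_natCast]
        gcongr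
    _ ≤ _ := hmean
    _ = ∫⁻ ω, condLExp (affectedHistory F G S ν) μ
          (fun ω => (T ω : ℝ≥0∞) - (ν : ℝ≥0∞)) ω ∂μ := (lintegral_condLExp hm' μ _).symm
    _ ≤ ∫⁻ _, essSup (condLExp (affectedHistory F G S ν) μ
          (fun ω => (T ω : ℝ≥0∞) - (ν : ℝ≥0∞))) μ ∂μ := lintegral_mono_ae ae_le_essSup
    _ = essSup (condLExp (affectedHistory F G S ν) μ
          (fun ω => (T ω : ℝ≥0∞) - (ν : ℝ≥0∞))) μ := by simp
    _ ≤ _ := le_iSup (fun ν : ℕ => essSup (condLExp (affectedHistory F G S ν)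
        (lawGivenNoAlarm ρ F G T ν) (fun ω => (T ω : ℝ≥0∞) - (ν : ℝ≥0∞)))
        (lawGivenNoAlarm ρ F G T ν)) ν

end RoundRobin

namespace RoundRobin

variable {R 𝓧 : Type*} [MeasurableSpace 𝓧] {K : ℕ} [NeZero K]

/-! ### The Round Robin CUSUM statistic as a Markov process -/

/-- The update of the state `(y, d)` of the Round Robin CUSUM upon an observation `x`. -/
noncomputable def nextState (ξ : 𝓧 → ℝ) (q : ℝ × Fin K) (x : 𝓧) : ℝ × Fin K :=
  (max q.1 0 + ξ x, if max q.1 0 + ξ x ≤ 0 then q.2 + 1 else q.2)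

/-- The transition operator of the Round Robin CUSUM killed at the level `A`, for observations with
distribution `μ d` in position `d`. -/
noncomputable def killedOp (A : ℝ) (ξ : 𝓧 → ℝ) (μ : Fin K → Measure 𝓧) (f : ℝ × Fin K → ℝ≥0∞)
    (q : ℝ × Fin K) : ℝ≥0∞ :=
  ∫⁻ x, if (nextState ξ q x).1 < A then f (nextState ξ q x) else 0 ∂(μ q.2)

theorem measurable_nextState {ξ : 𝓧 → ℝ} (hξ : Measurable ξ) :
    Measurable fun p : (ℝ × Fin K) × 𝓧 => nextState ξ p.1 p.2 := by
  have h1 : Measurable fun p : (ℝ × Fin K) × 𝓧 => max p.1.1 0 + ξ p.2 :=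
    ((measurable_fst.comp measurable_fst).max measurable_const).add (hξ.comp measurable_snd)
  have h2 : Measurable fun p : (ℝ × Fin K) × 𝓧 => p.1.2 := measurable_snd.comp measurable_fst
  exact h1.prodMk (Measurable.ite (h1 measurableSet_Iic)
    ((measurable_of_finite fun d : Fin K => d + 1).comp h2) h2)

theorem measurable_killed {D : Type*} [MeasurableSpace D] {A : ℝ} {f : ℝ × D → ℝ≥0∞}
    (hf : Measurable f) : Measurable fun q : ℝ × D => if q.1 < A then f q else 0 :=
  Measurable.ite (measurable_fst measurableSet_Iio) hf measurable_const

theorem measurable_killedOp {A : ℝ} {ξ : 𝓧 → ℝ} (hξ : Measurable ξ) (μ : Fin K → Measure 𝓧)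
    [∀ d, SFinite (μ d)] {f : ℝ × Fin K → ℝ≥0∞} (hf : Measurable f) :
    Measurable (killedOp A ξ μ f) := by
  refine measurable_from_prod_countable_left fun d => ?_
  have : Measurable fun p : ℝ × 𝓧 => if (nextState ξ (p.1, d) p.2).1 < A then
      f (nextState ξ (p.1, d) p.2) else 0 :=
    (measurable_killed hf).comp ((measurable_nextState hξ).comp
      ((measurable_fst.prodMk measurable_const).prodMk measurable_snd))
  exact this.lintegral_prod_right' (ν := μ d)

theorem measurable_killedOp_iterate {A : ℝ} {ξ : 𝓧 → ℝ} (hξ : Measurable ξ)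
    (μ : Fin K → Measure 𝓧) [∀ d, SFinite (μ d)] {f : ℝ × Fin K → ℝ≥0∞} (hf : Measurable f)
    (j : ℕ) : Measurable ((killedOp A ξ μ)^[j] f) := by
  induction j with
  | zero => exact hf
  | succ j ih => rw [Function.iterate_succ_apply']; exact measurable_killedOp hξ μ ih

theorem killedOp_mono {A : ℝ} {ξ : 𝓧 → ℝ} {μ : Fin K → Measure 𝓧} {f g : ℝ × Fin K → ℝ≥0∞}
    (hfg : f ≤ g) : killedOp A ξ μ f ≤ killedOp A ξ μ g := fun q =>
  lintegral_mono fun x => by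
    dsimp only
    split_ifs
    exacts [hfg _, le_rfl]

variable {F : Measure (Fin K → 𝓧)} {𝒢 : Set (Measure (Fin K → 𝓧))} {e : Equiv.Perm (Fin K)}
  {ξ : 𝓧 → ℝ}

theorem cusum_succ (hs : ∀ k, score F 𝒢 k = ξ) (x : ℕ → Fin K → 𝓧) (n : ℕ) :
    cusum F 𝒢 e x (n + 1) =
      nextState ξ (cusum F 𝒢 e x n) (x n (e (cusum F 𝒢 e x n).2)) := by
  rw [cusum, nextState, ← hs (e (cusum F 𝒢 e x n).2)]

/-- The indicator of the event that, during `j` steps after time `u`, only positions in `U` are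
sampled and the level `A` is not reached. -/
noncomputable def rrRun (F : Measure (Fin K → 𝓧)) (𝒢 : Set (Measure (Fin K → 𝓧)))
    (e : Equiv.Perm (Fin K)) (A : ℝ) (U : Set (Fin K)) (u j : ℕ) (ω : Sample R 𝓧 K) : ℝ≥0∞ :=
  open Classical in
  ∏ i ∈ Finset.range j,
    if (cusum F 𝒢 e ω.2 (u + i)).2 ∈ U ∧ (cusum F 𝒢 e ω.2 (u + i + 1)).1 < A then 1 else 0

theorem lt_rrStop_iff {A : ℝ} {ω : Sample R 𝓧 K} {n : ℕ} :
    (n : ℕ∞) < rrStop F 𝒢 e A ω ↔ ∀ j, 1 ≤ j → j ≤ n → (cusum F 𝒢 e ω.2 j).1 < A := by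
  constructor
  · intro h j h1 h2
    by_contra! hc
    have : rrStop F 𝒢 e A ω ≤ (j : ℕ∞) := iInf₂_le j ⟨h1, hc⟩
    exact absurd (h.trans_le this) (not_lt.2 (by exact_mod_cast h2))
  · intro h
    refine lt_of_lt_of_le (b := ((n + 1 : ℕ) : ℕ∞)) (by exact_mod_cast n.lt_succ_self) ?_
    refine le_iInf₂ fun j hj => ?_
    by_contra! hlt
    have hj' : j < n + 1 := by exact_mod_cast hlt
    exact absurd hj.2 (not_le.2 (h j hj.1 (by omega)))

theorem lt_rrStop_succ_iff {A : ℝ} {ω : Sample R 𝓧 K} {n : ℕ} :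
    ((n + 1 : ℕ) : ℕ∞) < rrStop F 𝒢 e A ω ↔
      (n : ℕ∞) < rrStop F 𝒢 e A ω ∧ (cusum F 𝒢 e ω.2 (n + 1)).1 < A := by
  simp only [lt_rrStop_iff]
  constructor
  · exact fun h => ⟨fun j h1 h2 => h j h1 (by omega), h _ (by omega) le_rfl⟩
  · rintro ⟨h, h'⟩ j h1 h2
    rcases Nat.lt_or_ge n j with h3 | h3
    · obtain rfl : j = n + 1 := by omega
      exact h'
    · exact h j h1 h3

theorem lt_rrStop_add (A : ℝ) (ω : Sample R 𝓧 K) (ν j : ℕ) :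
    {ω : Sample R 𝓧 K | ((ν + j : ℕ) : ℕ∞) < rrStop F 𝒢 e A ω}.indicator 1 ω =
      {ω : Sample R 𝓧 K | (ν : ℕ∞) < rrStop F 𝒢 e A ω}.indicator 1 ω *
        rrRun F 𝒢 e A Set.univ ν j ω := by
  induction j with
  | zero => simp [rrRun]
  | succ j ih =>
    have : rrRun F 𝒢 e A Set.univ ν (j + 1) ω = rrRun F 𝒢 e A Set.univ ν j ω *
        {ω : Sample R 𝓧 K | (cusum F 𝒢 e ω.2 (ν + j + 1)).1 < A}.indicator 1 ω := by
      rw [rrRun, Finset.prod_range_succ, rrRun]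
      congr 1
      by_cases h : (cusum F 𝒢 e ω.2 (ν + j + 1)).1 < A <;> simp [h]
    rw [this, ← mul_assoc, ← ih]
    by_cases h1 : ((ν + j : ℕ) : ℕ∞) < rrStop F 𝒢 e A ω <;>
      by_cases h2 : (cusum F 𝒢 e ω.2 (ν + j + 1)).1 < A
    all_goals
      have h3 := lt_rrStop_succ_iff (F := F) (𝒢 := 𝒢) (e := e) (A := A) (ω := ω) (n := ν + j)
      rw [add_assoc] at h3
      simp only [Set.indicator, Set.mem_ofPred_eq, h3, h1, h2, false_and, if_true,
        if_false, Pi.one_apply, mul_one, mul_zero]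
      try rw [add_assoc] at h2
      try simp [h2]

variable [MeasurableSpace R]

theorem measurable_cusum_obs (e : Equiv.Perm (Fin K)) (n : ℕ) :
    Measurable[obsFiltration (rrSampling (R := R) F 𝒢 e) n]
      fun ω : Sample R 𝓧 K => cusum F 𝒢 e ω.2 n := measurable_cusum F 𝒢 e n

theorem measurable_cusum' (e : Equiv.Perm (Fin K)) (n : ℕ) :
    Measurable fun ω : Sample R 𝓧 K => cusum F 𝒢 e ω.2 n :=
  (isPolicy_roundRobin F 𝒢 e 0).measurable (measurable_cusum F 𝒢 e n)

theorem dependsOnPast_cusum (e : Equiv.Perm (Fin K)) (n : ℕ) :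
    DependsOnPast n fun ω : Sample R 𝓧 K => cusum F 𝒢 e ω.2 n :=
  (isPolicy_roundRobin F 𝒢 e 0).dependsOnPast (measurable_cusum F 𝒢 e n)

theorem lintegral_cusum_succ (hs : ∀ k, score F 𝒢 k = ξ) (hξ : Measurable ξ) (ρ : Measure R)
    [IsProbabilityMeasure ρ] (Q : ℕ → Measure (Fin K → 𝓧)) [∀ n, IsProbabilityMeasure (Q n)]
    (n : ℕ) {φ : Sample R 𝓧 K → ℝ≥0∞} (hφ : Measurable φ) (hφp : DependsOnPast n φ)
    {f : ℝ × Fin K → ℝ≥0∞} (hf : Measurable f) :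
    ∫⁻ ω, φ ω * f (cusum F 𝒢 e ω.2 (n + 1)) ∂(sampleLaw ρ Q) =
      ∫⁻ ω, φ ω * ∫⁻ x, f (nextState ξ (cusum F 𝒢 e ω.2 n) x)
        ∂(marginal (Q n) (e (cusum F 𝒢 e ω.2 n).2)) ∂(sampleLaw ρ Q) := by
  have hc := measurable_cusum' (R := R) (F := F) (𝒢 := 𝒢) e n
  have hcp := dependsOnPast_cusum (R := R) (F := F) (𝒢 := 𝒢) e n
  have hfn := hf.comp (measurable_nextState (K := K) hξ)
  simp_rw [cusum_succ hs]
  refine (lintegral_sampled ρ Q n (s := fun ω => e (cusum F 𝒢 e ω.2 n).2)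
    ((measurable_of_finite e).comp (measurable_snd.comp hc)) (hcp.comp fun q => e q.2)
    (f := fun ω x => φ ω * f (nextState ξ (cusum F 𝒢 e ω.2 n) x)) ?_ ?_).trans ?_
  · exact (hφ.comp measurable_fst).mul
      (hfn.comp ((hc.comp measurable_fst).prodMk measurable_snd))
  · exact fun x => hφp.comp₂ hcp fun a q => a * f (nextState ξ q x)
  · refine lintegral_congr fun ω => ?_
    exact lintegral_const_mul _ (hfn.comp (measurable_const.prodMk measurable_id))

theorem measurable_rrRun_obs (A : ℝ) (U : Set (Fin K)) (u j : ℕ) :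
    Measurable[obsFiltration (rrSampling (R := R) F 𝒢 e) (u + j)]
      (rrRun (R := R) F 𝒢 e A U u j) := by
  classical
  refine Finset.measurable_prod _ fun i hi => ?_
  have hi' := Finset.mem_range.1 hi
  have h1 := (measurable_cusum_obs (R := R) (F := F) (𝒢 := 𝒢) e (u + i)).mono
    (obsFiltration_mono _ (by omega : u + i ≤ u + j)) le_rfl
  have h2 := (measurable_cusum_obs (R := R) (F := F) (𝒢 := 𝒢) e (u + i + 1)).mono
    (obsFiltration_mono _ (by omega : u + i + 1 ≤ u + j)) le_rfl
  refine Measurable.ite (MeasurableSet.inter ?_ ?_) measurable_const measurable_const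
  · exact (measurable_snd.comp h1) (Set.toFinite U).measurableSet
  · exact (measurable_fst.comp h2) measurableSet_Iio

/-- The Markov property, one step at a time from the end of the run. With `μ d = 0` outside `U`, the
killed operator also kills the process when it samples outside `U`, so one statement covers both
confined runs and `U = Set.univ`. -/
theorem lintegral_rrRun (hs : ∀ k, score F 𝒢 k = ξ) (hξ : Measurable ξ) (ρ : Measure R)
    [IsProbabilityMeasure ρ] (Q : ℕ → Measure (Fin K → 𝓧)) [∀ n, IsProbabilityMeasure (Q n)]
    (A : ℝ) {U : Set (Fin K)} {u : ℕ} {μ : Fin K → Measure 𝓧} [∀ d, SFinite (μ d)]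
    (j : ℕ)
    (hQ : ∀ n, u ≤ n → n < u + j → ∀ d ∈ U, marginal (Q n) (e d) = μ d)
    (hμ : ∀ d ∉ U, μ d = 0) {φ : Sample R 𝓧 K → ℝ≥0∞} (hφ : Measurable φ)
    (hφp : DependsOnPast u φ) {g : ℝ × Fin K → ℝ≥0∞} (hg : Measurable g) :
    ∫⁻ ω, φ ω * rrRun F 𝒢 e A U u j ω * g (cusum F 𝒢 e ω.2 (u + j)) ∂(sampleLaw ρ Q) =
      ∫⁻ ω, φ ω * (killedOp A ξ μ)^[j] g (cusum F 𝒢 e ω.2 u) ∂(sampleLaw ρ Q) := by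
  classical
  induction j generalizing g with
  | zero => simp [rrRun]
  | succ j ih =>
    have hpol := isPolicy_roundRobin (R := R) F 𝒢 e 0
    have hc := measurable_cusum' (R := R) (F := F) (𝒢 := 𝒢) e (u + j)
    have hcp := dependsOnPast_cusum (R := R) (F := F) (𝒢 := 𝒢) e (u + j)
    have hr := measurable_rrRun_obs (R := R) (F := F) (𝒢 := 𝒢) (e := e) A U u j
    set ψ : Sample R 𝓧 K → ℝ≥0∞ := fun ω => φ ω * rrRun F 𝒢 e A U u j ω *
      if (cusum F 𝒢 e ω.2 (u + j)).2 ∈ U then 1 else 0 with hψ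
    have hψm : Measurable ψ := (hφ.mul (hpol.measurable hr)).mul
      (Measurable.ite ((measurable_snd.comp hc) (Set.toFinite U).measurableSet) measurable_const
        measurable_const)
    have hψp : DependsOnPast (u + j) ψ :=
      ((hφp.mono (Nat.le_add_right u j)).comp₂ (hpol.dependsOnPast hr) (· * ·)).comp₂ hcp
        fun a q => a * if q.2 ∈ U then 1 else 0
    rw [Function.iterate_succ_apply, ← ih (fun n h1 h2 => hQ n h1 (by omega))
      (measurable_killedOp hξ μ hg)]
    calc _ = ∫⁻ ω, ψ ω * (fun q : ℝ × Fin K => if q.1 < A then g q else 0)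
            (cusum F 𝒢 e ω.2 (u + j + 1)) ∂(sampleLaw ρ Q) := by
          refine lintegral_congr fun ω => ?_
          have : rrRun F 𝒢 e A U u (j + 1) ω = rrRun F 𝒢 e A U u j ω *
              if (cusum F 𝒢 e ω.2 (u + j)).2 ∈ U ∧ (cusum F 𝒢 e ω.2 (u + j + 1)).1 < A then 1
                else 0 := by
            rw [rrRun, Finset.prod_range_succ, rrRun]
          rw [this, ← add_assoc]
          by_cases h1 : (cusum F 𝒢 e ω.2 (u + j)).2 ∈ U <;>
            by_cases h2 : (cusum F 𝒢 e ω.2 (u + j + 1)).1 < A <;> simp [hψ, h1, h2]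
      _ = _ := by
          rw [lintegral_cusum_succ hs hξ ρ Q (u + j) hψm hψp (measurable_killed hg)]
          refine lintegral_congr fun ω => ?_
          by_cases h1 : (cusum F 𝒢 e ω.2 (u + j)).2 ∈ U
          · simp only [hψ, h1, if_true, mul_one]
            rw [hQ (u + j) (by omega) (by omega) _ h1]
            rfl
          · simp [hψ, h1, killedOp, hμ _ h1]

/-- The mean time to a false alarm of the Round Robin CUSUM with threshold `A` is at least
`exp A`. -/
theorem exp_le_lintegral_rrStop (hs : ∀ k, score F 𝒢 k = ξ) (hξ : Measurable ξ) (ρ : Measure R)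
    [IsProbabilityMeasure ρ] [IsProbabilityMeasure F] {Fs : Measure 𝓧}
    (hF : ∀ k, marginal F k = Fs)
    (hexp : ∫⁻ x, ENNReal.ofReal (Real.exp (ξ x)) ∂Fs = 1) (A : ℝ) :
    ENNReal.ofReal (Real.exp A) ≤ ∫⁻ ω, (rrStop F 𝒢 e A ω : ℝ≥0∞) ∂(lawNoChange ρ F) := by
  have hpol := isPolicy_roundRobin (R := R) F 𝒢 e A
  rw [lawNoChange_eq]
  set P := sampleLaw ρ (fun _ : ℕ => F) with hP
  set alive : ℕ → Set (Sample R 𝓧 K) := fun n => {ω | (n : ℕ∞) < rrStop F 𝒢 e A ω} with halive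
  have hao : ∀ n, MeasurableSet[obsFiltration (rrSampling (R := R) F 𝒢 e) n] (alive n) :=
    fun n => hpol.measurableSet_lt n
  have ham : ∀ n, MeasurableSet (alive n) := fun n => hpol.obsFiltration_le n _ (hao n)
  -- The value `v 0 = 0`, instead of `exp 0 = 1`, keeps `exp (max Y 0) ≤ 1 + v` valid at time zero
  -- and lets the telescoped sum start from zero.
  set v : ℕ → Sample R 𝓧 K → ℝ≥0∞ := fun n ω =>
    if n = 0 then 0 else ENNReal.ofReal (Real.exp (cusum F 𝒢 e ω.2 n).1) with hv
  have hvm : ∀ n, Measurable (v n) := fun n => by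
    rcases Nat.eq_zero_or_pos n with rfl | hn
    · simp [hv]
    · simp only [hv, hn.ne', if_false]
      exact (measurable_fst.comp (measurable_cusum' e n)).exp.ennreal_ofReal
  have hexpm : Measurable fun q : ℝ × Fin K => ENNReal.ofReal (Real.exp q.1) :=
    measurable_fst.exp.ennreal_ofReal
  -- Since `exp ξ` has mean one under `Fs`, the mean of `exp Y` over surviving paths grows by at
  -- most their mass in a step; each path that is stopped carries away at least `exp A`.
  have step : ∀ n, (∫⁻ ω, (alive (n + 1)).indicator 1 ω * v (n + 1) ω ∂P) +
      ENNReal.ofReal (Real.exp A) * P (alive n \ alive (n + 1)) ≤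
      P (alive n) + ∫⁻ ω, (alive n).indicator 1 ω * v n ω ∂P := by
    intro n
    have hd : MeasurableSet (alive n \ alive (n + 1)) := (ham n).diff (ham (n + 1))
    calc _ = ∫⁻ ω, (alive (n + 1)).indicator 1 ω * v (n + 1) ω + ENNReal.ofReal (Real.exp A) *
            (alive n \ alive (n + 1)).indicator 1 ω ∂P := by
          rw [lintegral_add_right _ ((measurable_one.indicator hd).const_mul _),
            lintegral_const_mul _ (measurable_one.indicator hd), lintegral_indicator_one hd]
      _ ≤ ∫⁻ ω, (alive n).indicator 1 ω *
            ENNReal.ofReal (Real.exp (cusum F 𝒢 e ω.2 (n + 1)).1) ∂P := by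
          refine lintegral_mono fun ω => ?_
          have h3 := lt_rrStop_succ_iff (F := F) (𝒢 := 𝒢) (e := e) (A := A) (ω := ω) (n := n)
          by_cases h1 : (n : ℕ∞) < rrStop F 𝒢 e A ω <;>
            by_cases h2 : (cusum F 𝒢 e ω.2 (n + 1)).1 < A <;>
            simp only [Set.indicator, halive, Set.mem_sdiff, Set.mem_ofPred_eq, h3, h1, h2, hv,
              and_self, and_true, and_false, not_true, not_false_eq_true, if_true,
              if_false, Pi.one_apply, mul_one, mul_zero, zero_mul, one_mul, add_zero, zero_add,
              Nat.succ_ne_zero, le_refl]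
          exact ENNReal.ofReal_le_ofReal (Real.exp_le_exp.2 (not_lt.1 h2))
      _ = ∫⁻ ω, (alive n).indicator 1 ω *
            ENNReal.ofReal (Real.exp (max (cusum F 𝒢 e ω.2 n).1 0)) ∂P := by
          rw [hP, lintegral_cusum_succ (f := fun q => ENNReal.ofReal (Real.exp q.1)) hs hξ ρ _ n
            (measurable_one.indicator (ham n)) (hpol.dependsOnPast
              ((@measurable_const ℝ≥0∞ _ _ (obsFiltration _ n) 1).indicator (hao n))) hexpm]
          refine lintegral_congr fun ω => ?_
          simp only [nextState, Real.exp_add, hF, ENNReal.ofReal_mul (Real.exp_pos _).le]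
          rw [lintegral_const_mul _ hξ.exp.ennreal_ofReal, hexp, mul_one]
      _ ≤ ∫⁻ ω, (alive n).indicator 1 ω + (alive n).indicator 1 ω * v n ω ∂P := by
          refine lintegral_mono fun ω => ?_
          rw [← mul_one_add]
          gcongr
          rcases Nat.eq_zero_or_pos n with rfl | hn
          · simp [hv, cusum]
          · simp only [hv, hn.ne', if_false]
            rw [← ENNReal.ofReal_one, ← ENNReal.ofReal_add zero_le_one (Real.exp_pos _).le]
            refine ENNReal.ofReal_le_ofReal ?_
            rcases max_cases (cusum F 𝒢 e ω.2 n).1 0 with h | h <;> rw [h.1]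
            · linarith [Real.exp_pos (cusum F 𝒢 e ω.2 n).1]
            · simp [Real.exp_nonneg]
      _ = _ := by
          rw [lintegral_add_left (measurable_one.indicator (ham n)), lintegral_indicator_one (ham n)]
  have hsum : ∀ N, (∫⁻ ω, (alive N).indicator 1 ω * v N ω ∂P) +
      ENNReal.ofReal (Real.exp A) * P (alive N)ᶜ ≤ ∑ n ∈ Finset.range N, P (alive n) := by
    intro N
    induction N with
    | zero =>
      have : alive 0 = Set.univ := by
        ext ω
        simp only [halive, Set.mem_ofPred_eq, Set.mem_univ, iff_true, lt_rrStop_iff]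
        intro j h1 h2; omega
      simp [hv, this]
    | succ N ih =>
      rw [Finset.sum_range_succ]
      have hsub : (alive (N + 1))ᶜ ⊆ (alive N)ᶜ ∪ (alive N \ alive (N + 1)) := fun ω hω => by
        by_cases h : ω ∈ alive N
        exacts [Or.inr ⟨h, hω⟩, Or.inl h]
      calc _ ≤ (∫⁻ ω, (alive (N + 1)).indicator 1 ω * v (N + 1) ω ∂P) +
            ENNReal.ofReal (Real.exp A) * (P (alive N)ᶜ + P (alive N \ alive (N + 1))) := by
            gcongr
            exact (measure_mono hsub).trans (measure_union_le _ _)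
        _ = ((∫⁻ ω, (alive (N + 1)).indicator 1 ω * v (N + 1) ω ∂P) +
            ENNReal.ofReal (Real.exp A) * P (alive N \ alive (N + 1))) +
            ENNReal.ofReal (Real.exp A) * P (alive N)ᶜ := by ring
        _ ≤ P (alive N) + (∫⁻ ω, (alive N).indicator 1 ω * v N ω ∂P) +
            ENNReal.ofReal (Real.exp A) * P (alive N)ᶜ := by
            gcongr ?_ + _
            exact step N
        _ = ((∫⁻ ω, (alive N).indicator 1 ω * v N ω ∂P) +
            ENNReal.ofReal (Real.exp A) * P (alive N)ᶜ) + P (alive N) := by ring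
        _ ≤ _ := by gcongr
  have hT : ∫⁻ ω, (rrStop F 𝒢 e A ω : ℝ≥0∞) ∂P = ∑' n, P (alive n) := by
    simp_rw [toENNReal_eq_tsum]
    rw [lintegral_tsum fun n => (Measurable.ite (ham n) measurable_const
      measurable_const).aemeasurable]
    refine tsum_congr fun n => ?_
    rw [← lintegral_indicator_one (ham n)]
    refine lintegral_congr fun ω => ?_
    by_cases hω : (n : ℕ∞) < rrStop F 𝒢 e A ω <;> simp [halive, hω]
  rw [hT]
  -- If the mean is finite, survival probabilities tend to zero and `hsum` passes to the limit.
  by_cases htop : ∑' n, P (alive n) = ∞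
  · rw [htop]; exact le_top
  have hlim : Tendsto (fun n => P (alive n)) atTop (𝓝 0) :=
    ENNReal.tendsto_atTop_zero_of_tsum_ne_top htop
  have hcompl : Tendsto (fun n => ENNReal.ofReal (Real.exp A) * P (alive n)ᶜ) atTop
      (𝓝 (ENNReal.ofReal (Real.exp A) * (1 - 0))) := by
    refine ENNReal.Tendsto.const_mul ?_ (Or.inr ENNReal.ofReal_ne_top)
    simp_rw [prob_compl_eq_one_sub (ham _)]
    exact ENNReal.Tendsto.sub tendsto_const_nhds hlim (Or.inl ENNReal.one_ne_top)
  rw [tsub_zero, mul_one] at hcompl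
  exact le_of_tendsto' hcompl fun N =>
    (le_add_self.trans (hsum N)).trans (ENNReal.sum_le_tsum _)

end RoundRobin

namespace RoundRobin

/-! ### Log-likelihood ratios -/

/-- `ξ` is the log-likelihood ratio of `Gs` with respect to `Fs`; the two Kullback-Leibler
divergences are finite and positive. -/
structure IsLogRatio {𝓧 : Type*} [MeasurableSpace 𝓧] (ξ : 𝓧 → ℝ) (Fs Gs : Measure 𝓧) : Prop where
  measurable : Measurable ξ
  left_prob : IsProbabilityMeasure Fs
  right_prob : IsProbabilityMeasure Gs
  density : Gs = Fs.withDensity fun x => ENNReal.ofReal (Real.exp (ξ x))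
  integrable_left : Integrable ξ Fs
  integrable_right : Integrable ξ Gs
  left_neg : ∫ x, ξ x ∂Fs < 0
  right_pos : 0 < ∫ x, ξ x ∂Gs

namespace IsLogRatio

variable {𝓧 : Type*} [MeasurableSpace 𝓧] {ξ : 𝓧 → ℝ} {Fs Gs : Measure 𝓧}

theorem lintegral_exp (h : IsLogRatio ξ Fs Gs) :
    ∫⁻ x, ENNReal.ofReal (Real.exp (ξ x)) ∂Fs = 1 := by
  have := h.right_prob.measure_univ
  rw [h.density, withDensity_apply _ MeasurableSet.univ, Measure.restrict_univ] at this
  exact this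

theorem integrable_exp (h : IsLogRatio ξ Fs Gs) : Integrable (fun x => Real.exp (ξ x)) Fs := by
  refine ⟨h.measurable.exp.aestronglyMeasurable, ?_⟩
  rw [hasFiniteIntegral_iff_ofReal (ae_of_all _ fun x => (Real.exp_pos _).le), h.lintegral_exp]
  exact ENNReal.one_lt_top

theorem integral_exp (h : IsLogRatio ξ Fs Gs) : ∫ x, Real.exp (ξ x) ∂Fs = 1 := by
  rw [integral_eq_lintegral_of_nonneg_ae (ae_of_all _ fun x => (Real.exp_pos _).le)
    h.measurable.exp.aestronglyMeasurable, h.lintegral_exp, ENNReal.toReal_one]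

theorem integrable_exp_mul (h : IsLogRatio ξ Fs Gs) {t : ℝ} (h0 : 0 ≤ t) (h1 : t ≤ 1) :
    Integrable (fun x => Real.exp (t * ξ x)) Fs := by
  have := h.left_prob
  refine Integrable.mono' ((integrable_const (1 : ℝ)).add h.integrable_exp)
    (h.measurable.const_mul t).exp.aestronglyMeasurable (ae_of_all _ fun x => ?_)
  rw [Real.norm_of_nonneg (Real.exp_pos _).le, Pi.add_apply]
  rcases le_total (ξ x) 0 with hx | hx
  · have : Real.exp (t * ξ x) ≤ 1 := Real.exp_le_one_iff.2 (mul_nonpos_of_nonneg_of_nonpos h0 hx)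
    linarith [Real.exp_pos (ξ x)]
  · have : Real.exp (t * ξ x) ≤ Real.exp (ξ x) := Real.exp_le_exp.2 (by nlinarith)
    linarith

theorem integral_right (h : IsLogRatio ξ Fs Gs) (f : 𝓧 → ℝ) :
    ∫ x, f x ∂Gs = ∫ x, Real.exp (ξ x) * f x ∂Fs := by
  rw [h.density, integral_withDensity_eq_integral_toReal_smul
    (h.measurable.exp.ennreal_ofReal) (ae_of_all _ fun x => ENNReal.ofReal_lt_top)]
  refine integral_congr_ae (ae_of_all _ fun x => ?_)
  simp [ENNReal.toReal_ofReal (Real.exp_pos _).le]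

theorem integrable_right_iff (h : IsLogRatio ξ Fs Gs) (f : 𝓧 → ℝ) :
    Integrable f Gs ↔ Integrable (fun x => Real.exp (ξ x) * f x) Fs := by
  rw [h.density, integrable_withDensity_iff_integrable_smul₀'
    h.measurable.exp.ennreal_ofReal.aemeasurable (ae_of_all _ fun x => ENNReal.ofReal_lt_top)]
  refine integrable_congr (ae_of_all _ fun x => ?_)
  simp [ENNReal.toReal_ofReal (Real.exp_pos _).le]

/-- One minus the Hellinger affinity is half the mean square of `exp (ξ / 2) - 1`. It vanishes only
if `ξ = 0` almost everywhere, which the negative mean excludes. -/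
theorem integral_exp_half_lt_one (h : IsLogRatio ξ Fs Gs) :
    ∫ x, Real.exp (1 / 2 * ξ x) ∂Fs < 1 := by
  have := h.left_prob
  have hi := h.integrable_exp_mul (t := 1 / 2) (by norm_num) (by norm_num)
  have hid : ∀ x, (1 + Real.exp (ξ x)) / 2 - Real.exp (1 / 2 * ξ x) =
      (Real.exp (1 / 2 * ξ x) - 1) ^ 2 / 2 := fun x => by
    have : Real.exp (ξ x) = Real.exp (1 / 2 * ξ x) ^ 2 := by
      rw [← Real.exp_nat_mul]; congr 1; push_cast; ring
    rw [this]; ring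
  have hi2 : Integrable (fun x => (1 + Real.exp (ξ x)) / 2) Fs :=
    ((integrable_const _).add h.integrable_exp).div_const 2
  have hval : ∫ x, (Real.exp (1 / 2 * ξ x) - 1) ^ 2 / 2 ∂Fs =
      1 - ∫ x, Real.exp (1 / 2 * ξ x) ∂Fs := by
    simp_rw [← hid]
    rw [integral_sub hi2 hi, integral_div, integral_add (integrable_const _) h.integrable_exp,
      h.integral_exp]
    simp
  by_contra! hc
  have hz : ∫ x, (Real.exp (1 / 2 * ξ x) - 1) ^ 2 / 2 ∂Fs = 0 :=
    le_antisymm (by rw [hval]; linarith) (integral_nonneg fun x => by positivity)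
  rw [integral_eq_zero_iff_of_nonneg (fun x => by positivity)
    (by simp_rw [← hid]; exact hi2.sub hi)] at hz
  have hξ0 : ξ =ᵐ[Fs] 0 := by
    filter_upwards [hz] with x hx
    have h1 : (Real.exp (1 / 2 * ξ x) - 1) ^ 2 = 0 := by
      simpa using hx
    have h2 : Real.exp (1 / 2 * ξ x) = 1 := by
      have := pow_eq_zero_iff (two_ne_zero) |>.1 h1; linarith
    have h3 := Real.exp_eq_one_iff _ |>.1 h2
    simp only [Pi.zero_apply]; linarith
  have := h.left_neg
  rw [integral_congr_ae hξ0] at this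
  simp at this

theorem integrable_exp_neg_half_right (h : IsLogRatio ξ Fs Gs) :
    Integrable (fun x => Real.exp (-(ξ x) / 2)) Gs := by
  rw [h.integrable_right_iff]
  refine (h.integrable_exp_mul (t := 1 / 2) (by norm_num) (by norm_num)).congr
    (ae_of_all _ fun x => ?_)
  simp only [← Real.exp_add]
  congr 1; ring

theorem integral_exp_neg_half_right (h : IsLogRatio ξ Fs Gs) :
    ∫ x, Real.exp (-(ξ x) / 2) ∂Gs = ∫ x, Real.exp (1 / 2 * ξ x) ∂Fs := by
  rw [h.integral_right]
  refine integral_congr_ae (ae_of_all _ fun x => ?_)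
  simp only [← Real.exp_add]
  congr 1; ring

theorem tendsto_integral_min {P : Measure 𝓧} (hξ : Integrable ξ P) :
    Tendsto (fun c : ℝ => ∫ x, min (ξ x) c ∂P) atTop (𝓝 (∫ x, ξ x ∂P)) := by
  refine tendsto_integral_filter_of_dominated_convergence (fun x => |ξ x|) ?_ ?_ hξ.abs ?_
  · exact Eventually.of_forall fun c =>
      hξ.aestronglyMeasurable.inf aestronglyMeasurable_const
  · filter_upwards [eventually_ge_atTop 0] with c hc
    refine ae_of_all _ fun x => ?_
    rw [Real.norm_eq_abs, abs_le]
    constructor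
    · exact le_min (neg_abs_le _) ((neg_nonpos.2 (abs_nonneg _)).trans hc)
    · exact (min_le_left _ _).trans (le_abs_self _)
  · refine ae_of_all _ fun x => tendsto_const_nhds.congr' ?_
    filter_upwards [eventually_ge_atTop (ξ x)] with c hc
    exact (min_eq_left hc).symm

/-- Truncation from below at a far level keeps the drift negative while limiting how much one step
is credited with lowering the statistic. -/
theorem exists_integral_max_neg (h : IsLogRatio ξ Fs Gs) :
    ∃ b : ℝ, 0 ≤ b ∧ ∫ x, max (ξ x) (-b) ∂Fs < 0 := by
  have h1 := tendsto_integral_min h.integrable_left.neg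
  have h2 : (0 : ℝ) < ∫ x, (-ξ) x ∂Fs := by
    simpa [integral_neg] using h.left_neg
  obtain ⟨b, hb, hb0⟩ := ((h1.eventually (lt_mem_nhds h2)).and (eventually_ge_atTop 0)).exists
  refine ⟨b, hb0, ?_⟩
  have : ∀ x, max (ξ x) (-b) = -min ((-ξ) x) b := fun x => by
    rw [Pi.neg_apply, ← max_neg_neg, neg_neg]
  simp_rw [this]
  rw [integral_neg]; linarith

end IsLogRatio

/-! ### Leaving a set of positions in cyclic order -/

/-- The number of steps in the cyclic order from position `d` to the first position outside `U`. -/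
noncomputable def exitSteps {K : ℕ} [NeZero K] (U : Set (Fin K)) (d : Fin K) : ℕ :=
  sInf {r : ℕ | d + Fin.ofNat K r ∉ U}

section exitSteps

variable {K : ℕ} [NeZero K] {U : Set (Fin K)}

theorem fin_add_ofNat_sub (d d₀ : Fin K) : d + Fin.ofNat K (d₀ - d).val = d₀ := by
  have : Fin.ofNat K (d₀ - d).val = d₀ - d := by
    ext; simp [Fin.ofNat, Nat.mod_eq_of_lt]
  rw [this]; abel

theorem exitSteps_le (hU : ∃ d₀, d₀ ∉ U) (d : Fin K) : exitSteps U d ≤ K := by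
  obtain ⟨d₀, h0⟩ := hU
  have : (d₀ - d).val ∈ {r : ℕ | d + Fin.ofNat K r ∉ U} := by
    simpa only [Set.mem_ofPred_eq, fin_add_ofNat_sub] using h0
  exact (Nat.sInf_le this).trans (d₀ - d).isLt.le

theorem exitSteps_eq_zero {d : Fin K} (hd : d ∉ U) : exitSteps U d = 0 :=
  Nat.le_zero.1 (Nat.sInf_le (by simpa using hd))

theorem fin_add_ofNat_succ (d : Fin K) (r : ℕ) :
    d + Fin.ofNat K (r + 1) = d + 1 + Fin.ofNat K r := by
  have : Fin.ofNat K (r + 1) = Fin.ofNat K r + 1 := by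
    ext; simp [Fin.ofNat, Fin.val_add]
  rw [this]; abel

/-- Each change of source inside `U` uses up exactly one unit, so at most `K` truncation errors
accumulate before an affected source is reached. -/
theorem exitSteps_eq_succ (hU : ∃ d₀, d₀ ∉ U) {d : Fin K} (hd : d ∈ U) :
    exitSteps U d = exitSteps U (d + 1) + 1 := by
  have hne : ∀ d, {r : ℕ | d + Fin.ofNat K r ∉ U}.Nonempty := fun d => by
    obtain ⟨d₀, h0⟩ := hU
    exact ⟨(d₀ - d).val, by simpa only [Set.mem_ofPred_eq, fin_add_ofNat_sub] using h0⟩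
  refine le_antisymm (Nat.sInf_le ?_) ?_
  · have := Nat.sInf_mem (hne (d + 1))
    simp only [Set.mem_ofPred_eq] at this ⊢
    rwa [fin_add_ofNat_succ]
  · have h1 := Nat.sInf_mem (hne d)
    obtain ⟨r, hr⟩ : ∃ r, exitSteps U d = r + 1 := by
      refine Nat.exists_eq_succ_of_ne_zero fun h0 => ?_
      rw [exitSteps] at h0
      rw [h0] at h1
      simp only [Set.mem_ofPred_eq] at h1
      exact h1 (by simpa using hd)
    rw [hr]
    refine Nat.succ_le_succ (Nat.sInf_le ?_)
    rw [exitSteps] at hr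
    rw [hr] at h1
    simp only [Set.mem_ofPred_eq] at h1 ⊢
    rwa [fin_add_ofNat_succ] at h1

end exitSteps

/-! ### A Lyapunov function for the detection delay -/

/-- A bound for the expected delay of the Round Robin CUSUM from state `(y, d)`, when `U` is the set
of positions of the unaffected sources. -/
noncomputable def delayBound {K : ℕ} [NeZero K] (U : Set (Fin K)) (L I M α b : ℝ)
    (q : ℝ × Fin K) : ℝ :=
  open Classical in
  if q.2 ∈ U then L / I + M + α * max q.1 0 + α * b * exitSteps U q.2
  else (L - max q.1 0) / I + M * Real.exp (-(max q.1 0) / 2)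

section delayBound

variable {𝓧 : Type*} [MeasurableSpace 𝓧] {ξ : 𝓧 → ℝ} {Fs Gs : Measure 𝓧} {K : ℕ} [NeZero K]
  {U : Set (Fin K)} {A c I M α b : ℝ}

/-- The linear part loses one in mean, which pays for the step; the cap `c` on `ξ` keeps it
nonnegative without controlling the overshoot. A reset costs at most `M + α * b * K` beyond `(A + c)
/ I`. This cost is charged through `exp (-(p + ξ) / 2)`, which is at least one at a reset and whose
mean under `Gs` carries the Hellinger affinity; `hM` closes the loop. -/
theorem delayBound_step_affected (h : IsLogRatio ξ Fs Gs) (hU : ∃ d₀, d₀ ∉ U) (hA : 0 < A)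
    (hI0 : 0 < I) (hI : I = ∫ x, min (ξ x) c ∂Gs) (hc : 0 ≤ c) (hα : 0 ≤ α) (hb : 0 ≤ b)
    (hM : (M + α * b * K) * ∫ x, Real.exp (1 / 2 * ξ x) ∂Fs ≤ M) (hM0 : 0 ≤ M)
    {q : ℝ × Fin K} (hq : q.1 < A) (hqU : q.2 ∉ U) {μ : Fin K → Measure 𝓧} (hμ : μ q.2 = Gs) :
    1 + killedOp A ξ μ (fun q => ENNReal.ofReal (delayBound U (A + c) I M α b q)) q ≤
      ENNReal.ofReal (delayBound U (A + c) I M α b q) := by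
  have := h.right_prob
  set p := max q.1 0 with hp
  have hp0 : 0 ≤ p := le_max_right _ _
  have hpA : p ≤ A := max_le hq.le hA.le
  have hmin : Integrable (fun x => min (ξ x) c) Gs := h.integrable_right.inf (integrable_const c)
  have hexp := h.integrable_exp_neg_half_right
  set N := M + α * b * K with hN
  have hN0 : 0 ≤ N := by positivity
  set g : 𝓧 → ℝ := fun x => (A + c - p - min (ξ x) c) / I +
    N * Real.exp (-p / 2) * Real.exp (-(ξ x) / 2) with hg
  have hg0 : ∀ x, 0 ≤ g x := fun x => by
    have : 0 ≤ A + c - p - min (ξ x) c := by linarith [min_le_right (ξ x) c]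
    simp only [hg]; positivity
  have hgi1 : Integrable (fun x => (A + c - p - min (ξ x) c) / I) Gs :=
    ((integrable_const _).sub hmin).div_const I
  have hgi : Integrable g Gs := hgi1.add (hexp.const_mul _)
  have hgint : ∫ x, g x ∂Gs = (A + c - p) / I - 1 +
      N * Real.exp (-p / 2) * ∫ x, Real.exp (1 / 2 * ξ x) ∂Fs := by
    simp only [hg]
    rw [integral_add hgi1 (hexp.const_mul _), integral_div, integral_sub (integrable_const _) hmin,
      integral_const_mul, h.integral_exp_neg_half_right, ← hI]
    simp only [integral_const, probReal_univ, smul_eq_mul, one_mul]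
    rw [sub_div, div_self hI0.ne']
  have hle : killedOp A ξ μ (fun q => ENNReal.ofReal (delayBound U (A + c) I M α b q)) q ≤
      ENNReal.ofReal (∫ x, g x ∂Gs) := by
    rw [ofReal_integral_eq_lintegral_ofReal hgi (ae_of_all _ hg0), killedOp, hμ]
    refine lintegral_mono fun x => ?_
    dsimp only
    split_ifs with hx
    swap; · exact zero_le
    refine ENNReal.ofReal_le_ofReal ?_
    have hex : Real.exp (-p / 2) * Real.exp (-(ξ x) / 2) = Real.exp (-(p + ξ x) / 2) := by
      rw [← Real.exp_add]; congr 1; ring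
    simp only [hg, mul_assoc, hex]
    by_cases hy : p + ξ x ≤ 0
    · have hns : nextState ξ q x = (p + ξ x, q.2 + 1) := by
        simp only [nextState, ← hp, hy, if_true]
      -- At a reset `ξ ≤ -p ≤ 0 ≤ c`, so the linear part of `g` is at least `(A + c) / I`.
      have hmx : min (ξ x) c = ξ x := min_eq_left (by linarith)
      have hdiv : (A + c) / I ≤ (A + c - p - min (ξ x) c) / I := by
        exact div_le_div_of_nonneg_right (by linarith) hI0.le
      have hone : 1 ≤ Real.exp (-(p + ξ x) / 2) := Real.one_le_exp (by linarith)
      have hNe : N ≤ N * Real.exp (-(p + ξ x) / 2) := le_mul_of_one_le_right hN0 hone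
      have hr : α * b * (exitSteps U (q.2 + 1) : ℝ) ≤ α * b * K := by
        gcongr; exact exitSteps_le hU _
      rw [hns]
      by_cases hd : q.2 + 1 ∈ U
      · simp only [delayBound, max_eq_right hy, hd, if_true, mul_zero, add_zero]
        linarith
      · simp only [delayBound, max_eq_right hy, hd, if_false, sub_zero, neg_zero, zero_div, Real.exp_zero, mul_one]
        have : 0 ≤ α * b * K := by positivity
        linarith
    · push Not at hy
      simp only [nextState, ← hp, not_le.2 hy, if_false, delayBound, hqU, max_eq_left hy.le]
      have hdiv : (A + c - (p + ξ x)) / I ≤ (A + c - p - min (ξ x) c) / I := by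
        exact div_le_div_of_nonneg_right (by linarith [min_le_left (ξ x) c]) hI0.le
      have : M * Real.exp (-(p + ξ x) / 2) ≤ N * Real.exp (-(p + ξ x) / 2) := by
        gcongr; rw [hN]; have : 0 ≤ α * b * K := by positivity
        linarith
      linarith
  have hint0 : 0 ≤ ∫ x, g x ∂Gs := integral_nonneg hg0
  calc _ ≤ 1 + ENNReal.ofReal (∫ x, g x ∂Gs) := by gcongr
    _ = ENNReal.ofReal (1 + ∫ x, g x ∂Gs) := by
        rw [ENNReal.ofReal_add zero_le_one hint0, ENNReal.ofReal_one]
    _ ≤ _ := by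
        refine ENNReal.ofReal_le_ofReal ?_
        simp only [delayBound, hqU, if_false, ← hp, hgint]
        have : N * Real.exp (-p / 2) * ∫ x, Real.exp (1 / 2 * ξ x) ∂Fs ≤
            M * Real.exp (-p / 2) := by
          rw [mul_right_comm]; gcongr
        linarith

/-- The slope `α` is such that the truncated increment lowers the bound by at least one in mean. At
a reset the truncated drop is worth at most `α * b`, exactly what one step of `exitSteps` releases.
-/
theorem delayBound_step_unaffected (h : IsLogRatio ξ Fs Gs) (hU : ∃ d₀, d₀ ∉ U) (hA : 0 < A)
    (hI0 : 0 < I) (hc : 0 ≤ c) (hα : 0 ≤ α) (hb : 0 ≤ b)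
    (hαb : α * ∫ x, max (ξ x) (-b) ∂Fs ≤ -1) (hM0 : 0 ≤ M)
    {q : ℝ × Fin K} (hqU : q.2 ∈ U) {μ : Fin K → Measure 𝓧} (hμ : μ q.2 = Fs) :
    1 + killedOp A ξ μ (fun q => ENNReal.ofReal (delayBound U (A + c) I M α b q)) q ≤
      ENNReal.ofReal (delayBound U (A + c) I M α b q) := by
  have := h.left_prob
  set p := max q.1 0 with hp
  have hp0 : 0 ≤ p := le_max_right _ _
  have hmax : Integrable (fun x => max (ξ x) (-b)) Fs :=
    h.integrable_left.sup (integrable_const (-b))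
  have hr := exitSteps_eq_succ hU hqU
  have hr1 : (exitSteps U q.2 : ℝ) = exitSteps U (q.2 + 1) + 1 := by exact_mod_cast hr
  set D := (A + c) / I + M + α * p + α * b * exitSteps U q.2 with hD
  set g : 𝓧 → ℝ := fun x => D + α * max (ξ x) (-b) with hg
  have hlow : ∀ x, -(α * b) ≤ α * max (ξ x) (-b) := fun x => by
    rw [← mul_neg]; gcongr; exact le_max_right _ _
  have hDI : 0 ≤ (A + c) / I := by positivity
  have hg0 : ∀ x, 0 ≤ g x := fun x => by
    simp only [hg, hD, hr1]
    have := hlow x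
    have h2 : 0 ≤ α * p := by positivity
    have h3 : 0 ≤ α * b * (exitSteps U (q.2 + 1) : ℝ) := by positivity
    linarith
  have hgi : Integrable g Fs := (integrable_const _).add (hmax.const_mul _)
  have hgint : ∫ x, g x ∂Fs = D + α * ∫ x, max (ξ x) (-b) ∂Fs := by
    simp only [hg]
    rw [integral_add (integrable_const _) (hmax.const_mul _), integral_const_mul]
    simp
  have hle : killedOp A ξ μ (fun q => ENNReal.ofReal (delayBound U (A + c) I M α b q)) q ≤
      ENNReal.ofReal (∫ x, g x ∂Fs) := by
    rw [ofReal_integral_eq_lintegral_ofReal hgi (ae_of_all _ hg0), killedOp, hμ]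
    refine lintegral_mono fun x => ?_
    dsimp only
    split_ifs with hx
    swap; · exact zero_le
    refine ENNReal.ofReal_le_ofReal ?_
    have hl := hlow x
    have h2 : 0 ≤ α * p := by positivity
    by_cases hy : p + ξ x ≤ 0
    · have hns : nextState ξ q x = (p + ξ x, q.2 + 1) := by
        simp only [nextState, ← hp, hy, if_true]
      rw [hns]
      simp only [hg, hD, hr1]
      by_cases hd : q.2 + 1 ∈ U
      · simp only [delayBound, max_eq_right hy, hd, if_true]
        linarith
      · have : exitSteps U (q.2 + 1) = 0 := exitSteps_eq_zero hd
        simp only [delayBound, max_eq_right hy, hd, if_false, this, sub_zero, neg_zero, zero_div, Real.exp_zero, mul_one, Nat.cast_zero,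
          zero_add]
        linarith
    · push Not at hy
      simp only [nextState, ← hp, not_le.2 hy, if_false, delayBound, hqU, if_true,
        max_eq_left hy.le, hg, hD]
      have : α * (p + ξ x) ≤ α * p + α * max (ξ x) (-b) := by
        rw [← mul_add]; gcongr; exact le_max_left _ _
      linarith
  have hint0 : 0 ≤ ∫ x, g x ∂Fs := integral_nonneg hg0
  calc _ ≤ 1 + ENNReal.ofReal (∫ x, g x ∂Fs) := by gcongr
    _ = ENNReal.ofReal (1 + ∫ x, g x ∂Fs) := by
        rw [ENNReal.ofReal_add zero_le_one hint0, ENNReal.ofReal_one]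
    _ ≤ _ := by
        refine ENNReal.ofReal_le_ofReal ?_
        simp only [delayBound, hqU, if_true, ← hp, hgint]
        linarith

end delayBound

/-! ### Supersolutions and the expected time to killing. -/

section iterate

variable {𝓧 : Type*} [MeasurableSpace 𝓧] {ξ : 𝓧 → ℝ} {K : ℕ} [NeZero K] {A : ℝ}

theorem killedOp_add (hξ : Measurable ξ) (μ : Fin K → Measure 𝓧) {f g : ℝ × Fin K → ℝ≥0∞}
    (hf : Measurable f) : killedOp A ξ μ (f + g) = killedOp A ξ μ f + killedOp A ξ μ g := by
  ext q
  have hm : Measurable fun x => if (nextState ξ q x).1 < A then f (nextState ξ q x) else 0 :=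
    (measurable_killed (A := A) hf).comp ((measurable_nextState (K := K) hξ).comp
      (measurable_const.prodMk measurable_id))
  rw [Pi.add_apply, killedOp, killedOp, killedOp, ← lintegral_add_left hm]
  refine lintegral_congr fun x => ?_
  simp only [Pi.add_apply]
  split_ifs <;> simp

/-- A supersolution dominates the expected number of steps before the level `A` is reached. -/
theorem tsum_killedOp_le (hξ : Measurable ξ) (μ : Fin K → Measure 𝓧) [∀ d, SFinite (μ d)]
    {V : ℝ × Fin K → ℝ≥0∞} (hV : ∀ q : ℝ × Fin K, q.1 < A → 1 + killedOp A ξ μ V q ≤ V q)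
    {q : ℝ × Fin K} (hq : q.1 < A) : ∑' j : ℕ, (killedOp A ξ μ)^[j] 1 q ≤ V q := by
  have hmeas : ∀ N, Measurable (∑ j ∈ Finset.range N, (killedOp A ξ μ)^[j] 1) := fun N => by
    convert Finset.measurable_sum (Finset.range N) fun j _ =>
      measurable_killedOp_iterate (A := A) hξ μ measurable_one j using 1
    ext q
    simp
  -- The truncated expected times satisfy `u ↦ 1 + killedOp u`, so a supersolution dominates them by
  -- induction; measurability serves only the additivity of the operator.
  have hrec : ∀ N, ∑ j ∈ Finset.range (N + 1), (killedOp A ξ μ)^[j] 1 =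
      1 + killedOp A ξ μ (∑ j ∈ Finset.range N, (killedOp A ξ μ)^[j] 1) := by
    intro N
    induction N with
    | zero =>
      ext q
      simp [killedOp]
    | succ N ih =>
      rw [Finset.sum_range_succ _ (N + 1)]
      nth_rewrite 1 [ih]
      rw [Finset.sum_range_succ _ N, killedOp_add hξ μ (hmeas N), Function.iterate_succ_apply',
        add_assoc]
  have hfin : ∀ N, ∀ q : ℝ × Fin K, q.1 < A →
      (∑ j ∈ Finset.range N, (killedOp A ξ μ)^[j] 1) q ≤ V q := by
    intro N
    induction N with
    | zero => intro q _; simp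
    | succ N ih =>
      intro q hq
      rw [hrec]
      refine le_trans ?_ (hV q hq)
      rw [Pi.add_apply, Pi.one_apply]
      gcongr
      refine lintegral_mono fun x => ?_
      dsimp only
      split_ifs with hx
      exacts [ih _ hx, le_rfl]
  rw [ENNReal.tsum_eq_iSup_nat]
  refine iSup_le fun N => ?_
  simpa using hfin N q hq

end iterate

end RoundRobin

namespace RoundRobin

namespace IsLogRatio

variable {𝓧 : Type*} [MeasurableSpace 𝓧] {ξ : 𝓧 → ℝ} {Fs Gs : Measure 𝓧}

/-! ### The cumulant generating function on the unit interval -/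

theorem exp_cgf (h : IsLogRatio ξ Fs Gs) {t : ℝ} (h0 : 0 ≤ t) (h1 : t ≤ 1) :
    Real.exp (cgf ξ Fs t) = ∫ x, Real.exp (t * ξ x) ∂Fs := by
  have := h.left_prob
  exact ProbabilityTheory.exp_cgf (h.integrable_exp_mul h0 h1)

theorem continuousOn_mgf (h : IsLogRatio ξ Fs Gs) : ContinuousOn (mgf ξ Fs) (Set.Icc 0 1) := by
  have := h.left_prob
  refine continuousOn_of_dominated (bound := fun x => 1 + Real.exp (ξ x)) ?_ ?_ ?_ ?_
  · exact fun t _ => (h.measurable.const_mul t).exp.aestronglyMeasurable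
  · refine fun t ht => ae_of_all _ fun x => ?_
    rw [Real.norm_of_nonneg (Real.exp_pos _).le]
    rcases le_total (ξ x) 0 with hx | hx
    · have : Real.exp (t * ξ x) ≤ 1 :=
        Real.exp_le_one_iff.2 (mul_nonpos_of_nonneg_of_nonpos ht.1 hx)
      linarith [Real.exp_pos (ξ x)]
    · have : Real.exp (t * ξ x) ≤ Real.exp (ξ x) := Real.exp_le_exp.2 (by nlinarith [ht.2])
      linarith
  · exact (integrable_const _).add h.integrable_exp
  · exact ae_of_all _ fun x => by fun_prop

theorem convexOn_mgf (h : IsLogRatio ξ Fs Gs) : ConvexOn ℝ (Set.Icc 0 1) (mgf ξ Fs) := by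
  refine ⟨convex_Icc 0 1, fun s hs t ht a b ha hb hab => ?_⟩
  have hst := (convex_Icc (0 : ℝ) 1) hs ht ha hb hab
  have his := h.integrable_exp_mul hs.1 hs.2
  have hit := h.integrable_exp_mul ht.1 ht.2
  simp only [mgf, smul_eq_mul] at hst ⊢
  rw [← integral_const_mul, ← integral_const_mul, ← integral_add (his.const_mul a)
    (hit.const_mul b)]
  refine integral_mono (h.integrable_exp_mul hst.1 hst.2)
    ((his.const_mul a).add (hit.const_mul b)) fun x => ?_
  have := convexOn_exp.2 (Set.mem_univ (s * ξ x)) (Set.mem_univ (t * ξ x)) ha hb hab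
  simp only [smul_eq_mul] at this
  convert this using 2
  ring

theorem Ioo_subset_interior (h : IsLogRatio ξ Fs Gs) :
    Set.Ioo 0 1 ⊆ interior (integrableExpSet ξ Fs) :=
  interior_maximal (fun _ ht => h.integrable_exp_mul ht.1.le ht.2.le) isOpen_Ioo

theorem differentiableAt_cgf (h : IsLogRatio ξ Fs Gs) {t : ℝ} (ht : t ∈ Set.Ioo (0 : ℝ) 1) :
    DifferentiableAt ℝ (cgf ξ Fs) t := by
  have := h.left_prob
  exact (analyticAt_cgf (h.Ioo_subset_interior ht)).differentiableAt

theorem continuousOn_deriv_cgf (h : IsLogRatio ξ Fs Gs) :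
    ContinuousOn (deriv (cgf ξ Fs)) (Set.Ioo 0 1) := by
  have := h.left_prob
  exact fun t ht =>
    (analyticAt_cgf (h.Ioo_subset_interior ht)).deriv.continuousAt.continuousWithinAt

/-- The cumulant generating function attains its minimum over `[0, 1]` in the interior. -/
theorem exists_least_minimizer (h : IsLogRatio ξ Fs Gs) :
    ∃ θ ∈ Set.Ioo (0 : ℝ) 1, (∀ t ∈ Set.Icc (0 : ℝ) 1, cgf ξ Fs θ ≤ cgf ξ Fs t) ∧
      ∀ t, 0 ≤ t → t < θ → cgf ξ Fs θ < cgf ξ Fs t := by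
  have := h.left_prob
  obtain ⟨t₀, ht₀, hmin⟩ := isCompact_Icc.exists_isMinOn ⟨(0 : ℝ), by simp⟩ h.continuousOn_mgf
  have hcl : IsClosed (Set.Icc (0 : ℝ) 1 ∩ mgf ξ Fs ⁻¹' Set.Iic (mgf ξ Fs t₀)) :=
    h.continuousOn_mgf.preimage_isClosed_of_isClosed isClosed_Icc isClosed_Iic
  have hcomp : IsCompact (Set.Icc (0 : ℝ) 1 ∩ mgf ξ Fs ⁻¹' Set.Iic (mgf ξ Fs t₀)) :=
    isCompact_Icc.of_isClosed_subset hcl Set.inter_subset_left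
  -- The least minimizer is taken so that the function is strictly larger to its left, which later
  -- gives negative slopes. The value one at both ends against a value below one at `1 / 2` places
  -- it in the interior.
  obtain ⟨θ, ⟨hθ1, hθ2⟩, hθ3⟩ := hcomp.exists_isLeast ⟨t₀, ht₀, Set.mem_preimage.2 (Set.mem_Iic.2 le_rfl)⟩
  have hhalf : mgf ξ Fs (1 / 2) < 1 := h.integral_exp_half_lt_one
  have hθlt : mgf ξ Fs θ < 1 :=
    (hθ2.trans (hmin (by norm_num : (1 / 2 : ℝ) ∈ Set.Icc (0 : ℝ) 1))).trans_lt hhalf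
  have h0 : mgf ξ Fs 0 = 1 := mgf_zero
  have h1 : mgf ξ Fs 1 = 1 := by simpa [mgf] using h.integral_exp
  have hpos : ∀ t ∈ Set.Icc (0 : ℝ) 1, 0 < mgf ξ Fs t := fun t ht =>
    mgf_pos (h.integrable_exp_mul ht.1 ht.2)
  refine ⟨θ, ⟨lt_of_le_of_ne hθ1.1 ?_, lt_of_le_of_ne hθ1.2 ?_⟩, fun t ht => ?_, fun t ht0 ht => ?_⟩
  · rintro rfl; linarith
  · rintro rfl; linarith
  · exact Real.log_le_log (hpos _ hθ1) (hθ2.trans (hmin ht))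
  · have ht' : t ∈ Set.Icc (0 : ℝ) 1 := ⟨ht0, ht.le.trans hθ1.2⟩
    refine Real.log_lt_log (hpos _ hθ1) (lt_of_not_ge fun hc => ?_)
    exact absurd (hθ3 ⟨ht', hc.trans hθ2⟩) (not_le.2 ht)

/-- Near its minimizer, the cumulant generating function has tangents of every small negative slope,
and it is uniformly close to them. -/
theorem exists_tangents (h : IsLogRatio ξ Fs Gs) {θ : ℝ} (hθ : θ ∈ Set.Ioo (0 : ℝ) 1)
    (hmin : ∀ t ∈ Set.Icc (0 : ℝ) 1, cgf ξ Fs θ ≤ cgf ξ Fs t)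
    (hlt : ∀ t, 0 ≤ t → t < θ → cgf ξ Fs θ < cgf ξ Fs t) {η : ℝ} (hη : 0 < η) :
    ∃ a > 0, ∀ κ > 0, ∃ r > 0, ∀ c, 0 ≤ c → c ≤ a → ∃ t, θ - η ≤ t ∧ t ≤ θ ∧ 0 ≤ t - r ∧
      t + r ≤ 1 ∧ cgf ξ Fs t ≤ cgf ξ Fs (t - r) ∧
      |cgf ξ Fs (t + r) - cgf ξ Fs t + c * r| ≤ κ * r ∧
      |cgf ξ Fs (t - r) - cgf ξ Fs t - c * r| ≤ κ * r := by
  have := h.left_prob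
  set Λ := cgf ξ Fs with hΛ
  have hcont : ∀ {u v : ℝ}, 0 < u → v < 1 → ContinuousOn Λ (Set.Icc u v) := fun hu hv t ht =>
    (h.differentiableAt_cgf ⟨hu.trans_le ht.1, ht.2.trans_lt hv⟩).continuousAt.continuousWithinAt
  have hdiff : ∀ {u v : ℝ}, 0 < u → v < 1 → DifferentiableOn ℝ Λ (Set.Ioo u v) := fun hu hv t ht =>
    (h.differentiableAt_cgf ⟨hu.trans ht.1, ht.2.trans hv⟩).differentiableWithinAt
  obtain ⟨hθ0, hθ1⟩ := hθ
  -- The mean slope over `[u, θ]` is negative, so it is the slope at some `θa` within `η` of `θ`;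
  -- its absolute value is the witness for `a`.
  set u := max (θ / 2) (θ - η) with hu
  have hu0 : 0 < u := lt_max_of_lt_left (by linarith)
  have huθ : u < θ := max_lt (by linarith) (by linarith)
  obtain ⟨θa, ⟨hθa1, hθa2⟩, hθa⟩ := exists_deriv_eq_slope Λ huθ (hcont hu0 hθ1) (hdiff hu0 hθ1)
  have hslope : deriv Λ θa < 0 := by
    rw [hθa]
    exact div_neg_of_neg_of_pos (by linarith [hlt u hu0.le huθ]) (by linarith)
  have hθa0 : 0 < θa := hu0.trans hθa1
  have hθmin : deriv Λ θ = 0 := by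
    refine IsLocalMin.deriv_eq_zero ?_
    filter_upwards [Icc_mem_nhds hθ0 hθ1] with t ht using hmin t ht
  refine ⟨-deriv Λ θa, by linarith, fun κ hκ => ?_⟩
  have hJ : Set.Icc (θa / 2) ((1 + θ) / 2) ⊆ Set.Ioo 0 1 := fun t ht =>
    ⟨by linarith [ht.1], by linarith [ht.2]⟩
  -- Uniform continuity of the derivative makes the radius `r` independent of the slope `c`.
  have huc := isCompact_Icc.uniformContinuousOn_of_continuous (h.continuousOn_deriv_cgf.mono hJ)
  rw [Metric.uniformContinuousOn_iff] at huc
  obtain ⟨r₀, hr₀, huc⟩ := huc κ hκ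
  set r := min (r₀ / 2) (min (θa / 2) ((1 - θ) / 2)) with hr
  have hr1 : r < r₀ := (min_le_left _ _).trans_lt (by linarith)
  have hr2 : r ≤ θa / 2 := (min_le_right _ _).trans (min_le_left _ _)
  have hr3 : r ≤ (1 - θ) / 2 := (min_le_right _ _).trans (min_le_right _ _)
  have hr0 : 0 < r := lt_min (by linarith) (lt_min (by linarith) (by linarith))
  refine ⟨r, hr0, fun c hc0 hc => ?_⟩
  -- The derivative runs from `-a` at `θa` to zero at `θ`, so every slope `-c` is attained in
  -- between.
  have hivt := intermediate_value_Icc' (f := fun t => -deriv Λ t) hθa2.le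
    ((h.continuousOn_deriv_cgf.mono fun t ht => ⟨hθa0.trans_le ht.1, ht.2.trans_lt hθ1⟩).neg)
  obtain ⟨t, ⟨ht1, ht2⟩, ht⟩ := hivt (⟨by simpa [hθmin] using hc0, hc⟩ :
    c ∈ Set.Icc (-deriv Λ θ) (-deriv Λ θa))
  have hclose : ∀ ζ, t - r < ζ → ζ < t + r → |deriv Λ ζ + c| ≤ κ := fun ζ h1 h2 => by
    have hd := huc ζ ⟨by linarith, by linarith⟩ t ⟨by linarith, by linarith⟩
      (by rw [Real.dist_eq, abs_lt]; constructor <;> linarith)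
    rw [Real.dist_eq] at hd
    have : c = -deriv Λ t := ht.symm
    rw [this, ← sub_eq_add_neg]; exact hd.le
  refine ⟨t, (le_max_right _ _).trans (hθa1.le.trans ht1), ht2, by linarith, by linarith,
    ?_, ?_, ?_⟩
  -- The point `t` lies between `t - r` and the minimizer `θ`, so convexity bounds its value by that
  -- at `t - r`.
  · have htr : t - r ∈ Set.Icc (0 : ℝ) 1 := ⟨by linarith, by linarith⟩
    have hmθ : mgf ξ Fs θ ≤ mgf ξ Fs (t - r) := by
      have := hmin _ htr
      rw [← Real.exp_le_exp] at this
      rwa [hΛ, h.exp_cgf hθ0.le hθ1.le, h.exp_cgf htr.1 htr.2] at this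
    have hconv := h.convexOn_mgf.le_max_of_mem_Icc htr ⟨hθ0.le, hθ1.le⟩
      (⟨by linarith, ht2⟩ : t ∈ Set.Icc (t - r) θ)
    rw [max_eq_left hmθ] at hconv
    exact Real.log_le_log (mgf_pos (h.integrable_exp_mul (by linarith) (by linarith))) hconv
  · obtain ⟨ζ, ⟨h1, h2⟩, hζ⟩ := exists_deriv_eq_slope Λ (by linarith : t < t + r)
      (hcont (by linarith) (by linarith)) (hdiff (by linarith) (by linarith))
    have heq : Λ (t + r) - Λ t + c * r = (deriv Λ ζ + c) * r := by
      rw [hζ, add_sub_cancel_left, add_mul, div_mul_cancel₀ _ hr0.ne']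
    rw [heq, abs_mul, abs_of_pos hr0]
    exact mul_le_mul_of_nonneg_right (hclose ζ (by linarith) h2) hr0.le
  · obtain ⟨ζ, ⟨h1, h2⟩, hζ⟩ := exists_deriv_eq_slope Λ (by linarith : t - r < t)
      (hcont (by linarith) (by linarith)) (hdiff (by linarith) (by linarith))
    have heq : Λ (t - r) - Λ t - c * r = -((deriv Λ ζ + c) * r) := by
      rw [hζ, sub_sub_cancel, add_mul, div_mul_cancel₀ _ hr0.ne']
      ring
    rw [heq, abs_neg, abs_mul, abs_of_pos hr0]
    exact mul_le_mul_of_nonneg_right (hclose ζ h1 (by linarith)) hr0.le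

end IsLogRatio

/-! ### The probability that a random walk stays in a strip -/

/-- The probability that the random walk with increments `ξ` under `P` that starts at `x` stays in
the open interval `(0, A)` during the next `s` steps. -/
noncomputable def stripProb {𝓧 : Type*} [MeasurableSpace 𝓧] (A : ℝ) (ξ : 𝓧 → ℝ) (P : Measure 𝓧) :
    ℕ → ℝ → ℝ≥0∞
  | 0, _ => 1
  | s + 1, x => ∫⁻ y, if 0 < x + ξ y ∧ x + ξ y < A then stripProb A ξ P s (x + ξ y) else 0 ∂P

section strip

variable {𝓧 : Type*} [MeasurableSpace 𝓧] {ξ : 𝓧 → ℝ} {Fs Gs : Measure 𝓧} {A : ℝ}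

/-- A positive statistic never changes source, so staying in `(0, A)` is one way to survive,
entirely in position `d`. -/
theorem stripProb_le_killedOp {K : ℕ} [NeZero K] {μ : Fin K → Measure 𝓧} {d : Fin K}
    (hμ : μ d = Fs) (s : ℕ) (y : ℝ) :
    stripProb A ξ Fs s (max y 0) ≤ (killedOp A ξ μ)^[s] 1 (y, d) := by
  induction s generalizing y with
  | zero => simp [stripProb]
  | succ s ih =>
    rw [Function.iterate_succ_apply', stripProb, killedOp]
    simp only [hμ]
    refine lintegral_mono fun x => ?_
    dsimp only
    split_ifs with h1 h2 h2
    · have := ih (max y 0 + ξ x)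
      rw [max_eq_left h1.1.le] at this
      simpa only [nextState, not_le.2 h1.1, if_false] using this
    · exact absurd h1.2 h2
    all_goals exact zero_le

/-- A combination of three exponentials is a lower bound for the probability to stay in a strip. -/
theorem stripProb_ge_exp (h : IsLogRatio ξ Fs Gs) {t r L : ℝ} (hr : 0 ≤ r) (htr : 0 ≤ t - r)
    (htr' : t + r ≤ 1) (hle : cgf ξ Fs t ≤ cgf ξ Fs (t - r)) (s : ℕ)
    (htop : ∀ j : ℕ, j ≤ s → j * (cgf ξ Fs t - cgf ξ Fs (t + r)) ≤ r * (A - L)) (x : ℝ) :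
    ENNReal.ofReal (Real.exp (-t * L) * (Real.exp (s * cgf ξ Fs t + t * x) -
      Real.exp (s * cgf ξ Fs (t + r) + (t + r) * x - r * L) -
      Real.exp (s * cgf ξ Fs (t - r) + (t - r) * x))) ≤ stripProb A ξ Fs s x := by
  have := h.left_prob
  induction s generalizing x with
  | zero =>
    simp only [stripProb, Nat.cast_zero, zero_mul, zero_add]
    rw [← ENNReal.ofReal_one]
    refine ENNReal.ofReal_le_ofReal ?_
    -- Below `L` the factor `exp (-t * L)` caps the main term by one; above `L` the second
    -- exponential outweighs it.
    rcases le_total x L with hx | hx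
    · have h1 : Real.exp (-t * L) * Real.exp (t * x) ≤ 1 := by
        rw [← Real.exp_add]; exact Real.exp_le_one_iff.2 (by nlinarith)
      have h2 : 0 ≤ Real.exp (-t * L) * (Real.exp ((t + r) * x - r * L) +
        Real.exp ((t - r) * x)) := by positivity
      nlinarith
    · have h1 : Real.exp (t * x) ≤ Real.exp ((t + r) * x - r * L) :=
        Real.exp_le_exp.2 (by nlinarith)
      have h2 : Real.exp (t * x) - Real.exp ((t + r) * x - r * L) - Real.exp ((t - r) * x) ≤ 0 := by
        linarith [Real.exp_pos ((t - r) * x)]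
      exact (mul_nonpos_of_nonneg_of_nonpos (Real.exp_pos _).le h2).trans zero_le_one
  | succ s ih =>
    replace ih := ih fun j hj => htop j (by omega)
    set ψ : ℝ → ℝ := fun x => Real.exp (-t * L) * (Real.exp (s * cgf ξ Fs t + t * x) -
      Real.exp (s * cgf ξ Fs (t + r) + (t + r) * x - r * L) -
      Real.exp (s * cgf ξ Fs (t - r) + (t - r) * x)) with hψ
    -- Each exponential with its time factor is space-time harmonic for the free walk, so the
    -- combination reproduces itself under one step.
    have hint : ∀ {a : ℝ}, 0 ≤ a → a ≤ 1 → ∀ z : ℝ,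
        Integrable (fun y => Real.exp (z + a * (x + ξ y))) Fs ∧
        ∫ y, Real.exp (z + a * (x + ξ y)) ∂Fs = Real.exp (z + a * x + cgf ξ Fs a) := by
      intro a h0 h1 z
      have heq : ∀ y, Real.exp (z + a * (x + ξ y)) = Real.exp (z + a * x) * Real.exp (a * ξ y) :=
        fun y => by rw [← Real.exp_add]; congr 1; ring
      simp_rw [heq]
      exact ⟨(h.integrable_exp_mul h0 h1).const_mul _, by
        rw [integral_const_mul, Real.exp_add (z + a * x) (cgf ξ Fs a), h.exp_cgf h0 h1]⟩
    have ha := hint (a := t) (by linarith) (by linarith) (s * cgf ξ Fs t)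
    have hb := hint (a := t + r) (by linarith) (by linarith) (s * cgf ξ Fs (t + r) - r * L)
    have hc := hint (a := t - r) (by linarith) (by linarith) (s * cgf ξ Fs (t - r))
    have hψ' : ∀ y, ψ (x + ξ y) = Real.exp (-t * L) * (Real.exp (s * cgf ξ Fs t + t * (x + ξ y)) -
        Real.exp (s * cgf ξ Fs (t + r) - r * L + (t + r) * (x + ξ y)) -
        Real.exp (s * cgf ξ Fs (t - r) + (t - r) * (x + ξ y))) := fun y => by
      simp only [hψ]
      congr 4
      ring
    have hψi : Integrable (fun y => ψ (x + ξ y)) Fs := by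
      simp_rw [hψ']
      exact ((ha.1.sub hb.1).sub hc.1).const_mul _
    have hψint : ∫ y, ψ (x + ξ y) ∂Fs = Real.exp (-t * L) *
        (Real.exp ((s + 1 : ℕ) * cgf ξ Fs t + t * x) -
        Real.exp ((s + 1 : ℕ) * cgf ξ Fs (t + r) + (t + r) * x - r * L) -
        Real.exp ((s + 1 : ℕ) * cgf ξ Fs (t - r) + (t - r) * x)) := by
      have hab : Integrable (fun y => Real.exp (s * cgf ξ Fs t + t * (x + ξ y)) -
        Real.exp (s * cgf ξ Fs (t + r) - r * L + (t + r) * (x + ξ y))) Fs := ha.1.sub hb.1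
      simp_rw [hψ']
      rw [integral_const_mul, integral_sub hab hc.1, integral_sub ha.1 hb.1, ha.2,
        hb.2, hc.2]
      have e1 : (s : ℝ) * cgf ξ Fs t + t * x + cgf ξ Fs t = (s + 1 : ℕ) * cgf ξ Fs t + t * x := by
        push_cast; ring
      have e2 : (s : ℝ) * cgf ξ Fs (t + r) - r * L + (t + r) * x + cgf ξ Fs (t + r) =
          (s + 1 : ℕ) * cgf ξ Fs (t + r) + (t + r) * x - r * L := by
        push_cast; ring
      have e3 : (s : ℝ) * cgf ξ Fs (t - r) + (t - r) * x + cgf ξ Fs (t - r) =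
          (s + 1 : ℕ) * cgf ξ Fs (t - r) + (t - r) * x := by
        push_cast; ring
      rw [e1, e2, e3]
    -- Outside the strip the combination is nonpositive and killing can only help: below zero the
    -- exponent `t - r` wins by `hle`, above `A` the exponent `t + r` wins by `htop`.
    have hneg : ∀ z : ℝ, ¬ (0 < z ∧ z < A) → ψ z ≤ 0 := by
      intro z hz
      refine mul_nonpos_of_nonneg_of_nonpos (Real.exp_pos _).le ?_
      rcases le_or_gt z 0 with hz0 | hz0
      · have : Real.exp (s * cgf ξ Fs t + t * z) ≤
            Real.exp (s * cgf ξ Fs (t - r) + (t - r) * z) := by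
          refine Real.exp_le_exp.2 ?_
          have h1 : (s : ℝ) * cgf ξ Fs t ≤ s * cgf ξ Fs (t - r) := by gcongr
          nlinarith
        linarith [Real.exp_pos (s * cgf ξ Fs (t + r) + (t + r) * z - r * L)]
      · have hzA : A ≤ z := by
          by_contra! hc; exact hz ⟨hz0, hc⟩
        have : Real.exp (s * cgf ξ Fs t + t * z) ≤
            Real.exp (s * cgf ξ Fs (t + r) + (t + r) * z - r * L) := by
          refine Real.exp_le_exp.2 ?_
          have h1 := htop s (by omega)
          nlinarith
        linarith [Real.exp_pos (s * cgf ξ Fs (t - r) + (t - r) * z)]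
    rw [← hψint, stripProb]
    refine (ENNReal.ofReal_le_ofReal (integral_mono hψi hψi.pos_part fun y =>
      le_max_left _ _)).trans ?_
    rw [ofReal_integral_eq_lintegral_ofReal hψi.pos_part (ae_of_all _ fun y => le_max_right _ _)]
    refine lintegral_mono fun y => ?_
    dsimp only
    split_ifs with hy
    · refine le_trans (ENNReal.ofReal_le_iff_le_toReal ?_ |>.2 ?_) (ih (x + ξ y))
      · exact ENNReal.ofReal_ne_top
      · exact (ENNReal.toReal_ofReal' ).ge
    · rw [max_eq_right (hneg _ hy), ENNReal.ofReal_zero]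

/-- The walk stays in the strip while it follows a line that ends close to zero. -/
theorem stripProb_ge_of_line (h : IsLogRatio ξ Fs Gs) {t r L c κ x : ℝ} {s : ℕ} (hr : 0 < r)
    (htr : 0 ≤ t - r) (htr' : t + r ≤ 1) (hle : cgf ξ Fs t ≤ cgf ξ Fs (t - r)) (hc : 0 ≤ c)
    (hκ : 0 ≤ κ) (hup : |cgf ξ Fs (t + r) - cgf ξ Fs t + c * r| ≤ κ * r)
    (hdn : |cgf ξ Fs (t - r) - cgf ξ Fs t - c * r| ≤ κ * r) (hL : 0 ≤ L)
    (hsκ : s * κ ≤ L / 16) (hlow : L / 8 ≤ x - s * c) (hhigh : x - s * c ≤ 3 * L / 4)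
    (hrL : Real.log 4 ≤ r * L / 16) (hsc : s * c ≤ A - 2 * L) :
    ENNReal.ofReal (Real.exp (s * cgf ξ Fs t + t * (x - L)) / 2) ≤ stripProb A ξ Fs s x := by
  have h1 := abs_le.1 hup
  have h2 := abs_le.1 hdn
  have hs0 : (0 : ℝ) ≤ s := s.cast_nonneg
  refine le_trans (ENNReal.ofReal_le_ofReal ?_)
    (stripProb_ge_exp h (L := L) hr.le htr htr' hle s (fun j hj => ?_) x)
  · have hlog : Real.exp (-Real.log 4) = 1 / 4 := by
      rw [Real.exp_neg, Real.exp_log (by norm_num)]; norm_num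
    -- The line ends between `L / 8` and `3L / 4` and the tangent error is at most `L / 16`, so each
    -- correction is at most a quarter of the main term and half of it remains.
    have hA : Real.exp (s * cgf ξ Fs (t + r) + (t + r) * x - r * L) ≤
        Real.exp (s * cgf ξ Fs t + t * x) * (1 / 4) := by
      rw [← hlog, ← Real.exp_add]
      refine Real.exp_le_exp.2 ?_
      have : (s : ℝ) * (cgf ξ Fs (t + r) - cgf ξ Fs t) ≤ s * (κ * r - c * r) :=
        mul_le_mul_of_nonneg_left (by linarith [h1.2]) hs0
      have h3 : r * (x - s * c + s * κ - L) ≤ r * (-(L / 16)) :=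
        mul_le_mul_of_nonneg_left (by linarith) hr.le
      nlinarith
    have hB : Real.exp (s * cgf ξ Fs (t - r) + (t - r) * x) ≤
        Real.exp (s * cgf ξ Fs t + t * x) * (1 / 4) := by
      rw [← hlog, ← Real.exp_add]
      refine Real.exp_le_exp.2 ?_
      have : (s : ℝ) * (cgf ξ Fs (t - r) - cgf ξ Fs t) ≤ s * (κ * r + c * r) :=
        mul_le_mul_of_nonneg_left (by linarith [h2.2]) hs0
      have h3 : r * (-(x - s * c) + s * κ) ≤ r * (-(L / 16)) :=
        mul_le_mul_of_nonneg_left (by linarith) hr.le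
      nlinarith
    have hsplit : Real.exp (s * cgf ξ Fs t + t * (x - L)) =
        Real.exp (-t * L) * Real.exp (s * cgf ξ Fs t + t * x) := by
      rw [← Real.exp_add]; congr 1; ring
    rw [hsplit]
    have hpos := Real.exp_pos (-t * L)
    nlinarith [mul_le_mul_of_nonneg_left hA hpos.le, mul_le_mul_of_nonneg_left hB hpos.le]
  · have hj' : (j : ℝ) ≤ s := by exact_mod_cast hj
    have h3 : (j : ℝ) * (cgf ξ Fs t - cgf ξ Fs (t + r)) ≤ j * ((c + κ) * r) :=
      mul_le_mul_of_nonneg_left (by linarith [h1.1]) j.cast_nonneg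
    have h4 : (j : ℝ) * ((c + κ) * r) ≤ s * ((c + κ) * r) := by
      gcongr
    nlinarith

/-- Forcing the first `n` increments into the interval `[b₁, b₂]`. -/
theorem stripProb_ge_forced (hξ : Measurable ξ) {b₁ b₂ : ℝ} {p C : ℝ≥0∞}
    (hp : p ≤ Fs {y | b₁ ≤ ξ y ∧ ξ y ≤ b₂}) {s : ℕ} (n : ℕ) {x : ℝ}
    (hin : ∀ i : ℕ, 1 ≤ i → i ≤ n → 0 < x + i * b₁ ∧ x + i * b₂ < A)
    (hC : ∀ z, x + n * b₁ ≤ z → z ≤ x + n * b₂ → C ≤ stripProb A ξ Fs s z) :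
    p ^ n * C ≤ stripProb A ξ Fs (n + s) x := by
  induction n generalizing x with
  | zero => simpa using hC x (by simp) (by simp)
  | succ n ih =>
    have hm : MeasurableSet {y | b₁ ≤ ξ y ∧ ξ y ≤ b₂} :=
      (hξ measurableSet_Ici).inter (hξ measurableSet_Iic)
    rw [show n + 1 + s = (n + s) + 1 by omega, stripProb]
    calc p ^ (n + 1) * C = p ^ n * C * p := by rw [pow_succ]; ring
      _ ≤ p ^ n * C * Fs {y | b₁ ≤ ξ y ∧ ξ y ≤ b₂} := by gcongr
      _ = ∫⁻ y, {y | b₁ ≤ ξ y ∧ ξ y ≤ b₂}.indicator (fun _ => p ^ n * C) y ∂Fs := by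
          rw [lintegral_indicator_const hm]
      _ ≤ _ := by
          refine lintegral_mono fun y => ?_
          by_cases hy : y ∈ {y | b₁ ≤ ξ y ∧ ξ y ≤ b₂}
          swap; · simp [hy]
          have hy1 : b₁ ≤ ξ y := hy.1
          have hy2 : ξ y ≤ b₂ := hy.2
          have h1 := hin 1 le_rfl (by omega)
          simp only [Nat.cast_one, one_mul] at h1
          rw [Set.indicator_of_mem hy, if_pos ⟨by linarith, by linarith⟩]
          refine ih (fun i hi1 hi2 => ?_) fun z hz1 hz2 => hC z ?_ ?_
          · have := hin (i + 1) (by omega) (by omega)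
            push_cast at this
            constructor <;> linarith
          · push_cast; linarith
          · push_cast; linarith

end strip

end RoundRobin

namespace RoundRobin

/-! ### The strip estimate for all starting points. -/

section strip

variable {𝓧 : Type*} [MeasurableSpace 𝓧] {ξ : 𝓧 → ℝ} {Fs Gs : Measure 𝓧} {A : ℝ}

/-- A function that is positive with positive probability has its values in some dyadic interval with
positive probability. -/
theorem exists_exp_neg_le_measure {P : Measure 𝓧} [IsProbabilityMeasure P] {f : 𝓧 → ℝ}
    (hf : P {x | 0 < f x} ≠ 0) :
    ∃ b > 0, ∃ l ≥ 0, ENNReal.ofReal (Real.exp (-l)) ≤ P {x | b ≤ f x ∧ f x ≤ 2 * b} := by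
  have hsub : {x | 0 < f x} ⊆ ⋃ n : ℤ, {x | (2 : ℝ) ^ n ≤ f x ∧ f x ≤ 2 * (2 : ℝ) ^ n} := by
    intro x hx
    obtain ⟨n, hn1, hn2⟩ := exists_mem_Ico_zpow (x := f x) (y := 2) hx (by norm_num)
    refine Set.mem_iUnion.2 ⟨n, hn1, ?_⟩
    rw [zpow_add_one₀ (by norm_num)] at hn2
    linarith
  have hex : ∃ n : ℤ, P {x | (2 : ℝ) ^ n ≤ f x ∧ f x ≤ 2 * (2 : ℝ) ^ n} ≠ 0 := by
    by_contra! hc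
    exact hf (measure_mono_null hsub (measure_iUnion_null hc))
  obtain ⟨n, hn⟩ := hex
  set p := P {x | (2 : ℝ) ^ n ≤ f x ∧ f x ≤ 2 * (2 : ℝ) ^ n} with hp
  have hp1 : p ≤ 1 := prob_le_one
  have hpt : p ≠ ⊤ := measure_ne_top _ _
  have hp0 : 0 < p.toReal := ENNReal.toReal_pos hn hpt
  refine ⟨2 ^ n, by positivity, -Real.log p.toReal, ?_, ?_⟩
  · have := Real.log_nonpos hp0.le (ENNReal.toReal_mono ENNReal.one_ne_top hp1)
    linarith
  · rw [neg_neg, Real.exp_log hp0, ENNReal.ofReal_toReal hpt]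

theorem IsLogRatio.measure_neg_ne_zero (h : IsLogRatio ξ Fs Gs) : Fs {x | 0 < -ξ x} ≠ 0 := by
  intro h0
  have : 0 ≤ᵐ[Fs] ξ := by
    rw [Filter.EventuallyLE, ae_iff]
    simpa [not_le] using h0
  linarith [integral_nonneg_of_ae this, h.left_neg]

theorem IsLogRatio.measure_pos_ne_zero (h : IsLogRatio ξ Fs Gs) : Fs {x | 0 < ξ x} ≠ 0 := by
  intro h0
  have hac : Gs ≪ Fs := h.density ▸ withDensity_absolutelyContinuous _ _
  have : ξ ≤ᵐ[Gs] 0 := by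
    rw [Filter.EventuallyLE, ae_iff]
    simpa [not_le] using hac h0
  linarith [integral_nonpos_of_ae this, h.right_pos]

/-- The walk stays in the strip from every point that is not too close to its ends. -/
theorem stripProb_ge_middle (h : IsLogRatio ξ Fs Gs) {θ η a κ r L x : ℝ} {s : ℕ} (hθ1 : θ ≤ 1)
    (hmin : ∀ t ∈ Set.Icc (0 : ℝ) 1, cgf ξ Fs θ ≤ cgf ξ Fs t) (hr : 0 < r) (hκ : 0 ≤ κ)
    (htan : ∀ c, 0 ≤ c → c ≤ a → ∃ t, θ - η ≤ t ∧ t ≤ θ ∧ 0 ≤ t - r ∧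
      t + r ≤ 1 ∧ cgf ξ Fs t ≤ cgf ξ Fs (t - r) ∧
      |cgf ξ Fs (t + r) - cgf ξ Fs t + c * r| ≤ κ * r ∧
      |cgf ξ Fs (t - r) - cgf ξ Fs t - c * r| ≤ κ * r)
    (hη : 0 ≤ η) (ha : 0 ≤ a) (hL : 0 ≤ L) (hsκ : s * κ ≤ L / 16) (hrL : Real.log 4 ≤ r * L / 16)
    (hLA : 2 * L ≤ A) (hx1 : L / 8 ≤ x) (hx2 : x ≤ A - 3 * L / 2)
    (hx : x ≤ 3 * L / 4 ∨ x ≤ a * s) :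
    ENNReal.ofReal (Real.exp (s * cgf ξ Fs θ + θ * x - (η * A + L + Real.log 2))) ≤
      stripProb A ξ Fs s x := by
  have key : ∀ c, 0 ≤ c → c ≤ a → L / 8 ≤ x - s * c → x - s * c ≤ 3 * L / 4 →
      s * c ≤ A - 2 * L → ENNReal.ofReal (Real.exp (s * cgf ξ Fs θ + θ * x -
        (η * A + L + Real.log 2))) ≤ stripProb A ξ Fs s x := by
    intro c hc0 hca h1 h2 h3
    obtain ⟨t, ht1, ht2, ht3, ht4, ht5, ht6, ht7⟩ := htan c hc0 hca
    refine le_trans (ENNReal.ofReal_le_ofReal ?_)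
      (stripProb_ge_of_line h hr ht3 ht4 ht5 hc0 hκ ht6 ht7 hL hsκ h1 h2 hrL h3)
    rw [← sub_sub, Real.exp_sub, Real.exp_log (by norm_num)]
    gcongr
    -- Replacing `t` by the minimizer loses nothing in time and at most `η * A + L` in space, as `t`
    -- lies within `η` of `θ`.
    have hm := mul_le_mul_of_nonneg_left (hmin t ⟨by linarith, by linarith⟩) s.cast_nonneg
    have hx0 : 0 ≤ x := by linarith
    have hxA : x ≤ A := by linarith
    nlinarith [mul_le_mul_of_nonneg_right ht1 hx0, mul_le_mul_of_nonneg_left hxA hη,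
      mul_le_mul_of_nonneg_right (ht2.trans hθ1) hL]
  -- A low starting point stays level with slope zero; otherwise the line descends to height `L / 2`
  -- at time `s`, and `x ≤ a * s` keeps its slope admissible.
  rcases le_or_gt x (3 * L / 4) with hx' | hx'
  · exact key 0 le_rfl ha (by simpa using hx1) (by simpa using hx') (by simpa using hLA)
  · have hxs : x ≤ a * s := hx.resolve_left (not_le.2 hx')
    have hs : (0 : ℝ) < s := by
      rcases (s.cast_nonneg : (0 : ℝ) ≤ s).eq_or_lt with h0 | h0
      · rw [← h0] at hxs; linarith
      · exact h0
    have hsc : s * ((x - L / 2) / s) = x - L / 2 := mul_div_cancel₀ _ hs.ne'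
    refine key ((x - L / 2) / s) (div_nonneg (by linarith) hs.le) ?_ ?_ ?_ ?_
    · rw [div_le_iff₀ hs]; linarith
    all_goals rw [hsc]; linarith

theorem ofReal_exp_neg_pow_mul (l z : ℝ) (n : ℕ) :
    ENNReal.ofReal (Real.exp (-l)) ^ n * ENNReal.ofReal (Real.exp z) =
      ENNReal.ofReal (Real.exp (z - n * l)) := by
  rw [← ENNReal.ofReal_pow (Real.exp_pos _).le, ← Real.exp_nat_mul,
    ← ENNReal.ofReal_mul (Real.exp_pos _).le, ← Real.exp_add]
  congr 2
  ring

/-- Extension of a lower bound for the staying probability to starting points close to zero. -/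
theorem stripProb_ge_low (hξ : Measurable ξ) {θ Λ e b l L x : ℝ} {s : ℕ} (hθ0 : 0 ≤ θ)
    (hθ1 : θ ≤ 1) (hΛ : Λ ≤ 0) (hb : 0 < b) (hl : 0 ≤ l) (he : 0 ≤ e)
    (hp : ENNReal.ofReal (Real.exp (-l)) ≤ Fs {y | b ≤ ξ y ∧ ξ y ≤ 2 * b}) (hbL : 2 * b ≤ L / 8)
    (hLA : L < A)
    (hmid : ∀ s' : ℕ, s' ≤ s → ∀ z, L / 8 ≤ z → z ≤ 3 * L / 4 →
      ENNReal.ofReal (Real.exp (s' * Λ + θ * z - e)) ≤ stripProb A ξ Fs s' z)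
    (hx0 : 0 ≤ x) (hx : x < L / 8) :
    ENNReal.ofReal (Real.exp (s * Λ + θ * x - (e + L / 8 + l * (L / (8 * b) + 1)))) ≤
      stripProb A ξ Fs s x := by
  -- After `n` upward steps of size in `[b, 2b]` the walk is in the range covered by `hmid`.
  set n := ⌈L / (8 * b)⌉₊ with hn
  have hn1 : L / 8 ≤ n * b := by
    have := Nat.le_ceil (L / (8 * b))
    rw [div_le_iff₀ (by positivity)] at this
    linarith
  have hn2 : (n : ℝ) ≤ L / (8 * b) + 1 :=
    (Nat.ceil_lt_add_one (div_nonneg (by linarith) (by positivity))).le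
  have hn3 : n * (2 * b) ≤ L / 4 + 2 * b := by
    have : L / (8 * b) * (2 * b) = L / 4 := by field_simp; ring
    nlinarith
  have hin : ∀ m ≤ n, ∀ i : ℕ, 1 ≤ i → i ≤ m → 0 < x + i * b ∧ x + i * (2 * b) < A := by
    intro m hm i hi1 hi2
    have h1 : (1 : ℝ) ≤ i := by exact_mod_cast hi1
    have h2 : (i : ℝ) ≤ n := by exact_mod_cast hi2.trans hm
    constructor
    · nlinarith
    · nlinarith
  rcases le_or_gt n s with hns | hns
  · obtain ⟨k, rfl⟩ := Nat.exists_eq_add_of_le hns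
    refine le_trans ?_ (stripProb_ge_forced hξ hp (C := ENNReal.ofReal
      (Real.exp (k * Λ + θ * x - e))) n (hin n le_rfl) fun z hz1 hz2 => ?_)
    · rw [ofReal_exp_neg_pow_mul]
      refine ENNReal.ofReal_le_ofReal (Real.exp_le_exp.2 ?_)
      have h1 : (n : ℝ) * Λ ≤ 0 := mul_nonpos_of_nonneg_of_nonpos n.cast_nonneg hΛ
      push_cast
      nlinarith
    · refine le_trans (ENNReal.ofReal_le_ofReal (Real.exp_le_exp.2 ?_))
        (hmid k (by omega) z (by linarith) (by linarith))
      have : θ * x ≤ θ * z := mul_le_mul_of_nonneg_left (by nlinarith) hθ0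
      linarith
  -- If the time runs out during the climb, the forced steps alone give the bound.
  · have := stripProb_ge_forced hξ hp (C := ENNReal.ofReal (Real.exp 0)) (s := 0) (A := A) (x := x)
      s (hin s hns.le) fun z _ _ => by simp [stripProb]
    rw [add_zero] at this
    refine le_trans ?_ this
    rw [ofReal_exp_neg_pow_mul]
    refine ENNReal.ofReal_le_ofReal (Real.exp_le_exp.2 ?_)
    have h1 : (s : ℝ) * Λ ≤ 0 := mul_nonpos_of_nonneg_of_nonpos s.cast_nonneg hΛ
    have h2 : (s : ℝ) ≤ n := by exact_mod_cast hns.le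
    have h3 : θ * x ≤ x := by nlinarith
    have h4 : s * l ≤ l * (L / (8 * b) + 1) := by nlinarith
    linarith

/-- Extension of a lower bound for the staying probability to starting points close to `A`. -/
theorem stripProb_ge_high (hξ : Measurable ξ) {θ Λ e b l L x : ℝ} {s : ℕ} (hθ0 : 0 ≤ θ)
    (hθ1 : θ ≤ 1) (hΛ : Λ ≤ 0) (hb : 0 < b) (hl : 0 ≤ l)
    (hp : ENNReal.ofReal (Real.exp (-l)) ≤ Fs {y | b ≤ -ξ y ∧ -ξ y ≤ 2 * b}) (hL : 0 < L)
    (hbL : 2 * b ≤ L) (hLA : 6 * L ≤ A) (hs : 3 * L / (2 * b) + 1 ≤ s / 2)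
    (hmid : ∀ s' : ℕ, s' ≤ s → (s : ℝ) / 2 ≤ s' → ∀ z, L / 8 ≤ z → z ≤ A - 3 * L / 2 →
      ENNReal.ofReal (Real.exp (s' * Λ + θ * z - e)) ≤ stripProb A ξ Fs s' z)
    (hx0 : A - 3 * L / 2 < x) (hx : x < A) :
    ENNReal.ofReal (Real.exp (s * Λ + θ * x - (e + 4 * L + l * (3 * L / (2 * b) + 1)))) ≤
      stripProb A ξ Fs s x := by
  -- Forced downward steps lead below `A - 3L / 2`; by `hs` at least half of the time is left for
  -- the descent covered by `hmid`.
  set n := ⌈3 * L / (2 * b)⌉₊ with hn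
  have hn1 : 3 * L / 2 ≤ n * b := by
    have := Nat.le_ceil (3 * L / (2 * b))
    rw [div_le_iff₀ (by positivity)] at this
    linarith
  have hn2 : (n : ℝ) ≤ 3 * L / (2 * b) + 1 :=
    (Nat.ceil_lt_add_one (by positivity : 0 ≤ 3 * L / (2 * b))).le
  have hn3 : n * (2 * b) ≤ 3 * L + 2 * b := by
    have : 3 * L / (2 * b) * (2 * b) = 3 * L := by field_simp
    nlinarith
  have hp' : ENNReal.ofReal (Real.exp (-l)) ≤ Fs {y | -(2 * b) ≤ ξ y ∧ ξ y ≤ -b} := by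
    refine hp.trans (measure_mono fun y hy => ⟨?_, ?_⟩)
    · linarith [hy.2]
    · linarith [hy.1]
  have hs0 : (0 : ℝ) ≤ s := s.cast_nonneg
  have hns : n ≤ s := by
    have : (n : ℝ) ≤ s := by linarith
    exact_mod_cast this
  obtain ⟨k, hk⟩ := Nat.exists_eq_add_of_le hns
  have hk' : (s : ℝ) = n + k := by rw [hk]; push_cast; ring
  nth_rewrite 2 [hk]
  refine le_trans ?_ (stripProb_ge_forced hξ hp' (C := ENNReal.ofReal
      (Real.exp (k * Λ + θ * (x - n * (2 * b)) - e))) n (fun i hi1 hi2 => ?_) fun z hz1 hz2 => ?_)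
  · rw [ofReal_exp_neg_pow_mul]
    refine ENNReal.ofReal_le_ofReal (Real.exp_le_exp.2 ?_)
    have h1 : (n : ℝ) * Λ ≤ 0 := mul_nonpos_of_nonneg_of_nonpos n.cast_nonneg hΛ
    have h2 : θ * (n * (2 * b)) ≤ n * (2 * b) := by
      have : 0 ≤ n * (2 * b) := by positivity
      nlinarith
    have h3 : n * l ≤ l * (3 * L / (2 * b) + 1) := by nlinarith
    rw [hk']
    nlinarith
  · have h1 : (1 : ℝ) ≤ i := by exact_mod_cast hi1
    have h2 : (i : ℝ) ≤ n := by exact_mod_cast hi2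
    constructor
    · nlinarith
    · nlinarith
  · refine le_trans (ENNReal.ofReal_le_ofReal (Real.exp_le_exp.2 ?_))
      (hmid k (by omega) (by linarith) z (by linarith) (by linarith))
    have : θ * (x - n * (2 * b)) ≤ θ * z := mul_le_mul_of_nonneg_left (by linarith) hθ0
    linarith

/-- The walk stays in the strip `(0, A)` for a time of order `A` with a probability that agrees with
its exponential upper bound up to a small exponential factor. -/
theorem exists_stripProb_ge (h : IsLogRatio ξ Fs Gs) {θ : ℝ} (hθ : θ ∈ Set.Ioo (0 : ℝ) 1)
    (hmin : ∀ t ∈ Set.Icc (0 : ℝ) 1, cgf ξ Fs θ ≤ cgf ξ Fs t)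
    (hlt : ∀ t, 0 ≤ t → t < θ → cgf ξ Fs θ < cgf ξ Fs t) {ε : ℝ} (hε : 0 < ε) :
    ∃ M > 0, ∀ᶠ A in atTop, ∀ (s : ℕ) (x : ℝ),
      (s = ⌈M * A⌉₊ ∧ 0 ≤ x ∧ x < A ∨ s ≤ ⌈M * A⌉₊ ∧ x = 0) →
      ENNReal.ofReal (Real.exp (s * cgf ξ Fs θ + θ * x - ε * A)) ≤ stripProb A ξ Fs s x := by
  have := h.left_prob
  have hΛ : cgf ξ Fs θ ≤ 0 := by simpa using hmin 0 (by simp)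
  obtain ⟨b, hb, l, hl, hp⟩ := exists_exp_neg_le_measure h.measure_pos_ne_zero
  obtain ⟨b', hb', l', hl', hp'⟩ := exists_exp_neg_le_measure h.measure_neg_ne_zero
  obtain ⟨a, ha, htan⟩ := h.exists_tangents hθ hmin hlt (η := ε / 4) (by linarith)
  -- Even half of the time `M * A` suffices to descend from height `A` at slope `a`.
  set M := 2 / a with hM
  have hM0 : 0 < M := by positivity
  -- `D * L` collects all losses proportional to `L = δ * A`: the margin `L` inside `e`, the further
  -- `4 * L`, and the price of the forced steps. It takes a quarter of `ε * A`, the tilt `η = ε / 4`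
  -- another, and the constants a third.
  set D := 5 + l / (8 * b) + 3 * l' / (2 * b') with hD
  have hD0 : 5 ≤ D := by
    have h1 : 0 ≤ l / (8 * b) := by positivity
    have h2 : 0 ≤ 3 * l' / (2 * b') := by positivity
    linarith
  set δ := min (1 / 8) (min (b' * M / 6) (ε / (4 * D))) with hδ
  have hδ1 : δ ≤ 1 / 8 := min_le_left _ _
  have hδ2 : δ ≤ b' * M / 6 := (min_le_right _ _).trans (min_le_left _ _)
  have hδ3 : δ * D ≤ ε / 4 := by
    have : δ ≤ ε / (4 * D) := (min_le_right _ _).trans (min_le_right _ _)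
    rw [le_div_iff₀ (by positivity)] at this
    linarith
  have hδ0 : 0 < δ := lt_min (by norm_num) (lt_min (by positivity) (by positivity))
  -- The tangent error accumulated over at most `(M + 1) * A` steps is then `L / 16`.
  set κ := δ / (16 * (M + 1)) with hκ
  have hκ0 : 0 < κ := by positivity
  obtain ⟨r, hr, htan⟩ := htan κ hκ0
  refine ⟨M, hM0, ?_⟩
  filter_upwards [eventually_ge_atTop 1, eventually_ge_atTop (4 / M),
    eventually_ge_atTop (16 * Real.log 4 / (r * δ)), eventually_ge_atTop (16 * b / δ),
    eventually_ge_atTop (2 * b' / δ), eventually_ge_atTop (4 * (Real.log 2 + l + l') / ε)]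
    with A hA1 hA2 hA3 hA4 hA5 hA6
  set L := δ * A with hL
  have hL0 : 0 < L := by positivity
  rw [div_le_iff₀ (by positivity)] at hA2 hA3 hA4 hA5 hA6
  have hNle : (⌈M * A⌉₊ : ℝ) ≤ M * A + 1 := (Nat.ceil_lt_add_one (by positivity)).le
  have hNge : M * A ≤ (⌈M * A⌉₊ : ℝ) := Nat.le_ceil _
  have hsκ : ∀ s : ℕ, s ≤ ⌈M * A⌉₊ → (s : ℝ) * κ ≤ L / 16 := by
    intro s hs
    have h1 : (s : ℝ) ≤ (M + 1) * A := by
      have : (s : ℝ) ≤ ⌈M * A⌉₊ := by exact_mod_cast hs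
      linarith
    have h2 : (M + 1) * A * κ = L / 16 := by
      rw [hκ, hL]; field_simp
    exact h2 ▸ mul_le_mul_of_nonneg_right h1 hκ0.le
  have hrL : Real.log 4 ≤ r * L / 16 := by rw [hL]; linarith
  have hLA : 8 * L ≤ A := by nlinarith
  set e := ε / 4 * A + L + Real.log 2 with he
  have hlog : 0 ≤ Real.log 2 := Real.log_nonneg (by norm_num)
  have he0 : 0 ≤ e := by positivity
  have hmid1 : ∀ s : ℕ, s ≤ ⌈M * A⌉₊ → ∀ z, L / 8 ≤ z → z ≤ 3 * L / 4 →
      ENNReal.ofReal (Real.exp (s * cgf ξ Fs θ + θ * z - e)) ≤ stripProb A ξ Fs s z :=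
    fun s hs z h1 h2 => stripProb_ge_middle h hθ.2.le hmin hr hκ0.le htan (by positivity) ha.le
      hL0.le (hsκ s hs) hrL (by linarith) h1 (by linarith) (Or.inl h2)
  have hmid2 : ∀ s : ℕ, s ≤ ⌈M * A⌉₊ → (⌈M * A⌉₊ : ℝ) / 2 ≤ s → ∀ z, L / 8 ≤ z →
      z ≤ A - 3 * L / 2 →
      ENNReal.ofReal (Real.exp (s * cgf ξ Fs θ + θ * z - e)) ≤ stripProb A ξ Fs s z := by
    refine fun s hs hs' z h1 h2 => stripProb_ge_middle h hθ.2.le hmin hr hκ0.le htan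
      (by positivity) ha.le hL0.le (hsκ s hs) hrL (by linarith) h1 h2 (Or.inr ?_)
    have h3 : a * (M * A) = 2 * A := by rw [hM]; field_simp
    nlinarith
  have hexp : L * D = 5 * L + l * (L / (8 * b)) + l' * (3 * L / (2 * b')) := by
    rw [hD]; field_simp
  have hLD : L * D ≤ ε / 4 * A := by
    have := mul_le_mul_of_nonneg_right hδ3 (by linarith : (0 : ℝ) ≤ A)
    rw [hL]; linarith
  have hnn1 : 0 ≤ l * (L / (8 * b)) := by positivity
  have hnn2 : 0 ≤ l' * (3 * L / (2 * b')) := by positivity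
  have hlow : ∀ s : ℕ, s ≤ ⌈M * A⌉₊ → ∀ x, 0 ≤ x → x < L / 8 →
      ENNReal.ofReal (Real.exp (s * cgf ξ Fs θ + θ * x - ε * A)) ≤ stripProb A ξ Fs s x := by
    intro s hs x hx0 hx
    refine le_trans (ENNReal.ofReal_le_ofReal (Real.exp_le_exp.2 ?_))
      (stripProb_ge_low h.measurable hθ.1.le hθ.2.le hΛ hb hl he0 hp (by linarith) (by linarith)
        (fun s' hs' => hmid1 s' (hs'.trans hs)) hx0 hx)
    linarith
  intro s x hsx
  rcases hsx with ⟨rfl, hx0, hxA⟩ | ⟨hs, rfl⟩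
  swap; · exact hlow s hs 0 le_rfl (by positivity)
  rcases lt_or_ge x (L / 8) with hx | hx
  · exact hlow _ le_rfl x hx0 hx
  rcases le_or_gt x (A - 3 * L / 2) with hx' | hx'
  · refine le_trans (ENNReal.ofReal_le_ofReal (Real.exp_le_exp.2 ?_))
      (hmid2 _ le_rfl (half_le_self (Nat.cast_nonneg _)) x hx hx')
    linarith
  · refine le_trans (ENNReal.ofReal_le_ofReal (Real.exp_le_exp.2 ?_))
      (stripProb_ge_high h.measurable hθ.1.le hθ.2.le hΛ hb' hl' hp' hL0 (by linarith)
        (by linarith) ?_ hmid2 hx' hxA)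
    · linarith
    · have h1 : 3 * L / (2 * b') ≤ M * A / 4 := by
        rw [div_le_iff₀ (by positivity)]
        have := mul_le_mul_of_nonneg_right hδ2 (by linarith : (0 : ℝ) ≤ A)
        rw [hL]; linarith
      linarith

end strip

/-! ### The statistic is rarely large while unaffected sources are sampled -/

section unaffected

variable {𝓧 : Type*} [MeasurableSpace 𝓧] {ξ : 𝓧 → ℝ} {Fs Gs : Measure 𝓧} {A : ℝ} {K : ℕ} [NeZero K]

theorem killedOp_const_mul {μ : Fin K → Measure 𝓧} {c : ℝ≥0∞} (hc : c ≠ ⊤)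
    (f : ℝ × Fin K → ℝ≥0∞) (q : ℝ × Fin K) :
    killedOp A ξ μ (fun q => c * f q) q = c * killedOp A ξ μ f q := by
  rw [killedOp, killedOp, ← lintegral_const_mul' _ _ hc]
  refine lintegral_congr fun x => ?_
  split_ifs <;> simp

/-- Monotonicity and homogeneity turn a one-step supersolution into geometric decay. -/
theorem killedOp_iterate_le {μ : Fin K → Measure 𝓧} {c a : ℝ≥0∞} (hc : c ≠ ⊤) (ha : a ≠ ⊤)
    {f g : ℝ × Fin K → ℝ≥0∞} (hf : ∀ q, killedOp A ξ μ f q ≤ c * f q) (hg : ∀ q, g q ≤ a * f q)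
    (s : ℕ) (q : ℝ × Fin K) : (killedOp A ξ μ)^[s] g q ≤ a * c ^ s * f q := by
  induction s generalizing q with
  | zero => simpa using hg q
  | succ s ih =>
    rw [Function.iterate_succ_apply']
    calc killedOp A ξ μ ((killedOp A ξ μ)^[s] g) q
        ≤ killedOp A ξ μ (fun q => a * c ^ s * f q) q := killedOp_mono (fun q => ih q) q
      _ = a * c ^ s * killedOp A ξ μ f q :=
          killedOp_const_mul (ENNReal.mul_ne_top ha (ENNReal.pow_ne_top hc)) f q
      _ ≤ a * c ^ s * (c * f q) := by gcongr; exact hf q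
      _ = a * c ^ (s + 1) * f q := by rw [pow_succ]; ring

/-- An exponential supersolution for the walk that is confined to unaffected sources. -/
theorem killedOp_exp_le (h : IsLogRatio ξ Fs Gs) {U : Set (Fin K)} (hU : ∃ d₀, d₀ ∉ U)
    {μ : Fin K → Measure 𝓧} (hμ : ∀ d ∈ U, μ d = Fs) (hμ0 : ∀ d ∉ U, μ d = 0) {θ B : ℝ}
    (hθ0 : 0 ≤ θ) (hθ1 : θ ≤ 1) (hB : 1 ≤ B) (q : ℝ × Fin K) :
    killedOp A ξ μ (fun q => ENNReal.ofReal (B ^ exitSteps U q.2 * Real.exp (θ * max q.1 0))) q ≤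
      ENNReal.ofReal (Real.exp (cgf ξ Fs θ) + 1 / B) *
        ENNReal.ofReal (B ^ exitSteps U q.2 * Real.exp (θ * max q.1 0)) := by
  have := h.left_prob
  have hB0 : 0 < B := by linarith
  by_cases hq : q.2 ∈ U
  swap; · simp [killedOp, hμ0 _ hq]
  set y := max q.1 0 with hy
  have hy0 : 0 ≤ y := le_max_right _ _
  -- A reset lowers the power of `B` by one and contributes the rate `1 / B`; a step without reset
  -- contributes `exp (cgf ξ Fs θ)`.
  set E := exitSteps U (q.2 + 1) with hE
  have hE1 : exitSteps U q.2 = E + 1 := exitSteps_eq_succ hU hq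
  rw [killedOp, hμ _ hq, hE1]
  have hint : Integrable (fun x => B ^ (E + 1) * Real.exp (θ * y) * Real.exp (θ * ξ x) + B ^ E) Fs :=
    ((h.integrable_exp_mul hθ0 hθ1).const_mul _).add (integrable_const _)
  calc ∫⁻ x, (if (nextState ξ q x).1 < A then ENNReal.ofReal (B ^ exitSteps U (nextState ξ q x).2 *
        Real.exp (θ * max (nextState ξ q x).1 0)) else 0) ∂Fs
      ≤ ∫⁻ x, ENNReal.ofReal
          (B ^ (E + 1) * Real.exp (θ * y) * Real.exp (θ * ξ x) + B ^ E) ∂Fs := by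
        refine lintegral_mono fun x => ?_
        dsimp only
        split_ifs
        swap; · exact zero_le
        refine ENNReal.ofReal_le_ofReal ?_
        simp only [nextState, ← hy]
        split_ifs with h2
        · rw [max_eq_right h2, mul_zero, Real.exp_zero, mul_one]
          exact le_add_of_nonneg_left (by positivity)
        · rw [max_eq_left (not_le.1 h2).le, hE1, mul_add, Real.exp_add, mul_assoc]
          exact le_add_of_nonneg_right (by positivity)
    _ = ENNReal.ofReal (B ^ (E + 1) * Real.exp (θ * y) * Real.exp (cgf ξ Fs θ) + B ^ E) := by
        rw [← ofReal_integral_eq_lintegral_ofReal hint (ae_of_all _ fun x => by positivity),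
          integral_add ((h.integrable_exp_mul hθ0 hθ1).const_mul _) (integrable_const _),
          integral_const_mul, h.exp_cgf hθ0 hθ1]
        simp
    _ ≤ _ := by
        rw [← ENNReal.ofReal_mul (by positivity)]
        refine ENNReal.ofReal_le_ofReal ?_
        have h1 : 1 ≤ Real.exp (θ * y) := Real.one_le_exp (by positivity)
        have h2 : B ^ E ≤ B ^ E * Real.exp (θ * y) := le_mul_of_one_le_right (by positivity) h1
        have h3 : 1 / B * (B ^ (E + 1) * Real.exp (θ * y)) = B ^ E * Real.exp (θ * y) := by
          rw [pow_succ]; field_simp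
        rw [add_mul, h3]
        linarith

/-- Conditionally on no alarm and on unaffected sources only, the statistic is rarely of order `A`
after a time of order `A`, and also at all earlier times if it starts from zero. -/
theorem exists_killedOp_iterate_le (h : IsLogRatio ξ Fs Gs) {U : Set (Fin K)} (hU : ∃ d₀, d₀ ∉ U)
    {μ : Fin K → Measure 𝓧} (hμ : ∀ d ∈ U, μ d = Fs) (hμ0 : ∀ d ∉ U, μ d = 0) {ε ε' : ℝ}
    (hε : 0 < ε) (hε' : 0 < ε') :
    ∃ M > 0, ∀ᶠ A in atTop, ∀ (s : ℕ) (q : ℝ × Fin K), q.2 ∈ U →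
      (s = ⌈M * A⌉₊ ∧ q.1 < A ∨ s ≤ ⌈M * A⌉₊ ∧ q.1 ≤ 0) →
      (killedOp A ξ μ)^[s] ({q | ε * A < q.1 ∧ q.2 ∈ U}.indicator 1) q ≤
        ENNReal.ofReal ε' * (killedOp A ξ μ)^[s] 1 q := by
  obtain ⟨θ, hθ, hmin, hlt⟩ := h.exists_least_minimizer
  obtain ⟨M, hM, hstrip⟩ := exists_stripProb_ge h hθ hmin hlt
    (ε := θ * ε / 4) (by have := hθ.1; positivity)
  refine ⟨M, hM, ?_⟩
  have hθ0 := hθ.1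
  -- Of the gain `θ * ε * A`, one quarter covers the loss in the strip bound, one quarter the
  -- surplus rate `β` due to resets, and one half the factor `B ^ K / ε'`.
  set β := θ * ε / (4 * (M + 1)) with hβ
  have hβ0 : 0 < β := by positivity
  set B := max 1 (1 / (Real.exp (cgf ξ Fs θ) * β)) with hB
  have hB1 : 1 ≤ B := le_max_left _ _
  have hB2 : 1 / B ≤ Real.exp (cgf ξ Fs θ) * β := by
    rw [one_div_le (by positivity) (by positivity)]
    exact le_max_right _ _
  have hlim : Tendsto (fun A => Real.exp (θ * ε / 2 * A)) atTop atTop :=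
    Real.tendsto_exp_atTop.comp (tendsto_id.const_mul_atTop (by positivity))
  filter_upwards [hstrip, eventually_gt_atTop 1, hlim.eventually_ge_atTop (B ^ K / ε')]
    with A hA hA1 hA2 s q hq hs
  have hNle : (⌈M * A⌉₊ : ℝ) ≤ M * A + 1 := (Nat.ceil_lt_add_one (by positivity)).le
  have hsN : (s : ℝ) ≤ (M + 1) * A := by
    have : s ≤ ⌈M * A⌉₊ := by rcases hs with hs | hs; exacts [hs.1.le, hs.1]
    have : (s : ℝ) ≤ ⌈M * A⌉₊ := by exact_mod_cast this
    linarith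
  have hlow : ENNReal.ofReal (Real.exp (s * cgf ξ Fs θ + θ * max q.1 0 - θ * ε / 4 * A)) ≤
      (killedOp A ξ μ)^[s] 1 q := by
    refine (hA s (max q.1 0) ?_).trans (stripProb_le_killedOp (hμ _ hq) s q.1)
    rcases hs with hs | hs
    · exact Or.inl ⟨hs.1, le_max_right _ _, max_lt hs.2 (by linarith)⟩
    · exact Or.inr ⟨hs.1, max_eq_right hs.2⟩
  have hup := killedOp_iterate_le (A := A) (c := ENNReal.ofReal (Real.exp (cgf ξ Fs θ) + 1 / B))
    (a := ENNReal.ofReal (Real.exp (-(θ * (ε * A))))) ENNReal.ofReal_ne_top ENNReal.ofReal_ne_top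
    (killedOp_exp_le h hU hμ hμ0 hθ0.le hθ.2.le hB1)
    (g := {q | ε * A < q.1 ∧ q.2 ∈ U}.indicator 1) (fun q => ?_) s q
  swap
  · by_cases hgq : q ∈ {q : ℝ × Fin K | ε * A < q.1 ∧ q.2 ∈ U}
    swap; · simp [hgq]
    rw [Set.indicator_of_mem hgq, Pi.one_apply, ← ENNReal.ofReal_mul (Real.exp_pos _).le,
      ← ENNReal.ofReal_one]
    refine ENNReal.ofReal_le_ofReal ?_
    have h1 : ε * A < q.1 := hgq.1
    calc (1 : ℝ) = Real.exp (-(θ * (ε * A))) * (1 * Real.exp (θ * (ε * A))) := by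
          rw [one_mul, ← Real.exp_add]; simp
      _ ≤ _ := by
          gcongr
          · exact one_le_pow₀ hB1
          · exact h1.le.trans (le_max_left _ _)
  refine hup.trans (le_trans ?_ (mul_le_mul_right hlow _))
  rw [← ENNReal.ofReal_pow (by positivity), ← ENNReal.ofReal_mul (by positivity),
    ← ENNReal.ofReal_mul (by positivity), ← ENNReal.ofReal_mul hε'.le]
  refine ENNReal.ofReal_le_ofReal ?_
  have hc : (Real.exp (cgf ξ Fs θ) + 1 / B) ^ s ≤
      Real.exp (s * cgf ξ Fs θ + θ * ε / 4 * A) := by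
    have h1 : Real.exp (cgf ξ Fs θ) + 1 / B ≤ Real.exp (cgf ξ Fs θ + β) := by
      rw [Real.exp_add]
      nlinarith [Real.add_one_le_exp β, Real.exp_pos (cgf ξ Fs θ)]
    refine (pow_le_pow_left₀ (by positivity) h1 s).trans ?_
    rw [← Real.exp_nat_mul]
    refine Real.exp_le_exp.2 ?_
    have h2 : (M + 1) * A * β = θ * ε / 4 * A := by rw [hβ]; field_simp
    have := mul_le_mul_of_nonneg_right hsN hβ0.le
    linarith
  have hBK : B ^ exitSteps U q.2 ≤ ε' * Real.exp (θ * ε / 2 * A) := by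
    rw [div_le_iff₀ hε'] at hA2
    refine (pow_le_pow_right₀ hB1 (exitSteps_le hU q.2)).trans (by linarith)
  calc Real.exp (-(θ * (ε * A))) * (Real.exp (cgf ξ Fs θ) + 1 / B) ^ s *
        (B ^ exitSteps U q.2 * Real.exp (θ * max q.1 0))
      ≤ Real.exp (-(θ * (ε * A))) * Real.exp (s * cgf ξ Fs θ + θ * ε / 4 * A) *
        (ε' * Real.exp (θ * ε / 2 * A) * Real.exp (θ * max q.1 0)) := by gcongr
    _ = ε' * (Real.exp (-(θ * (ε * A))) * Real.exp (s * cgf ξ Fs θ + θ * ε / 4 * A) *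
        Real.exp (θ * ε / 2 * A) * Real.exp (θ * max q.1 0)) := by ring
    _ = _ := by
        rw [← Real.exp_add, ← Real.exp_add, ← Real.exp_add]
        congr 2
        ring

end unaffected

end RoundRobin

namespace RoundRobin

/-! ### The history of the affected sources -/

section history

variable {R 𝓧 : Type*} [MeasurableSpace 𝓧] {K : ℕ}

/-- As long as no affected source is sampled, the history of the affected sources does not grow. -/
theorem exists_affectedHistory_inter_eq {F G : Measure (Fin K → 𝓧)}
    {S : ℕ → Sample R 𝓧 K → Fin K} (τ : ℕ) {ν : ℕ} {B : Set (Sample R 𝓧 K)}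
    (hB : MeasurableSet[affectedHistory F G S ν] B) :
    ∃ B', MeasurableSet[affectedHistory F G S τ] B' ∧
      ∀ ω, (∀ t, τ ≤ t → t < ν → S t ω ∉ affected F G) → (ω ∈ B ↔ ω ∈ B') := by
  induction B, hB using MeasurableSpace.generateFrom_induction with
  | hC C hC =>
    obtain ⟨t, ht, k, hk, B, hB, rfl⟩ := hC
    rcases lt_or_ge t τ with htτ | htτ
    · exact ⟨_, MeasurableSpace.measurableSet_generateFrom ⟨t, htτ, k, hk, B, hB, rfl⟩,
        fun _ _ => Iff.rfl⟩
    · refine ⟨∅, @MeasurableSet.empty _ (affectedHistory F G S τ), fun ω hω => ?_⟩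
      simp only [Set.mem_ofPred_eq, Set.mem_empty_iff_false, iff_false]
      rintro ⟨rfl, -⟩
      exact hω t htτ ht hk
  | empty => exact ⟨∅, @MeasurableSet.empty _ (affectedHistory F G S τ), fun _ _ => Iff.rfl⟩
  | compl C _ ih =>
    obtain ⟨B', hB', h⟩ := ih
    exact ⟨B'ᶜ, hB'.compl, fun ω hω => not_congr (h ω hω)⟩
  | iUnion C _ ih =>
    choose B' hB' h using ih
    refine ⟨⋃ n, B' n, MeasurableSet.iUnion hB', fun ω hω => ?_⟩
    simp only [Set.mem_iUnion]
    exact exists_congr fun n => h n ω hω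

end history

/-! ### Blocks of consecutive visits to unaffected sources. -/

section unaffected

variable {R 𝓧 : Type*} [MeasurableSpace 𝓧] {K : ℕ} [NeZero K]
  {F : Measure (Fin K → 𝓧)} {𝒢 : Set (Measure (Fin K → 𝓧))} {e : Equiv.Perm (Fin K)}

/-- No alarm has been raised up to time `u`, and only positions in `U` are visited from time `τ` to
time `u`. -/
def confined (R : Type*) (F : Measure (Fin K → 𝓧)) (𝒢 : Set (Measure (Fin K → 𝓧)))
    (e : Equiv.Perm (Fin K)) (A : ℝ) (U : Set (Fin K)) (τ u : ℕ) : Set (Sample R 𝓧 K) :=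
  {ω | (u : ℕ∞) < rrStop F 𝒢 e A ω ∧ ∀ t, τ ≤ t → t < u → (cusum F 𝒢 e ω.2 t).2 ∈ U}

theorem confined_indicator_mul_rrRun (A : ℝ) (U : Set (Fin K)) {τ u : ℕ} (h : τ ≤ u) (j : ℕ)
    (ω : Sample R 𝓧 K) :
    (confined R F 𝒢 e A U τ u).indicator 1 ω * rrRun F 𝒢 e A U u j ω =
      (confined R F 𝒢 e A U τ (u + j)).indicator (1 : Sample R 𝓧 K → ℝ≥0∞) ω := by
  classical
  have hrun : rrRun F 𝒢 e A U u j ω = if ∀ i ∈ Finset.range j, (cusum F 𝒢 e ω.2 (u + i)).2 ∈ U ∧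
      (cusum F 𝒢 e ω.2 (u + i + 1)).1 < A then 1 else 0 := Finset.prod_boole ..
  have hiff : ω ∈ confined R F 𝒢 e A U τ (u + j) ↔ ω ∈ confined R F 𝒢 e A U τ u ∧
      ∀ i ∈ Finset.range j, (cusum F 𝒢 e ω.2 (u + i)).2 ∈ U ∧
        (cusum F 𝒢 e ω.2 (u + i + 1)).1 < A := by
    simp only [confined, Set.mem_ofPred_eq, lt_rrStop_iff, Finset.mem_range]
    constructor
    · rintro ⟨h1, h2⟩
      exact ⟨⟨fun i hi hi' => h1 i hi (by omega), fun t ht ht' => h2 t ht (by omega)⟩,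
        fun i hi => ⟨h2 _ (by omega) (by omega), h1 _ (by omega) (by omega)⟩⟩
    · rintro ⟨⟨h1, h2⟩, h3⟩
      refine ⟨fun i hi hi' => ?_, fun t ht ht' => ?_⟩
      · rcases le_or_gt i u with hiu | hiu
        · exact h1 i hi hiu
        · have := (h3 (i - u - 1) (by omega)).2
          rwa [show u + (i - u - 1) + 1 = i by omega] at this
      · rcases lt_or_ge t u with htu | htu
        · exact h2 t ht htu
        · have := (h3 (t - u) (by omega)).1
          rwa [show u + (t - u) = t by omega] at this
  rw [hrun]
  by_cases h1 : ω ∈ confined R F 𝒢 e A U τ u <;>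
    by_cases h2 : ∀ i ∈ Finset.range j, (cusum F 𝒢 e ω.2 (u + i)).2 ∈ U ∧
        (cusum F 𝒢 e ω.2 (u + i + 1)).1 < A
  · rw [Set.indicator_of_mem h1, if_pos h2, Set.indicator_of_mem (hiff.2 ⟨h1, h2⟩)]; simp
  · rw [if_neg h2, Set.indicator_of_notMem fun h => h2 (hiff.1 h).2, mul_zero]
  all_goals
    rw [Set.indicator_of_notMem h1, zero_mul, Set.indicator_of_notMem fun h => h1 (hiff.1 h).1]

/-- The position before time `τ`, if there is one, is not in `U`. -/
def entered (R : Type*) (F : Measure (Fin K → 𝓧)) (𝒢 : Set (Measure (Fin K → 𝓧)))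
    (e : Equiv.Perm (Fin K)) (U : Set (Fin K)) (τ : ℕ) : Set (Sample R 𝓧 K) :=
  {ω | ∀ t, t + 1 = τ → (cusum F 𝒢 e ω.2 t).2 ∉ U}

/-- The position changes only when the statistic is nonpositive, so every block in `U` starts from a
nonpositive value. -/
theorem cusum_nonpos_of_entered {U : Set (Fin K)} {τ : ℕ} {ω : Sample R 𝓧 K}
    (h : ω ∈ entered R F 𝒢 e U τ) (hU : (cusum F 𝒢 e ω.2 τ).2 ∈ U) :
    (cusum F 𝒢 e ω.2 τ).1 ≤ 0 := by
  cases τ with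
  | zero => simp [cusum]
  | succ τ =>
    by_contra hc
    have h1 := h τ rfl
    rw [cusum] at hU hc
    dsimp only at hU hc
    rw [if_neg hc] at hU
    exact h1 hU

/-- The least time from which all positions before `ν` lie in `U` is the start of the current block.
It equals `ν` when there is no such position, so every surviving path is covered. -/
theorem exists_entered_confined (A : ℝ) (U : Set (Fin K)) {ν : ℕ} {ω : Sample R 𝓧 K}
    (hω : (ν : ℕ∞) < rrStop F 𝒢 e A ω) :
    ∃ τ ≤ ν, ω ∈ entered R F 𝒢 e U τ ∩ confined R F 𝒢 e A U τ ν := by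
  classical
  have hex : ∃ τ, ∀ t, τ ≤ t → t < ν → (cusum F 𝒢 e ω.2 t).2 ∈ U := ⟨ν, fun t h1 h2 => by omega⟩
  refine ⟨Nat.find hex, Nat.find_min' hex fun t h1 h2 => by omega, fun t ht hU => ?_, hω,
    Nat.find_spec hex⟩
  refine Nat.find_min hex (by omega : t < Nat.find hex) fun t' h1 h2 => ?_
  rcases h1.eq_or_lt with rfl | h1
  exacts [hU, Nat.find_spec hex t' (by omega) h2]

theorem disjoint_entered_confined (A : ℝ) (U : Set (Fin K)) {ν τ τ' : ℕ} (h : τ < τ') (h' : τ' ≤ ν) :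
    Disjoint (entered R F 𝒢 e U τ ∩ confined R F 𝒢 e A U τ ν)
      (entered R F 𝒢 e U τ' ∩ confined R F 𝒢 e A U τ' ν) := by
  refine Set.disjoint_left.2 fun ω h1 h2 => ?_
  exact h2.1 (τ' - 1) (by omega) (h1.2.2 _ (by omega) (by omega))

variable [MeasurableSpace R]

theorem measurableSet_confined (A : ℝ) (U : Set (Fin K)) (τ u : ℕ) :
    MeasurableSet[obsFiltration (rrSampling (R := R) F 𝒢 e) u] (confined R F 𝒢 e A U τ u) := by
  have h1 := (isPolicy_roundRobin (R := R) F 𝒢 e A).measurableSet_lt u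
  have h2 : MeasurableSet[obsFiltration (rrSampling (R := R) F 𝒢 e) u]
      (⋂ t ∈ Set.Ico τ u, {ω : Sample R 𝓧 K | (cusum F 𝒢 e ω.2 t).2 ∈ U}) :=
    MeasurableSet.biInter (Set.to_countable _) fun t ht => obsFiltration_mono _ ht.2.le _
      ((measurable_snd.comp (measurable_cusum F 𝒢 e t)) (Set.toFinite U).measurableSet)
  convert h1.inter h2 using 1
  ext ω
  simp [confined]

theorem measurableSet_entered (U : Set (Fin K)) (τ : ℕ) :
    MeasurableSet[obsFiltration (rrSampling (R := R) F 𝒢 e) τ] (entered R F 𝒢 e U τ) := by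
  cases τ with
  | zero => convert @MeasurableSet.univ _ (obsFiltration (rrSampling (R := R) F 𝒢 e) 0); simp [entered]
  | succ τ =>
    have : MeasurableSet[obsFiltration (rrSampling (R := R) F 𝒢 e) (τ + 1)]
        {ω : Sample R 𝓧 K | (cusum F 𝒢 e ω.2 τ).2 ∉ U} := obsFiltration_mono _ (Nat.le_succ τ) _
      ((measurable_snd.comp (measurable_cusum F 𝒢 e τ)) (Set.toFinite Uᶜ).measurableSet)
    convert this using 1
    ext ω
    simp [entered]

variable {ξ : 𝓧 → ℝ} {Fs Gs : Measure 𝓧}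

/-- Within a block `B` coincides with an event of the observations at its start. It therefore acts
as a fixed weight, and the two measures differ only in the function to which the iterated killed
operator is applied. -/
theorem measure_affectedHistory_inter_entered_le (hs : ∀ k, score F 𝒢 k = ξ) (hξ : Measurable ξ)
    (ρ : Measure R) [IsProbabilityMeasure ρ] [IsProbabilityMeasure F] {G : Measure (Fin K → 𝓧)}
    {U : Set (Fin K)} (hU : ∀ d, d ∈ U ↔ e d ∉ affected F G) {μ : Fin K → Measure 𝓧}
    [∀ d, SFinite (μ d)] (hμ : ∀ d ∈ U, marginal F (e d) = μ d) (hμ0 : ∀ d ∉ U, μ d = 0)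
    {A : ℝ} {y : ℝ} {δ : ℝ≥0∞} {N : ℕ}
    (hcrux : ∀ (s : ℕ) (q : ℝ × Fin K), q.2 ∈ U → (s = N ∧ q.1 < A ∨ s ≤ N ∧ q.1 ≤ 0) →
      (killedOp A ξ μ)^[s] ({q | y < q.1 ∧ q.2 ∈ U}.indicator 1) q ≤
        δ * (killedOp A ξ μ)^[s] 1 q)
    {ν : ℕ} {B : Set (Sample R 𝓧 K)}
    (hB : MeasurableSet[affectedHistory F G (rrSampling F 𝒢 e) ν] B) {τ : ℕ} (hτ : τ ≤ ν) :
    lawNoChange ρ F (B ∩ (entered R F 𝒢 e U τ ∩ confined R F 𝒢 e A U τ ν) ∩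
        {ω | y < (cusum F 𝒢 e ω.2 ν).1 ∧ (cusum F 𝒢 e ω.2 ν).2 ∈ U}) ≤
      δ * lawNoChange ρ F (B ∩ (entered R F 𝒢 e U τ ∩ confined R F 𝒢 e A U τ ν)) := by
  have hpol := isPolicy_roundRobin (R := R) F 𝒢 e A
  obtain ⟨B', hB', hBB'⟩ := exists_affectedHistory_inter_eq τ hB
  replace hB' := hpol.affectedHistory_le F G τ _ hB'
  -- A long block is entered `N` steps before `ν`, where only `Y < A` is known; a short one at its
  -- start, where `Y ≤ 0`. These are the two alternatives in `hcrux`.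
  obtain ⟨u, hu⟩ : ∃ u, u = max τ (ν - N) := ⟨_, rfl⟩
  obtain ⟨j, rfl⟩ : ∃ j, ν = u + j := Nat.exists_eq_add_of_le (by omega)
  have hτu : τ ≤ u := hu ▸ le_max_left _ _
  set C := B' ∩ entered R F 𝒢 e U τ ∩ confined R F 𝒢 e A U τ u with hC
  have hCm : MeasurableSet[obsFiltration (rrSampling (R := R) F 𝒢 e) u] C :=
    ((obsFiltration_mono _ hτu _ hB').inter
      (obsFiltration_mono _ hτu _ (measurableSet_entered U τ))).inter
      (measurableSet_confined A U τ u)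
  set φ : Sample R 𝓧 K → ℝ≥0∞ := C.indicator 1 with hφ
  have hφo : Measurable[obsFiltration (rrSampling (R := R) F 𝒢 e) u] φ :=
    (@measurable_const ℝ≥0∞ _ _ (obsFiltration _ u) 1).indicator hCm
  have hφm := hpol.measurable hφo
  set g : ℝ × Fin K → ℝ≥0∞ := {q | y < q.1 ∧ q.2 ∈ U}.indicator 1 with hg
  have hgs : MeasurableSet {q : ℝ × Fin K | y < q.1 ∧ q.2 ∈ U} :=
    (measurable_fst measurableSet_Ioi).inter (measurable_snd (Set.toFinite U).measurableSet)
  have hgm : Measurable g := measurable_one.indicator hgs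
  set W := B ∩ (entered R F 𝒢 e U τ ∩ confined R F 𝒢 e A U τ (u + j)) with hW
  have hWeq : W = B' ∩ entered R F 𝒢 e U τ ∩ confined R F 𝒢 e A U τ (u + j) := by
    ext ω
    simp only [hW, Set.mem_inter_iff, and_assoc]
    constructor
    · rintro ⟨h1, h2, h3⟩
      exact ⟨(hBB' ω fun t ht ht' => (hU _).1 (h3.2 t ht ht')).1 h1, h2, h3⟩
    · rintro ⟨h1, h2, h3⟩
      exact ⟨(hBB' ω fun t ht ht' => (hU _).1 (h3.2 t ht ht')).2 h1, h2, h3⟩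
  have hWm : MeasurableSet W := hWeq ▸ hpol.obsFiltration_le _ _
    (((obsFiltration_mono _ hτ _ hB').inter
      (obsFiltration_mono _ hτ _ (measurableSet_entered U τ))).inter
      (measurableSet_confined A U τ (u + j)))
  have hφW : ∀ ω, φ ω * rrRun F 𝒢 e A U u j ω = W.indicator 1 ω := by
    intro ω
    simp only [hWeq, hφ, hC, Set.inter_indicator_one, Pi.mul_apply]
    rw [mul_assoc, confined_indicator_mul_rrRun A U hτu]
  have hcm := measurable_cusum' (R := R) (F := F) (𝒢 := 𝒢) e (u + j)
  have key : ∀ f : ℝ × Fin K → ℝ≥0∞, Measurable f →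
      ∫⁻ ω, W.indicator 1 ω * f (cusum F 𝒢 e ω.2 (u + j)) ∂(lawNoChange ρ F) =
        ∫⁻ ω, φ ω * (killedOp A ξ μ)^[j] f (cusum F 𝒢 e ω.2 u) ∂(lawNoChange ρ F) := by
    intro f hf
    have := lintegral_rrRun (e := e) hs hξ ρ (fun _ => F) A (U := U) (u := u) (μ := μ) j
      (fun _ _ _ => hμ) hμ0 hφm (hpol.dependsOnPast hφo) hf
    simp_rw [hφW] at this
    rwa [lawNoChange_eq]
  calc lawNoChange ρ F (W ∩ {ω | y < (cusum F 𝒢 e ω.2 (u + j)).1 ∧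
          (cusum F 𝒢 e ω.2 (u + j)).2 ∈ U})
      = ∫⁻ ω, W.indicator 1 ω * g (cusum F 𝒢 e ω.2 (u + j)) ∂(lawNoChange ρ F) := by
        refine (lintegral_indicator_one (hWm.inter (hcm hgs))).symm.trans ?_
        rw [Set.inter_indicator_one]
        rfl
    _ = ∫⁻ ω, φ ω * (killedOp A ξ μ)^[j] g (cusum F 𝒢 e ω.2 u) ∂(lawNoChange ρ F) := key g hgm
    _ ≤ ∫⁻ ω, δ * (φ ω * (killedOp A ξ μ)^[j] 1 (cusum F 𝒢 e ω.2 u)) ∂(lawNoChange ρ F) := by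
        refine lintegral_mono fun ω => ?_
        dsimp only
        by_cases hω : ω ∈ C
        swap; · simp [hφ, hω]
        rw [hφ, Set.indicator_of_mem hω, Pi.one_apply, one_mul, one_mul]
        by_cases hq : (cusum F 𝒢 e ω.2 u).2 ∈ U
        · refine hcrux j _ hq ?_
          rcases hτu.eq_or_lt with h1 | h1
          · subst h1
            exact Or.inr ⟨by omega, cusum_nonpos_of_entered hω.1.2 hq⟩
          · exact Or.inl ⟨by omega, lt_rrStop_iff.1 hω.2.1 u (by omega) le_rfl⟩
        -- If the position at `u` is outside `U`, the left-hand side vanishes: through the indicator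
        -- when no step remains, through the zero measure otherwise.
        · cases j with
          | zero => simp [hg, hq]
          | succ j =>
            rw [Function.iterate_succ_apply', killedOp, hμ0 _ hq]
            simp
    _ = δ * ∫⁻ ω, φ ω * (killedOp A ξ μ)^[j] 1 (cusum F 𝒢 e ω.2 u) ∂(lawNoChange ρ F) :=
        lintegral_const_mul _ (hφm.mul ((measurable_killedOp_iterate hξ μ measurable_one j).comp
          (measurable_cusum' e u)))
    _ = δ * lawNoChange ρ F W := by
        rw [← key 1 measurable_one]
        simp [lintegral_indicator_one hWm]

/-- Given the history of the affected sources and no alarm, it is unlikely that the statistic is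
large while an unaffected source is sampled. -/
theorem measure_affectedHistory_inter_le (hs : ∀ k, score F 𝒢 k = ξ) (hξ : Measurable ξ)
    (ρ : Measure R) [IsProbabilityMeasure ρ] [IsProbabilityMeasure F] {G : Measure (Fin K → 𝓧)}
    {U : Set (Fin K)} (hU : ∀ d, d ∈ U ↔ e d ∉ affected F G) {μ : Fin K → Measure 𝓧}
    [∀ d, SFinite (μ d)] (hμ : ∀ d ∈ U, marginal F (e d) = μ d) (hμ0 : ∀ d ∉ U, μ d = 0)
    {A : ℝ} {y : ℝ} {δ : ℝ≥0∞} {N : ℕ}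
    (hcrux : ∀ (s : ℕ) (q : ℝ × Fin K), q.2 ∈ U → (s = N ∧ q.1 < A ∨ s ≤ N ∧ q.1 ≤ 0) →
      (killedOp A ξ μ)^[s] ({q | y < q.1 ∧ q.2 ∈ U}.indicator 1) q ≤
        δ * (killedOp A ξ μ)^[s] 1 q)
    {ν : ℕ} {B : Set (Sample R 𝓧 K)}
    (hB : MeasurableSet[affectedHistory F G (rrSampling F 𝒢 e) ν] B) :
    lawNoChange ρ F (B ∩ {ω | (ν : ℕ∞) < rrStop F 𝒢 e A ω} ∩
        {ω | y < (cusum F 𝒢 e ω.2 ν).1 ∧ (cusum F 𝒢 e ω.2 ν).2 ∈ U}) ≤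
      δ * lawNoChange ρ F (B ∩ {ω | (ν : ℕ∞) < rrStop F 𝒢 e A ω}) := by
  have hpol := isPolicy_roundRobin (R := R) F 𝒢 e A
  -- The survival event is split disjointly by the start `τ` of the block in progress at `ν`.
  set W : ℕ → Set (Sample R 𝓧 K) := fun τ =>
    B ∩ (entered R F 𝒢 e U τ ∩ confined R F 𝒢 e A U τ ν) with hW
  set E : Set (Sample R 𝓧 K) :=
    {ω | y < (cusum F 𝒢 e ω.2 ν).1 ∧ (cusum F 𝒢 e ω.2 ν).2 ∈ U} with hE
  have hWm : ∀ τ ∈ Finset.range (ν + 1), MeasurableSet (W τ) := fun τ hτ => by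
    refine hpol.obsFiltration_le ν _ ((hpol.affectedHistory_le F G ν _ hB).inter (.inter ?_
      (measurableSet_confined A U τ ν)))
    exact obsFiltration_mono _ (by have := Finset.mem_range.1 hτ; omega) _
      (measurableSet_entered U τ)
  have hdisj : Set.PairwiseDisjoint (Finset.range (ν + 1) : Set ℕ) W := by
    intro τ hτ τ' hτ' hne
    have h1 := Finset.mem_range.1 hτ
    have h2 := Finset.mem_range.1 hτ'
    refine Set.disjoint_of_subset Set.inter_subset_right Set.inter_subset_right ?_
    rcases hne.lt_or_gt with h | h
    · exact disjoint_entered_confined A U h (by omega)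
    · exact (disjoint_entered_confined A U h (by omega)).symm
  calc _ ≤ lawNoChange ρ F (⋃ τ ∈ Finset.range (ν + 1), W τ ∩ E) := by
        refine measure_mono fun ω hω => ?_
        obtain ⟨τ, hτ, h⟩ := exists_entered_confined A U hω.1.2
        exact Set.mem_biUnion (Finset.mem_range.2 (by omega)) ⟨⟨hω.1.1, h⟩, hω.2⟩
    _ ≤ ∑ τ ∈ Finset.range (ν + 1), lawNoChange ρ F (W τ ∩ E) := measure_biUnion_finset_le _ _
    _ ≤ ∑ τ ∈ Finset.range (ν + 1), δ * lawNoChange ρ F (W τ) :=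
        Finset.sum_le_sum fun τ hτ => measure_affectedHistory_inter_entered_le hs hξ ρ hU hμ hμ0
          hcrux hB (by have := Finset.mem_range.1 hτ; omega)
    _ = δ * lawNoChange ρ F (⋃ τ ∈ Finset.range (ν + 1), W τ) := by
        rw [← Finset.mul_sum, measure_biUnion_finset hdisj hWm]
    _ ≤ _ := by
        gcongr
        exact Set.iUnion₂_subset fun τ _ ω hω => ⟨hω.1, hω.2.2.1⟩

end unaffected

/-! ### The delay of the Round Robin CUSUM -/

section delay

variable {R 𝓧 : Type*} [MeasurableSpace R] [MeasurableSpace 𝓧] {K : ℕ}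

/-- A conditional expectation is bounded by `C` once its integrals over conditioning events are; the
normalization by the mass of `{T > ν}` cancels. -/
theorem IsPolicy.worstDelay_le {S : ℕ → Sample R 𝓧 K → Fin K} {T : Sample R 𝓧 K → ℕ∞}
    (h : IsPolicy S T) (ρ : Measure R) [IsProbabilityMeasure ρ] (F G : Measure (Fin K → 𝓧))
    [IsProbabilityMeasure F] [IsProbabilityMeasure G] {C : ℝ≥0∞}
    (hC : ∀ (ν : ℕ) (B : Set (Sample R 𝓧 K)), MeasurableSet[affectedHistory F G S ν] B →
      ∫⁻ ω in B ∩ {ω | (ν : ℕ∞) < T ω}, ((T ω : ℝ≥0∞) - (ν : ℝ≥0∞)) ∂(lawChange ρ F G ν) ≤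
        C * lawChange ρ F G ν (B ∩ {ω | (ν : ℕ∞) < T ω})) :
    worstDelay ρ F G S T ≤ C := by
  refine iSup_le fun ν => essSup_le_of_ae_le _ ?_
  have : IsProbabilityMeasure (lawChange ρ F G ν) := by
    rw [lawChange_eq]; infer_instance
  have hm : affectedHistory F G S ν ≤ (inferInstance : MeasurableSpace (Sample R 𝓧 K)) :=
    (h.affectedHistory_le F G ν).trans (h.obsFiltration_le ν)
  have hD := h.obsFiltration_le ν _ (h.measurableSet_lt ν)
  have hfin : IsFiniteMeasure (lawGivenNoAlarm ρ F G T ν) := by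
    unfold lawGivenNoAlarm; infer_instance
  refine ae_le_of_ae_le_trim (hm := hm) ?_
  refine ae_le_of_forall_setLIntegral_le_of_sigmaFinite (measurable_condLExp _ _ _)
    fun B hB _ => ?_
  rw [setLIntegral_condLExp_trim hm _ _ hB, setLIntegral_const, trim_measurableSet_eq hm hB]
  unfold lawGivenNoAlarm ProbabilityTheory.cond
  rw [Measure.restrict_smul, lintegral_smul_measure, Measure.restrict_restrict (hm _ hB),
    Measure.smul_apply, Measure.restrict_apply (hm _ hB), smul_eq_mul, smul_eq_mul,
    mul_left_comm]
  gcongr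
  exact hC ν B hB

variable [NeZero K] {F G : Measure (Fin K → 𝓧)} {𝒢 : Set (Measure (Fin K → 𝓧))}
  {e : Equiv.Perm (Fin K)} {ξ : 𝓧 → ℝ} {Fs Gs : Measure 𝓧}

/-- Survival after `ν` is governed by iterates of the killed operator, whose sum is dominated by
`delayBound` at the state reached at `ν`. The law of that state is the one without change, so the
rarity of a large statistic on an unaffected source applies. -/
theorem worstDelay_rrStop_le (h : IsLogRatio ξ Fs Gs) (hs : ∀ k, score F 𝒢 k = ξ)
    (ρ : Measure R) [IsProbabilityMeasure ρ] [IsProbabilityMeasure F] [IsProbabilityMeasure G]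
    (hF : ∀ k, marginal F k = Fs) (hG : ∀ k ∈ affected F G, marginal G k = Gs)
    {U : Set (Fin K)} (hU : ∀ d, d ∈ U ↔ e d ∉ affected F G) (hU' : ∃ d₀, d₀ ∉ U)
    {μ : Fin K → Measure 𝓧} (hμ : ∀ d ∈ U, μ d = Fs) (hμ0 : ∀ d ∉ U, μ d = 0)
    {A ε : ℝ} (hA : 0 < A) (hε : 0 ≤ ε) {N : ℕ}
    (hcrux : ∀ (s : ℕ) (q : ℝ × Fin K), q.2 ∈ U → (s = N ∧ q.1 < A ∨ s ≤ N ∧ q.1 ≤ 0) →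
      (killedOp A ξ μ)^[s] ({q | ε * A < q.1 ∧ q.2 ∈ U}.indicator 1) q ≤
        ENNReal.ofReal ε * (killedOp A ξ μ)^[s] 1 q)
    {I c M α b : ℝ} (hI0 : 0 < I) (hI : I = ∫ x, min (ξ x) c ∂Gs) (hc : 0 ≤ c) (hα : 0 ≤ α)
    (hb : 0 ≤ b) (hαb : α * ∫ x, max (ξ x) (-b) ∂Fs ≤ -1) (hM0 : 0 ≤ M)
    (hM : (M + α * b * K) * ∫ x, Real.exp (1 / 2 * ξ x) ∂Fs ≤ M) :
    worstDelay ρ F G (rrSampling F 𝒢 e) (rrStop F 𝒢 e A) ≤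
      ENNReal.ofReal ((A + c) / I + M + α * b * K + 2 * α * ε * A) := by
  classical
  have := h.left_prob
  have := h.right_prob
  have hpol := isPolicy_roundRobin (R := R) F 𝒢 e A
  have hsf : ∀ d, SFinite (μ d) := fun d => by
    by_cases hd : d ∈ U
    · rw [hμ d hd]; infer_instance
    · rw [hμ0 d hd]; infer_instance
  refine hpol.worstDelay_le ρ F G fun ν B hB => ?_
  have hBo := hpol.affectedHistory_le F G ν _ hB
  set D : Set (Sample R 𝓧 K) := B ∩ {ω | (ν : ℕ∞) < rrStop F 𝒢 e A ω} with hDdef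
  have hDo : MeasurableSet[obsFiltration (rrSampling (R := R) F 𝒢 e) ν] D :=
    hBo.inter (hpol.measurableSet_lt ν)
  have hDm := hpol.obsFiltration_le ν _ hDo
  set E : Set (Sample R 𝓧 K) :=
    {ω | ε * A < (cusum F 𝒢 e ω.2 ν).1 ∧ (cusum F 𝒢 e ω.2 ν).2 ∈ U} with hE
  have hEo : MeasurableSet[obsFiltration (rrSampling (R := R) F 𝒢 e) ν] E :=
    (measurable_cusum F 𝒢 e ν) ((measurable_fst measurableSet_Ioi).inter
      (measurable_snd (Set.toFinite U).measurableSet))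
  have hlaw : ∀ s, MeasurableSet[obsFiltration (rrSampling (R := R) F 𝒢 e) ν] s →
      lawChange ρ F G ν s = lawNoChange ρ F s := fun s hs => by
    rw [← lintegral_indicator_one (hpol.obsFiltration_le ν _ hs),
      ← lintegral_indicator_one (hpol.obsFiltration_le ν _ hs)]
    exact hpol.lintegral_congr_law ρ F G ν
      ((@measurable_const ℝ≥0∞ _ _ (obsFiltration _ ν) 1).indicator hs)
  have hDE : lawChange ρ F G ν (D ∩ E) ≤ ENNReal.ofReal ε * lawChange ρ F G ν D := by
    rw [hlaw _ hDo, hlaw _ (hDo.inter hEo)]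
    exact measure_affectedHistory_inter_le hs h.measurable ρ hU (fun d hd => by rw [hF, hμ d hd])
      hμ0 hcrux hB
  set κ : Fin K → Measure 𝓧 := fun d => marginal G (e d) with hκ
  have hκp : ∀ d, IsProbabilityMeasure (κ d) := fun d => isProbabilityMeasure_marginal G (e d)
  have hV : ∀ q : ℝ × Fin K, q.1 < A →
      1 + killedOp A ξ κ (fun q => ENNReal.ofReal (delayBound U (A + c) I M α b q)) q ≤
        ENNReal.ofReal (delayBound U (A + c) I M α b q) := by
    intro q hq
    by_cases hqU : q.2 ∈ U
    · refine delayBound_step_unaffected h hU' hA hI0 hc hα hb hαb hM0 hqU ?_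
      have : e q.2 ∉ affected F G := (hU _).1 hqU
      simp only [affected, Set.mem_ofPred_eq, not_not] at this
      rw [hκ, ← hF (e q.2)]; exact this
    · exact delayBound_step_affected h hU' hA hI0 hI hc hα hb hM hM0 hq hqU
        (hG _ (by by_contra hc; exact hqU ((hU _).2 hc)))
  have hφo : Measurable[obsFiltration (rrSampling (R := R) F 𝒢 e) ν]
      (D.indicator (1 : Sample R 𝓧 K → ℝ≥0∞)) :=
    (@measurable_const ℝ≥0∞ _ _ (obsFiltration _ ν) 1).indicator hDo
  have hrm : ∀ j, Measurable fun ω : Sample R 𝓧 K => D.indicator (1 : Sample R 𝓧 K → ℝ≥0∞) ω *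
      rrRun F 𝒢 e A Set.univ ν j ω := fun j =>
    (measurable_one.indicator hDm).mul (hpol.measurable (measurable_rrRun_obs A Set.univ ν j))
  have hkm : ∀ j, Measurable fun ω : Sample R 𝓧 K => D.indicator (1 : Sample R 𝓧 K → ℝ≥0∞) ω *
      (killedOp A ξ κ)^[j] 1 (cusum F 𝒢 e ω.2 ν) := fun j =>
    (measurable_one.indicator hDm).mul ((measurable_killedOp_iterate h.measurable κ measurable_one
      j).comp (measurable_cusum' e ν))
  have hC0 : 0 ≤ (A + c) / I + M + α * b * K := by positivity
  calc ∫⁻ ω in D, ((rrStop F 𝒢 e A ω : ℝ≥0∞) - (ν : ℝ≥0∞)) ∂(lawChange ρ F G ν)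
      = ∫⁻ ω, ∑' j, D.indicator 1 ω * rrRun F 𝒢 e A Set.univ ν j ω ∂(lawChange ρ F G ν) := by
        rw [← lintegral_indicator hDm]
        refine lintegral_congr fun ω => ?_
        by_cases hω : ω ∈ D
        swap; · simp [hω]
        rw [Set.indicator_of_mem hω, Set.indicator_of_mem hω, toENNReal_sub_eq_tsum]
        refine tsum_congr fun j => ?_
        have h1 := lt_rrStop_add (F := F) (𝒢 := 𝒢) (e := e) A ω ν j
        rw [Set.indicator_of_mem (by exact hω.2 :
          ω ∈ {ω : Sample R 𝓧 K | (ν : ℕ∞) < rrStop F 𝒢 e A ω})] at h1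
        rw [Pi.one_apply] at h1 ⊢
        rw [← h1]
        simp [Set.indicator_apply]
    _ = ∑' j, ∫⁻ ω, D.indicator 1 ω * rrRun F 𝒢 e A Set.univ ν j ω ∂(lawChange ρ F G ν) :=
        lintegral_tsum fun j => (hrm j).aemeasurable
    _ = ∑' j, ∫⁻ ω, D.indicator 1 ω * (killedOp A ξ κ)^[j] 1 (cusum F 𝒢 e ω.2 ν)
          ∂(lawChange ρ F G ν) := by
        refine tsum_congr fun j => ?_
        have h1 := lintegral_rrRun (e := e) hs h.measurable ρ (changeSeq F G ν) A (U := Set.univ)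
          (u := ν) (μ := κ) j (fun n hn _ d _ => by rw [changeSeq, if_neg (by omega)])
          (fun d hd => absurd (Set.mem_univ d) hd) (measurable_one.indicator hDm)
          (hpol.dependsOnPast hφo) (g := 1) measurable_one
        simpa [lawChange_eq] using h1
    _ = ∫⁻ ω, ∑' j, D.indicator 1 ω * (killedOp A ξ κ)^[j] 1 (cusum F 𝒢 e ω.2 ν)
          ∂(lawChange ρ F G ν) := (lintegral_tsum fun j => (hkm j).aemeasurable).symm
    -- The term `α * max Y 0` on an unaffected source is at most `α * ε * A` off `E` and `α * A` on
    -- `E`; the latter carries a conditional probability at most `ε`.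
    _ ≤ ∫⁻ ω, ENNReal.ofReal ((A + c) / I + M + α * b * K + α * ε * A) * D.indicator 1 ω +
          ENNReal.ofReal (α * A) * (D ∩ E).indicator 1 ω ∂(lawChange ρ F G ν) := by
        refine lintegral_mono fun ω => ?_
        dsimp only
        rw [ENNReal.tsum_mul_left]
        by_cases hω : ω ∈ D
        swap; · simp [hω]
        have hYA : (cusum F 𝒢 e ω.2 ν).1 < A := by
          rcases Nat.eq_zero_or_pos ν with rfl | hν
          · simpa [cusum] using hA
          · exact lt_rrStop_iff.1 hω.2 ν hν le_rfl
        rw [Set.indicator_of_mem hω, Pi.one_apply, one_mul, mul_one]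
        refine (tsum_killedOp_le h.measurable κ hV hYA).trans ?_
        have hEv : ENNReal.ofReal (α * A) * (D ∩ E).indicator 1 ω =
            ENNReal.ofReal (if ω ∈ E then α * A else 0) := by
          by_cases hωE : ω ∈ E <;> simp [Set.indicator, hω, hωE]
        rw [hEv, ← ENNReal.ofReal_add (by positivity) (by split_ifs <;> positivity)]
        refine ENNReal.ofReal_le_ofReal ?_
        set Y := (cusum F 𝒢 e ω.2 ν).1 with hY
        have hY0 : 0 ≤ max Y 0 := le_max_right _ _
        rw [delayBound]
        split_ifs with hd hωE hωE
        · have h1 : α * max Y 0 ≤ α * A :=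
            mul_le_mul_of_nonneg_left (max_le hYA.le hA.le) hα
          have h2 : α * b * exitSteps U (cusum F 𝒢 e ω.2 ν).2 ≤ α * b * K := by
            gcongr; exact exitSteps_le hU' _
          have h3 : 0 ≤ α * ε * A := by positivity
          linarith
        · have h1 : Y ≤ ε * A := by
            by_contra! hc; exact hωE ⟨hc, hd⟩
          have h2 : α * max Y 0 ≤ α * (ε * A) :=
            mul_le_mul_of_nonneg_left (max_le h1 (by positivity)) hα
          have h3 : α * b * exitSteps U (cusum F 𝒢 e ω.2 ν).2 ≤ α * b * K := by
            gcongr; exact exitSteps_le hU' _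
          linarith
        · exact absurd hωE.2 hd
        · have h1 : (A + c - max Y 0) / I ≤ (A + c) / I := by gcongr; linarith
          have h2 : M * Real.exp (-(max Y 0) / 2) ≤ M :=
            mul_le_of_le_one_right hM0 (Real.exp_le_one_iff.2 (by linarith))
          have h3 : 0 ≤ α * ε * A := by positivity
          have h4 : 0 ≤ α * b * K := by positivity
          linarith
    _ = ENNReal.ofReal ((A + c) / I + M + α * b * K + α * ε * A) * lawChange ρ F G ν D +
          ENNReal.ofReal (α * A) * lawChange ρ F G ν (D ∩ E) := by
        have hDEm := hpol.obsFiltration_le ν _ (hDo.inter hEo)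
        rw [lintegral_add_left ((measurable_one.indicator hDm).const_mul _),
          lintegral_const_mul _ (measurable_one.indicator hDm),
          lintegral_const_mul _ (measurable_one.indicator hDEm), lintegral_indicator_one hDm,
          lintegral_indicator_one hDEm]
    _ ≤ ENNReal.ofReal ((A + c) / I + M + α * b * K + α * ε * A) * lawChange ρ F G ν D +
          ENNReal.ofReal (α * A) * (ENNReal.ofReal ε * lawChange ρ F G ν D) := by gcongr
    _ = _ := by
        rw [← mul_assoc, ← add_mul, ← ENNReal.ofReal_mul (by positivity),
          ← ENNReal.ofReal_add (by positivity) (by positivity)]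
        congr 2
        ring

end delay

end RoundRobin

namespace RoundRobin

/-! ### Asymptotic optimality -/

/-- Mutual absolute continuity makes the density strictly positive, so it is the exponential of the
log ratio; both divergences are positive because the laws differ. -/
theorem isLogRatio_llr {𝓧 : Type*} [MeasurableSpace 𝓧] {Fs Gs : Measure 𝓧}
    [IsProbabilityMeasure Fs] [IsProbabilityMeasure Gs] (hne : Gs ≠ Fs)
    (hGF : InformationTheory.klDiv Gs Fs ≠ ∞) (hFG : InformationTheory.klDiv Fs Gs ≠ ∞) :
    IsLogRatio (llr Gs Fs) Fs Gs := by
  have h1 := InformationTheory.klDiv_ne_top_iff.1 hGF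
  have h2 := InformationTheory.klDiv_ne_top_iff.1 hFG
  have hneg : llr Gs Fs =ᵐ[Fs] fun x => -llr Fs Gs x := by
    filter_upwards [neg_llr h2.1] with x hx
    rw [← hx]; rfl
  refine ⟨measurable_llr _ _, inferInstance, inferInstance, ?_, ?_, h1.2, ?_, ?_⟩
  · conv_lhs => rw [← Measure.withDensity_rnDeriv_eq Gs Fs h1.1]
    refine withDensity_congr_ae ?_
    filter_upwards [exp_llr_of_ac' Gs Fs h2.1, Measure.rnDeriv_lt_top Gs Fs] with x hx hlt
    rw [hx, ENNReal.ofReal_toReal hlt.ne]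
  · exact h2.2.neg.congr hneg.symm
  · rw [integral_congr_ae hneg, integral_neg, ← InformationTheory.toReal_klDiv_of_measure_eq h2.1
      (by simp)]
    exact neg_neg_of_pos (ENNReal.toReal_pos
      (fun h => hne (InformationTheory.klDiv_eq_zero_iff.1 h).symm) hFG)
  · rw [← InformationTheory.toReal_klDiv_of_measure_eq h1.1 (by simp)]
    exact ENNReal.toReal_pos (fun h => hne (InformationTheory.klDiv_eq_zero_iff.1 h)) hGF

section asymptotics

variable {R 𝓧 : Type*} [MeasurableSpace 𝓧] {K : ℕ}
  {F G : Measure (Fin K → 𝓧)} {𝒢 : Set (Measure (Fin K → 𝓧))} {e : Equiv.Perm (Fin K)}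
  {ξ : 𝓧 → ℝ} {Fs Gs : Measure 𝓧}

/-- The family of post-change marginals of each source is the singleton `{Gs}`, so the mixture is
`Gs` itself. -/
theorem score_eq_llr (hF : ∀ k, marginal F k = Fs)
    (hG : ∀ G ∈ 𝒢, ∀ k ∈ affected F G, marginal G k = Gs) {k : Fin K}
    (hpost : (postMarginals F 𝒢 k).Nonempty) : score F 𝒢 k = llr Gs Fs := by
  have hset : postMarginals F 𝒢 k = {Gs} := by
    refine Set.eq_singleton_iff_nonempty_unique_mem.2 ⟨hpost, ?_⟩
    rintro P ⟨G, hG1, hk, rfl⟩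
    exact hG G hG1 k hk
  have hmix : mixture F 𝒢 k = Gs := by
    simp [mixture, hset]
  ext x
  rw [score, hmix, hF]

variable [MeasurableSpace R]

/-- The window is `m = ⌊(1 - δ) log γ / I⌋`. Then `(1 + δ) * I * m` is at most `(1 - δ²) log γ`, so
the change of measure leaves a factor `γ ^ (-δ²)` that beats `2m`, and the variance term is of order
`1 / m`. With `ε = 3δ`, one `δ` is spent on the window, one on rounding and one on the error
probability. -/
theorem eventually_le_optimalDelay (h : IsLogRatio ξ Fs Gs) (ρ : Measure R)
    [IsProbabilityMeasure ρ] [IsProbabilityMeasure F] [IsProbabilityMeasure G]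
    (hF : ∀ k, marginal F k = Fs) (hG : ∀ k ∈ affected F G, marginal G k = Gs)
    (hi2 : Integrable (fun x => (ξ x - ∫ y, ξ y ∂Gs) ^ 2) Gs) {ε : ℝ} (hε : 0 < ε) (hε1 : ε < 1) :
    ∀ᶠ γ in atTop, ENNReal.ofReal ((1 - ε) * Real.log γ / ∫ y, ξ y ∂Gs) ≤
      optimalDelay ρ F G γ := by
  have := h.right_prob
  set I := ∫ y, ξ y ∂Gs with hI
  have hI0 : 0 < I := h.right_pos
  set v := ∫ x, (ξ x - I) ^ 2 ∂Gs with hv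
  have hv0 : 0 ≤ v := integral_nonneg fun x => sq_nonneg _
  obtain ⟨δ, rfl⟩ : ∃ δ, ε = 3 * δ := ⟨ε / 3, by ring⟩
  have hδ : 0 < δ := by linarith
  have hδ1 : 0 < 1 - δ := by linarith
  have hlim1 : Tendsto (fun γ => (1 - δ) * Real.log γ / I - 1) atTop atTop :=
    tendsto_atTop_add_const_right _ _
      ((Real.tendsto_log_atTop.const_mul_atTop hδ1).atTop_div_const hI0)
  have hlim2 : Tendsto (fun γ => (δ ^ 2 * Real.log γ) ^ 1 * Real.exp (-(δ ^ 2 * Real.log γ))) atTop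
      (𝓝 0) := (Real.tendsto_pow_mul_exp_neg_atTop_nhds_zero 1).comp
    (Real.tendsto_log_atTop.const_mul_atTop (by positivity))
  filter_upwards [eventually_gt_atTop 1, hlim1.eventually_ge_atTop 1,
    hlim1.eventually_ge_atTop (2 * v / (δ ^ 3 * I ^ 2)),
    Real.tendsto_log_atTop.eventually_ge_atTop (I / δ),
    hlim2.eventually_le_const (by positivity : 0 < δ ^ 3 * I / 4)] with γ h1 h2 h3 h4 h5
  set x := Real.log γ with hx
  have hx0 : 0 < x := Real.log_pos h1
  set m := ⌊(1 - δ) * x / I⌋₊ with hm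
  have hm1 : (m : ℝ) ≤ (1 - δ) * x / I := Nat.floor_le (by positivity)
  have hm2 : (1 - δ) * x / I - 1 < m := by
    have := Nat.lt_floor_add_one ((1 - δ) * x / I)
    linarith
  have hm0 : (0 : ℝ) < m := by linarith
  refine le_iInf fun S => le_iInf fun T => le_iInf fun hT => ?_
  refine le_trans (ENNReal.ofReal_le_ofReal ?_) (hT.1.optimal_lower_bound ρ F G h.measurable hF hG
    h.density h.integrable_right hi2 hI0 (by linarith) hT.2 (m := m)
    (by exact_mod_cast hm0) hδ)
  have hmI : m * I ≤ (1 - δ) * x := (le_div_iff₀ hI0).1 hm1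
  have herr1 : Real.exp ((1 + δ) * I * m) * (2 * m / γ) ≤ δ / 2 := by
    have hγ : γ = Real.exp x := (Real.exp_log (by linarith)).symm
    have e1 : Real.exp ((1 + δ) * I * m) * (2 * m / γ) =
        2 * m * Real.exp ((1 + δ) * I * m - x) := by
      rw [hγ, Real.exp_sub]; ring
    have e2 : Real.exp ((1 + δ) * I * m - x) ≤ Real.exp (-(δ ^ 2 * x)) := by
      refine Real.exp_le_exp.2 ?_
      nlinarith
    have e3 : (m : ℝ) ≤ x / I := hm1.trans (by gcongr; nlinarith)
    rw [e1]
    calc 2 * m * Real.exp ((1 + δ) * I * m - x) ≤ 2 * (x / I) * Real.exp (-(δ ^ 2 * x)) := by gcongr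
      _ = 2 / (δ ^ 2 * I) * ((δ ^ 2 * x) ^ 1 * Real.exp (-(δ ^ 2 * x))) := by field_simp
      _ ≤ 2 / (δ ^ 2 * I) * (δ ^ 3 * I / 4) := by gcongr
      _ = δ / 2 := by field_simp; norm_num
  have herr2 : v / (δ ^ 2 * I ^ 2 * m) ≤ δ / 2 := by
    rw [div_le_iff₀ (by positivity)]
    rw [div_le_iff₀ (by positivity)] at h3
    have := mul_le_mul_of_nonneg_left hm2.le (by positivity : 0 ≤ δ ^ 3 * I ^ 2)
    nlinarith
  have hxI : 1 ≤ δ * x / I := by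
    rw [le_div_iff₀ hI0, one_mul]
    rw [div_le_iff₀ hδ] at h4
    linarith
  calc (1 - 3 * δ) * x / I = (1 - δ) * x / I - δ * x / I - δ * (x / I) := by ring
    _ ≤ (1 - δ) * x / I - 1 - δ * m := by
        have : δ * m ≤ δ * (x / I) := by
          gcongr
          exact hm1.trans (by gcongr; nlinarith)
        linarith
    _ ≤ m * (1 - δ) := by linarith
    _ ≤ _ := by gcongr; linarith

variable [NeZero K]

theorem eventually_worstDelay_rrStop_le (h : IsLogRatio ξ Fs Gs) (hs : ∀ k, score F 𝒢 k = ξ)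
    (ρ : Measure R) [IsProbabilityMeasure ρ] [IsProbabilityMeasure F] [IsProbabilityMeasure G]
    (hF : ∀ k, marginal F k = Fs) (hG : ∀ k ∈ affected F G, marginal G k = Gs)
    (hne : (affected F G).Nonempty) {ε : ℝ} (hε : 0 < ε) :
    ∀ᶠ A in atTop, worstDelay ρ F G (rrSampling F 𝒢 e) (rrStop F 𝒢 e A) ≤
      ENNReal.ofReal ((1 + ε) * A / ∫ y, ξ y ∂Gs) := by
  classical
  set I := ∫ y, ξ y ∂Gs with hI
  have hI0 : 0 < I := h.right_pos
  set U : Set (Fin K) := {d | e d ∉ affected F G} with hU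
  have hU' : ∃ d₀, d₀ ∉ U := by
    obtain ⟨k, hk⟩ := hne
    exact ⟨e.symm k, by simpa [hU] using hk⟩
  obtain ⟨b, hb, hbneg⟩ := h.exists_integral_max_neg
  set α := -1 / ∫ x, max (ξ x) (-b) ∂Fs with hα
  have hα0 : 0 < α := div_pos_of_neg_of_neg (by norm_num) hbneg
  have hαb : α * ∫ x, max (ξ x) (-b) ∂Fs = -1 := div_mul_cancel₀ _ hbneg.ne
  set η := ∫ x, Real.exp (1 / 2 * ξ x) ∂Fs with hη
  have hη1 : 0 < 1 - η := by linarith [h.integral_exp_half_lt_one]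
  have hη0 : 0 ≤ η := integral_nonneg fun x => (Real.exp_pos _).le
  -- The solution of `(M + α * b * K) * η = M`; finite because the Hellinger affinity `η` is below
  -- one.
  set M := α * b * K * η / (1 - η) with hM
  have hM0 : 0 ≤ M := by positivity
  have hMeq : (M + α * b * K) * η = M := by
    rw [hM]; field_simp; ring
  have hclose : I / (1 + ε / 3) < I := by
    rw [div_lt_iff₀ (by positivity)]; nlinarith
  obtain ⟨c, hc1, hc2⟩ := (((IsLogRatio.tendsto_integral_min h.integrable_right).eventually_const_lt
    hclose).and (eventually_ge_atTop 0)).exists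
  set Ic := ∫ x, min (ξ x) c ∂Gs with hIc
  have hIc0 : 0 < Ic := lt_trans (by positivity) hc1
  have hIinv : 1 / Ic ≤ (1 + ε / 3) / I := by
    rw [div_le_div_iff₀ hIc0 hI0]
    rw [div_lt_iff₀ (by positivity)] at hc1
    linarith
  -- Makes `2 * α * ε' * A` equal to a third of `ε * A / I`; the truncation at `c` and the bounded
  -- terms use the other two thirds.
  set ε' := ε / (6 * α * I) with hε'
  have hε0 : 0 < ε' := by positivity
  set μ : Fin K → Measure 𝓧 := fun d => if d ∈ U then Fs else 0 with hμ
  have hμ1 : ∀ d ∈ U, μ d = Fs := fun d hd => if_pos hd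
  have hμ0 : ∀ d ∉ U, μ d = 0 := fun d hd => if_neg hd
  obtain ⟨N, -, hcrux⟩ := exists_killedOp_iterate_le h hU' hμ1 hμ0 hε0 hε0
  filter_upwards [hcrux, eventually_gt_atTop 0,
    eventually_ge_atTop ((c / Ic + M + α * b * K) / (ε / (3 * I)))] with A hA hA0 hA1
  refine (worstDelay_rrStop_le h hs ρ hF hG (fun d => Iff.rfl) hU' hμ1 hμ0 hA0 hε0.le hA hIc0 hIc
    hc2 hα0.le hb hαb.le hM0 hMeq.le).trans (ENNReal.ofReal_le_ofReal ?_)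
  rw [div_le_iff₀ (by positivity)] at hA1
  have e1 : 2 * α * ε' * A = ε / (3 * I) * A := by
    rw [hε']; field_simp; ring
  have e2 : (A + c) / Ic = A * (1 / Ic) + c / Ic := by ring
  have e3 : A * (1 / Ic) ≤ A * ((1 + ε / 3) / I) := by gcongr
  have e4 : (1 + ε) * A / I = A * ((1 + ε / 3) / I) + 2 * (ε / (3 * I) * A) := by
    field_simp; ring
  linarith

/-- The Round Robin CUSUM is asymptotically optimal if the two families of marginal distributions
are singletons. -/
theorem isAsymptoticallyOptimal_roundRobin (h : IsLogRatio ξ Fs Gs)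
    (hs : ∀ k, score F 𝒢 k = ξ) (ρ : Measure R) [IsProbabilityMeasure ρ] [IsProbabilityMeasure F]
    [IsProbabilityMeasure G] (hF : ∀ k, marginal F k = Fs)
    (hG : ∀ k ∈ affected F G, marginal G k = Gs) (hne : (affected F G).Nonempty)
    (hi2 : Integrable (fun x => (ξ x - ∫ y, ξ y ∂Gs) ^ 2) Gs) :
    IsAsymptoticallyOptimal ρ F G (fun _ => rrSampling F 𝒢 e)
      (fun γ => rrStop F 𝒢 e (Real.log γ)) := by
  set I := ∫ y, ξ y ∂Gs with hI
  have hI0 : 0 < I := h.right_pos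
  have hup : ∀ {ε : ℝ}, 0 < ε → ∀ᶠ γ in atTop, worstDelay ρ F G (rrSampling F 𝒢 e)
      (rrStop F 𝒢 e (Real.log γ)) ≤ ENNReal.ofReal ((1 + ε) * Real.log γ / I) := fun hε =>
    Real.tendsto_log_atTop.eventually (eventually_worstDelay_rrStop_le h hs ρ hF hG hne hε)
  have hlow : ∀ {ε : ℝ}, 0 < ε → ε < 1 → ∀ᶠ γ in atTop,
      ENNReal.ofReal ((1 - ε) * Real.log γ / I) ≤ optimalDelay ρ F G γ := fun hε hε1 =>
    eventually_le_optimalDelay h ρ hF hG hi2 hε hε1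
  have hopt : ∀ᶠ γ in atTop, optimalDelay ρ F G γ ≤ worstDelay ρ F G (rrSampling F 𝒢 e)
      (rrStop F 𝒢 e (Real.log γ)) := by
    filter_upwards [eventually_gt_atTop 0] with γ hγ
    refine iInf_le_of_le _ (iInf_le_of_le _ (iInf_le _ ⟨isPolicy_roundRobin F 𝒢 e _, ?_⟩))
    have := exp_le_lintegral_rrStop (e := e) hs h.measurable ρ hF h.lintegral_exp (Real.log γ)
    rwa [Real.exp_log hγ] at this
  -- The ratio is at least one by admissibility of the policy, once the optimal delay is known to be
  -- positive and finite; the upper side compares the two asymptotic bounds.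
  refine tendsto_order.2 ⟨fun a ha => ?_, fun a ha => ?_⟩
  · filter_upwards [hopt, hup one_pos, hlow (ε := 1 / 2) (by norm_num) (by norm_num),
      eventually_gt_atTop 1] with γ h1 h2 h3 h4
    refine ha.trans_le ?_
    have hx : 0 < Real.log γ := Real.log_pos h4
    have hpos : optimalDelay ρ F G γ ≠ 0 :=
      (lt_of_lt_of_le (ENNReal.ofReal_pos.2 (by norm_num; positivity)) h3).ne'
    have hfin : optimalDelay ρ F G γ ≠ ⊤ :=
      ne_top_of_le_ne_top ENNReal.ofReal_ne_top (h1.trans h2)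
    rw [ENNReal.le_div_iff_mul_le (Or.inl hpos) (Or.inl hfin), one_mul]
    exact h1
  · have hlim : Tendsto (fun ε : ℝ => ENNReal.ofReal ((1 + ε) / (1 - ε))) (𝓝[>] 0) (𝓝 1) := by
      have : ContinuousAt (fun ε : ℝ => (1 + ε) / (1 - ε)) 0 := by
        refine ContinuousAt.div (by fun_prop) (by fun_prop) (by norm_num)
      have := (ENNReal.tendsto_ofReal this.tendsto).mono_left (nhdsWithin_le_nhds (s := Set.Ioi 0))
      simpa using this
    obtain ⟨ε, hεa, hε0, hε1⟩ := ((hlim.eventually_lt_const ha).and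
      (Ioo_mem_nhdsGT (one_pos : (0 : ℝ) < 1))).exists
    filter_upwards [hup hε0, hlow hε0 hε1, eventually_gt_atTop 1] with γ h1 h2 h3
    refine lt_of_le_of_lt ?_ hεa
    have hx : 0 < Real.log γ := Real.log_pos h3
    have hε1' : 0 < 1 - ε := by linarith
    calc _ ≤ ENNReal.ofReal ((1 + ε) * Real.log γ / I) /
          ENNReal.ofReal ((1 - ε) * Real.log γ / I) := ENNReal.div_le_div h1 h2
      _ = ENNReal.ofReal ((1 + ε) / (1 - ε)) := by
          rw [← ENNReal.ofReal_div_of_pos (by positivity)]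
          congr 1
          field_simp

end asymptotics

end RoundRobin

theorem mainTheorem8
    {R 𝓧 : Type*} [MeasurableSpace R] [MeasurableSpace 𝓧] {K : ℕ} [NeZero K]
    -- initial randomization, and the order in which the sources are visited
    (ρ : Measure R) [IsProbabilityMeasure ρ] (e : Equiv.Perm (Fin K))
    -- pre-change distribution and family of post-change distributions
    (F : Measure (Fin K → 𝓧)) [IsProbabilityMeasure F]
    (𝒢 : Set (Measure (Fin K → 𝓧))) (h𝒢 : ∀ G ∈ 𝒢, IsProbabilityMeasure G)
    -- every post-change distribution affects a source, every source is affected by one of them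
    (haffected : ∀ G ∈ 𝒢, (RoundRobin.affected F G).Nonempty)
    (hpost : ∀ k, (RoundRobin.postMarginals F 𝒢 k).Nonempty)
    -- common marginal distributions
    (Fs Gs : Measure 𝓧)
    (hF : ∀ k, RoundRobin.marginal F k = Fs)
    (hG : ∀ G ∈ 𝒢, ∀ k ∈ RoundRobin.affected F G, RoundRobin.marginal G k = Gs)
    -- finite Kullback-Leibler divergences
    (hGF : InformationTheory.klDiv Gs Fs ≠ ∞)
    (hFG : InformationTheory.klDiv Fs Gs ≠ ∞)
    -- second-moment condition
    (hsq : ∀ G ∈ 𝒢, ∀ k ∈ RoundRobin.affected F G,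
      Integrable (fun x => (llr (RoundRobin.marginal G k) (RoundRobin.marginal F k) x) ^ 2)
        (RoundRobin.marginal G k)) :
    ∀ G ∈ 𝒢,
      RoundRobin.IsAsymptoticallyOptimal ρ F G
        (fun _ => RoundRobin.rrSampling F 𝒢 e)
        (fun γ => RoundRobin.rrStop F 𝒢 e (Real.log γ)) := by
  intro G hGm
  have := h𝒢 G hGm
  obtain ⟨k, hk⟩ := haffected G hGm
  have hGs : IsProbabilityMeasure Gs :=
    hG G hGm k hk ▸ RoundRobin.isProbabilityMeasure_marginal G k
  have hFs : IsProbabilityMeasure Fs := hF k ▸ RoundRobin.isProbabilityMeasure_marginal F k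
  have hne : Gs ≠ Fs := by
    rw [← hG G hGm k hk, ← hF k]
    exact hk
  have hllr := RoundRobin.isLogRatio_llr hne hGF hFG
  refine RoundRobin.isAsymptoticallyOptimal_roundRobin hllr
    (fun k => RoundRobin.score_eq_llr hF hG (hpost k)) ρ hF (hG G hGm) ⟨k, hk⟩ ?_
  have hsq' := hsq G hGm k hk
  rw [hG G hGm k hk, hF k] at hsq'
  -- The second moment is assumed about zero but used about the mean; square integrability passes
  -- from one to the other.
  have hmem : MemLp (llr Gs Fs) 2 Gs :=
    (memLp_two_iff_integrable_sq hllr.measurable.aestronglyMeasurable).2 hsq'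
  exact (hmem.sub (memLp_const _)).integrable_sq
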